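/- **Setting.** A market consists of $N$ users and $L$ providers, $1\le L\le N$; let $\mathcal A$ be the set of all agents. Each agent $a$ has true preferences $\mu(a,a')\ge 0$ over the agents $a'$ of the other side and over $\emptyset$ (being unmatched), with $\mu(a,\emptyset)=0$ and $\mu(a,a')\ne\mu(a,a'')$ for $a'\neq a''$. A feasible matching $M$ matches each provider to exactly one user and each user to at most one provider; $\mathcal W$ is the set of feasible matchings and $M(a)$ is the match of $a$ ($\emptyset$ if none). For a payoff function $V$, $S(V)$ is the set of $M\in\mathcal W$ for which no user $u$ and provider $p$ satisfy both $V(u,M(u))<V(u,p)$ and $V(p,M(p))<V(p,u)$. Put $\Delta_{\max}(a)=\max_{a_1,a_2}(\mu(a,a_1)-\mu(a,a_2))$ and $\Delta_{\min}=\min_{a,\,a_2\ne a_3}|\mu(a,a_2)-\mu(a,a_3)|$, where $a_1,a_2,a_3$ range over the agents of the other side of $a$ and $\emptyset$. Let $\sigma\ge0$ and $\alpha>2$. For $a,b$ on opposite sides let $\mathcal D(a,b)$ be a $\sigma^2$-sub-Gaussian distribution centred at $\mu(a,b)$. Agent $a$ starts with $T_0(a,b)=T_0(b,a)>0$ samples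 of $\mathcal D(a,b)$; at time $t=1,2,\dots$ it gets the reward $X_t(a,b)\sim\mathcal D(a,b)$ if it is matched to $b$ ($X_t(a,\emptyset)=0$). All these samples and rewards are independent. With $T_{t-1}(a,b)$ the number of samples that $a$ has of $b$ before time $t$ and $\hat\mu_t(a,b)$ their mean, $a$ reports $$\nu_t(a,b)=\hat\mu_t(a,b)+\sqrt{2\sigma^2\alpha\log t/T_{t-1}(a,b)},\qquad \nu_t(a,\emptyset)=0,$$ and the platform assigns the matching $\mathcal M(\cdot\,;\nu_t)\in\mathcal W$, a (measurable) function of $\nu_t$. Costs are proportional with rate $\gamma\in[0,1]$ and there are no transfers: under preferences $\psi$ the cost of $a$ for $a'$ is $\gamma\psi(a,a')$. So $V(a,a';\psi)=(1-\gamma)\psi(a,a')$, and the observed payoff is $U_t(a,a';\nu_t)=X_t(a,a')-\gamma\nu_t(a,a')$. The system is incentive-compatible if $\mathcal M(\cdot\,;\nu_t)\in S(V(\cdot,\cdot\,;\nu_t))$ for all $t\le T$. Let $\overline M{}^a_t$ and $\underline M{}^a_t$ maximize and minimize $\mathbb E[U_t(a,M(a);\nu_t)]$ over $M\in S(V(\cdot,\cdot\,;\mu))$.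 The optimal regret of $a$ with horizon $T$ is $\overline R_T(a)=\mathbb E\sum_{t=1}^T\big(U_t(a,\overline M{}^a_t(a);\nu_t)-U_t(a,\mathcal M(a;\nu_t);\nu_t)\big)$, and the pessimal regret $\underline R_T(a)$ is the same with $\underline M{}^a_t$. The system is unfair if for some $A'\subset\mathcal A$ with $0<|A'|<|\mathcal A|$ there are $a\in A'$ with $\overline R_T(a)=O(\log T)$ and $a'\in\mathcal A\setminus A'$ with $\overline R_T(a')=\omega(\log T)$ as $T\to\infty$. Social welfare is high at time $t$ if $\sum_a V(a,\mathcal M(a;\nu_t);\nu_t)\ge\frac12\max_{M\in\mathcal W}\sum_a V(a,M(a);\nu_t)$. "$\mathcal M$ is Gale–Shapley" means that, for every information state $\psi$, $\mathcal M(\cdot\,;\psi)$ is returned by the provider-proposing Gale–Shapley algorithm over $V(\cdot,\cdot\,;\psi)$, with any order of the proposers and any tie-breaking in the providers' rankings. **Proposition.** Let $\gamma\in[0,1]$. 1. In every market, if $\mathcal M$ is Gale–Shapley, the system is incentive-compatible. 2. If $\gamma<1$ and $\mathcal M$ is Gale–Shapley, then in every market, for every agent $a$ and every horizon $T\ge 2$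 (and also for $T=1$ if $\gamma=0$), $$\underline R_T(a)\le 2N^2L\,(1-\gamma)\,\Delta_{\max}(a)\left(\frac{8\sigma^2\alpha\log T}{(1-\gamma)^2\Delta_{\min}^2}+\frac{\alpha}{\alpha-2}\right).$$ 3. If $\gamma<1$, incentive compatibility guarantees neither fairness nor high social welfare, and optimal regret may be linear: (a) there are $(\mathcal A,\mu)$ for which the system is unfair, for all $\sigma,\alpha,\mathcal D,T_0$ and every Gale–Shapley $\mathcal M$; (b) there are $(\mathcal A,\mu)$ such that, for all $\sigma,\alpha,\mathcal D,T_0$ and every incentive-compatible $\mathcal M$, for all large $T$ it is not almost sure that social welfare is high at every $t\le T$; (c) there are $(\mathcal A,\mu)$ such that, for all $\sigma,\alpha,\mathcal D,T_0$ and every Gale–Shapley $\mathcal M$, some agent $a$ has $\overline R_T(a)=\Omega(T)$ as $T\to\infty$. -/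

import Mathlib

open MeasureTheory ProbabilityTheory Filter
open scoped NNReal

universe u

/-! ### Agents, preferences, matchings -/

/-- The agents: `N` users (left) and `L` providers (right). -/
abbrev Agent (N L : ℕ) : Type := Fin N ⊕ Fin L

/-- The agents on the other side of the market from `a`. -/
abbrev Opp {N L : ℕ} : Agent N L → Type
  | .inl _ => Fin L
  | .inr _ => Fin N

instance {N L : ℕ} : (a : Agent N L) → Fintype (Opp a)
  | .inl _ => inferInstanceAs (Fintype (Fin L))
  | .inr _ => inferInstanceAs (Fintype (Fin N))

instance {N L : ℕ} : (a : Agent N L) → DecidableEq (Opp a)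
  | .inl _ => inferInstanceAs (DecidableEq (Fin L))
  | .inr _ => inferInstanceAs (DecidableEq (Fin N))

/-- A real function `ψ(a, a')` of an agent `a` and of an `a'` that is an agent on the other side
or nobody (`none`): preferences, payoffs, costs, transfers, information states. -/
abbrev Info (N L : ℕ) : Type := (a : Agent N L) → Option (Opp a) → ℝ

/-- A feasible matching: each user has at most one provider, each provider exactly one user. -/
@[ext]
structure Matching (N L : ℕ) where
  user : Fin N → Option (Fin L)
  prov : Fin L → Option (Fin N)
  consistent : ∀ u p, user u = some p ↔ prov p = some u
  full : ∀ p, prov p ≠ none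

/-- The match of agent `a`. -/
def Matching.partner {N L : ℕ} (M : Matching N L) : (a : Agent N L) → Option (Opp a)
  | .inl u => M.user u
  | .inr p => M.prov p

instance {N L : ℕ} : MeasurableSpace (Matching N L) := ⊤

/-- The set `S(V)` of the matchings that no user-provider pair wants to leave. -/
def stableSet {N L : ℕ} (V : Info N L) : Set (Matching N L) :=
  {M | ¬ ∃ (u : Fin N) (p : Fin L),
    V (.inl u) (M.user u) < V (.inl u) (some p) ∧ V (.inr p) (M.prov p) < V (.inr p) (some u)}

/-! ### The Gale-Shapley algorithm with providers as proposers -/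

/-- A configuration of the algorithm: the current partial matching and the providers' queues. -/
structure GSState (N L : ℕ) where
  user : Fin N → Option (Fin L)
  prov : Fin L → Option (Fin N)
  queue : Fin L → List (Fin N)

/-- `q` lists all users in order of decreasing preference of provider `p` (ties in any order). -/
def IsQueue {N L : ℕ} (V : Info N L) (p : Fin L) (q : List (Fin N)) : Prop :=
  q.Nodup ∧ (∀ u, u ∈ q) ∧ q.Pairwise fun u u' => V (.inr p) (some u') ≤ V (.inr p) (some u)

/-- One pass through the loop: some unmatched provider `p` proposes to the first user `u` left in
its queue. -/
inductive GSStep {N L : ℕ} (V : Info N L) : GSState N L → GSState N L → Prop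
  /-- `u` is unmatched and accepts. -/
  | accept (s : GSState N L) (p : Fin L) (u : Fin N) (rest : List (Fin N))
      (hp : s.prov p = none) (hq : s.queue p = u :: rest) (hu : s.user u = none) :
      GSStep V s
        { user := Function.update s.user u (some p)
          prov := Function.update s.prov p (some u)
          queue := Function.update s.queue p rest }
  /-- `u` prefers `p` to its current match `p'` and switches. -/
  | switch (s : GSState N L) (p : Fin L) (u : Fin N) (rest : List (Fin N)) (p' : Fin L)
      (hp : s.prov p = none) (hq : s.queue p = u :: rest) (hu : s.user u = some p')
      (hV : V (.inl u) (some p') < V (.inl u) (some p)) :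
      GSStep V s
        { user := Function.update s.user u (some p)
          prov := Function.update (Function.update s.prov p' none) p (some u)
          queue := Function.update s.queue p rest }
  /-- `u` does not prefer `p` to its current match `p'` and rejects. -/
  | reject (s : GSState N L) (p : Fin L) (u : Fin N) (rest : List (Fin N)) (p' : Fin L)
      (hp : s.prov p = none) (hq : s.queue p = u :: rest) (hu : s.user u = some p')
      (hV : ¬ V (.inl u) (some p') < V (.inl u) (some p)) :
      GSStep V s
        { user := s.user
          prov := s.prov
          queue := Function.update s.queue p rest }

/-- `M` is returned by some run of the algorithm over payoffs `V`: start from the empty matching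
with full queues, loop until every provider is matched. The order of the proposers and the order
of tied users in the queues are free. -/
def GSReturns {N L : ℕ} (V : Info N L) (M : Matching N L) : Prop :=
  ∃ Q : Fin L → List (Fin N), (∀ p, IsQueue V p (Q p)) ∧
    ∃ s : GSState N L,
      Relation.ReflTransGen (GSStep V)
        { user := fun _ => none, prov := fun _ => none, queue := Q } s ∧
      (∀ p, s.prov p ≠ none) ∧ s.user = M.user ∧ s.prov = M.prov

/-! ### The platform -/

/-- The platform's rules: a matching mechanism, a cost rule and a transfer rule, each applied to
the reported information state. -/
structure Platform (N L : ℕ) where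
  mech : Info N L → Matching N L
  cost : Info N L → Info N L
  transfer : Info N L → Info N L

/-- The payoff `V(a, a'; ψ) = ψ(a, a') - C(a, a'; ψ) + T(a, a'; ψ)`. -/
def Platform.payoff {N L : ℕ} (F : Platform N L) (ψ : Info N L) : Info N L :=
  fun a o => ψ a o - F.cost ψ a o + F.transfer ψ a o

/-- Proportional costs of rate `γ` and no transfers. -/
def proportional {N L : ℕ} (γ : ℝ) (mech : Info N L → Matching N L) : Platform N L where
  mech := mech
  cost := fun ψ a o => γ * ψ a o
  transfer := fun _ _ _ => 0

/-- The mechanism always returns an output of the Gale-Shapley algorithm over the payoffs. -/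
def Platform.IsGaleShapley {N L : ℕ} (F : Platform N L) : Prop :=
  ∀ ψ : Info N L, GSReturns (F.payoff ψ) (F.mech ψ)

/-! ### The market and the learning process -/

/-- The setting: the agents and their true preferences. -/
structure Market (N L : ℕ) where
  pos : 0 < L
  le : L ≤ N
  μ : Info N L
  nonneg : ∀ a o, 0 ≤ μ a o
  none_eq : ∀ a, μ a none = 0
  no_ties : ∀ a, Function.Injective (μ a)

/-- `Δ_max(a)`, the largest difference of two true preferences of `a`. -/
noncomputable def Market.gapMax {N L : ℕ} (m : Market N L) (a : Agent N L) : ℝ :=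
  ⨆ x : Option (Opp a) × Option (Opp a), (m.μ a x.1 - m.μ a x.2)

/-- `Δ_min`, the smallest distance of two true preferences of one agent. -/
noncomputable def Market.gapMin {N L : ℕ} (m : Market N L) : ℝ :=
  ⨅ x : {x : (a : Agent N L) × (Option (Opp a) × Option (Opp a)) // x.2.1 ≠ x.2.2},
    |m.μ x.1.1 x.1.2.1 - m.μ x.1.1 x.1.2.2|

/-- The rest of the model over the probability space `Ω`: sub-Gaussian reward distributions
`D(a, a')` centred at the true preferences, the confidence parameter `α > 2`, the (symmetric) numbers
of initial samples, and independent rewards: `X₀ a b τ` are the initial samples (those with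
`τ < T₀` are used), `X a b t` is the reward of `a` from `b` at time `t = 1, 2, …`. -/
structure Env {N L : ℕ} (m : Market N L) (Ω : Type u) [MeasurableSpace Ω] where
  P : Measure Ω
  isProb : IsProbabilityMeasure P
  σ : ℝ≥0
  α : ℝ
  two_lt : 2 < α
  T₀ : Fin N → Fin L → ℕ
  T₀_pos : ∀ u p, 0 < T₀ u p
  D : (a : Agent N L) → Opp a → Measure ℝ
  subGaussian : ∀ a b, HasSubgaussianMGF (fun x : ℝ => x - m.μ a (some b)) (σ ^ 2) (D a b)
  X₀ : (a : Agent N L) → Opp a → ℕ → Ω → ℝ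
  X : (a : Agent N L) → Opp a → ℕ → Ω → ℝ
  measurable₀ : ∀ a b τ, Measurable (X₀ a b τ)
  measurable : ∀ a b t, Measurable (X a b t)
  law₀ : ∀ a b τ, P.map (X₀ a b τ) = D a b
  law : ∀ a b t, P.map (X a b t) = D a b
  indep : iIndepFun
    (fun i : ((a : Agent N L) × Opp a) × (ℕ ⊕ ℕ) =>
      Sum.elim (X₀ i.1.1 i.1.2) (X i.1.1 i.1.2) i.2) P

/-- What has been sampled so far: numbers of samples and sums of the sampled rewards. -/
structure Tally (N L : ℕ) where
  count : (a : Agent N L) → Opp a → ℕ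
  total : (a : Agent N L) → Opp a → ℝ

namespace Env

variable {N L : ℕ} {m : Market N L} {Ω : Type u} [MeasurableSpace Ω]

/-- The number of initial samples that `a` has of `b`. -/
def init (E : Env m Ω) : (a : Agent N L) → Opp a → ℕ
  | .inl u, p => E.T₀ u p
  | .inr p, u => E.T₀ u p

/-- The upper confidence bounds at time `t`, computed from a tally. -/
noncomputable def ucb (E : Env m Ω) (t : ℕ) (s : Tally N L) : Info N L
  | _, none => 0
  | a, some b => s.total a b / s.count a b +
      Real.sqrt (2 * (E.σ : ℝ) ^ 2 * E.α * Real.log t / s.count a b)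

/-- The tally after time `t`: `T_t(a, b)` and the sum of the rewards that `a` got from `b`. At time
`t + 1` the platform matches according to the upper confidence bounds, and every matched agent
adds its reward. -/
noncomputable def tally (E : Env m Ω) (F : Platform N L) (ω : Ω) : ℕ → Tally N L
  | 0 =>
    { count := E.init
      total := fun a b => ∑ τ ∈ Finset.range (E.init a b), E.X₀ a b τ ω }
  | t + 1 =>
    { count := fun a b => (tally E F ω t).count a b +
        if (F.mech (E.ucb (t + 1) (tally E F ω t))).partner a = some b then 1 else 0
      total := fun a b => (tally E F ω t).total a b +
        if (F.mech (E.ucb (t + 1) (tally E F ω t))).partner a = some b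
          then E.X a b (t + 1) ω else 0 }

/-- The information state `ν_t`, for `t = 1, 2, …`. -/
noncomputable def ν (E : Env m Ω) (F : Platform N L) (t : ℕ) (ω : Ω) : Info N L :=
  E.ucb t (E.tally F ω (t - 1))

/-- The match `M(a; ν_t)`. -/
noncomputable def matched (E : Env m Ω) (F : Platform N L) (t : ℕ) (ω : Ω) : Matching N L :=
  F.mech (E.ν F t ω)

/-- The reward `X_t(a, a')`, with `X_t(a, ∅) = 0`. -/
def reward (E : Env m Ω) (t : ℕ) (ω : Ω) : Info N L
  | _, none => 0
  | a, some b => E.X a b t ω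

/-- The observed payoff `U_t(a, a'; ν_t) = X_t(a, a') - C(a, a'; ν_t) + T(a, a'; ν_t)`. -/
noncomputable def U (E : Env m Ω) (F : Platform N L) (t : ℕ) (ω : Ω) : Info N L :=
  fun a o => E.reward t ω a o - F.cost (E.ν F t ω) a o + F.transfer (E.ν F t ω) a o

/-! ### The four desiderata -/

/-- Incentive compatibility up to the horizon `T`. -/
def IncentiveCompatible (E : Env m Ω) (F : Platform N L) (T : ℕ) : Prop :=
  ∀ t ∈ Finset.Icc 1 T, ∀ ω, E.matched F t ω ∈ stableSet (F.payoff (E.ν F t ω))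

/-- `M` is, for `a` at time `t`, best in expectation among the truly stable matchings. -/
def IsOptimal (E : Env m Ω) (F : Platform N L) (a : Agent N L) (t : ℕ) (M : Matching N L) : Prop :=
  M ∈ stableSet (F.payoff m.μ) ∧ ∀ M' ∈ stableSet (F.payoff m.μ),
    ∫ ω, E.U F t ω a (M'.partner a) ∂E.P ≤ ∫ ω, E.U F t ω a (M.partner a) ∂E.P

/-- `M` is, for `a` at time `t`, worst in expectation among the truly stable matchings. -/
def IsPessimal (E : Env m Ω) (F : Platform N L) (a : Agent N L) (t : ℕ) (M : Matching N L) : Prop :=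
  M ∈ stableSet (F.payoff m.μ) ∧ ∀ M' ∈ stableSet (F.payoff m.μ),
    ∫ ω, E.U F t ω a (M.partner a) ∂E.P ≤ ∫ ω, E.U F t ω a (M'.partner a) ∂E.P

open Classical in
/-- An optimal matching of `a` at time `t` (one always exists, the set of stable matchings being
finite and non-empty; the other branch is never taken). -/
noncomputable def optimalMatching (E : Env m Ω) (F : Platform N L) (a : Agent N L) (t : ℕ) :
    Matching N L :=
  if h : ∃ M, E.IsOptimal F a t M then h.choose else F.mech m.μ

open Classical in
/-- A pessimal matching of `a` at time `t` (one always exists, the set of stable matchings being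
finite and non-empty; the other branch is never taken). -/
noncomputable def pessimalMatching (E : Env m Ω) (F : Platform N L) (a : Agent N L) (t : ℕ) :
    Matching N L :=
  if h : ∃ M, E.IsPessimal F a t M then h.choose else F.mech m.μ

/-- The optimal regret of `a` up to the horizon `T`. -/
noncomputable def optimalRegret (E : Env m Ω) (F : Platform N L) (a : Agent N L) (T : ℕ) : ℝ :=
  ∫ ω, ∑ t ∈ Finset.Icc 1 T,
    (E.U F t ω a ((E.optimalMatching F a t).partner a)
      - E.U F t ω a ((E.matched F t ω).partner a)) ∂E.P

/-- The pessimal regret of `a` up to the horizon `T`. -/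
noncomputable def pessimalRegret (E : Env m Ω) (F : Platform N L) (a : Agent N L) (T : ℕ) : ℝ :=
  ∫ ω, ∑ t ∈ Finset.Icc 1 T,
    (E.U F t ω a ((E.pessimalMatching F a t).partner a)
      - E.U F t ω a ((E.matched F t ω).partner a)) ∂E.P

/-- The platform is unfair: some agents, but not all, form a set `A'` such that an agent in `A'` has
optimal regret `O(log T)` and an agent outside `A'` has optimal regret `ω(log T)`. -/
def Unfair (E : Env m Ω) (F : Platform N L) : Prop :=
  ∃ A' : Finset (Agent N L), 0 < A'.card ∧ A'.card < Fintype.card (Agent N L) ∧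
    ∃ a ∈ A', ∃ a' ∉ A',
      (∃ C : ℝ, ∀ᶠ T : ℕ in atTop, E.optimalRegret F a T ≤ C * Real.log T) ∧
      (∀ C : ℝ, ∀ᶠ T : ℕ in atTop, C * Real.log T ≤ E.optimalRegret F a' T)

/-- The social welfare of the matching `M` under the payoffs at time `t`. -/
noncomputable def welfare (E : Env m Ω) (F : Platform N L) (t : ℕ) (ω : Ω) (M : Matching N L) : ℝ :=
  ∑ a, F.payoff (E.ν F t ω) a (M.partner a)

/-- The social welfare at time `t` is at least half of the largest one of a feasible matching. -/
def HighWelfare (E : Env m Ω) (F : Platform N L) (t : ℕ) (ω : Ω) : Prop :=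
  (1 / 2 : ℝ) * (⨆ M : Matching N L, E.welfare F t ω M) ≤ E.welfare F t ω (E.matched F t ω)

end Env

/-!
Stability of the Gale-Shapley outcome is an invariant of a run: a provider proposes in decreasing
order of payoff, and the match of a user only improves (`GSReturns.mem_stableSet`). Every
occurrence of "the platform errs" below is then reduced to one event, `Env.Overvalued`: some agent
truly prefers another option to its match and does not rank it higher. A match that is stable for
the reports but not for the true preferences is overvalued, by the definition of a blocking pair.

The reports are upper confidence bounds. Since the matching at time `t` depends on the past only,
the exponentials `Env.expDev` of the sampled rewards form supermartingales although the numbers of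
samples are random, and a union bound over these numbers shows that the confidence intervals fail
at time `t` with probability `O(t ^ (1 - α))` and that the expected error beyond their width is of
the same order (`Env.exists_dominating`). When no interval fails, an overvalued match has a width
of at least `Δ_min / 2`, hence at most `8σ²α log T / Δ_min²` samples. As each match adds a sample,
overvalued matches occur `O(log T)` times in expectation (`Env.sum_overvalued_le`).

For the regret, the reward of time `t` is independent of the match of time `t`, so only `μ - γ ν`
matters (`Env.integral_regret`). The true preferences contribute the loss of an overvalued match.
The reports contribute `γ` times noise and optimism; the optimism is felt only where the width of
the matched pair exceeds `(1 - γ) Δ_min`, up to a constant factor, and such widths have a sum of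
order `log T / Δ_min` (`Env.sum_max_div_sqrt_le`). This is `Env.sum_regret_le`. For the pessimal
regret it is applied with the truly worst stable partner of `a`, and the resulting sum is brought
into the required form in `regret_bound_arith`; there the noise, of order `σ`, is split by the
inequality of arithmetic and geometric means between the logarithmic and the constant part, which
needs `log T` to be bounded below, whence `T ≥ 2` if `γ > 0`.

The counterexamples are two markets. In `welfareMarket` the only stable matching forgoes nearly
all welfare; it is chosen and accurately valued at all but `O(log T)` times in expectation, so for
large `T` the welfare is low at some `t ≤ T` with positive probability. In `crossedMarket` both
perfect matchings are stable, and the algorithm gives the providers their favourites unless a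
match is overvalued, so the optimal regret of a provider is `O(log T)`. A user would rather have
the other partner, but the cost is proportional to the report, and an unexplored partner has a
huge report that could make it worthless for the observed payoff. The stability of the matching
for the reports excludes this: were the width of the pair of user `0` and provider `0` large, both
would rank each other above their matches and block the matching
(`crossedMarket.width_diagonal_le`). To compare the optimism of a report with its noise, the noise
is bounded there by the width with parameter `α / 2`, which is smaller by the factor `√2`, and
whose failures still have vanishing frequency because `α / 2 > 1`. So the width stays of the order
of the small preference gap `δ` of the providers and the optimal regret of the user is linear.
-/

/-! ### Feasible matchings -/

instance {N L : ℕ} : Finite (Matching N L) := by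
  refine Finite.of_injective (fun M : Matching N L => (M.user, M.prov)) fun M M' h => ?_
  simp only [Prod.mk.injEq] at h
  exact Matching.ext h.1 h.2

lemma Matching.partner_inl_iff {N L : ℕ} (M : Matching N L) (u : Fin N) (p : Fin L) :
    M.partner (.inl u) = some p ↔ M.partner (.inr p) = some u := M.consistent u p

/-- With a single user the market has only one feasible matching. -/
lemma Matching.partner_eq_of_card_one {N L : ℕ} (hN : N = 1) (hL : 0 < L) (hLN : L ≤ N)
    (M M' : Matching N L) (a : Agent N L) : M.partner a = M'.partner a := by
  subst hN
  obtain rfl : L = 1 := by omega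
  have h : ∀ (M : Matching 1 1) (u p : Fin 1), M.prov p = some u := by
    intro M u p
    obtain ⟨u', hu'⟩ := Option.ne_none_iff_exists'.1 (M.full p)
    rw [hu', Subsingleton.elim u' u]
  rcases a with u | p
  · exact ((M.consistent u 0).2 (h M u 0)).trans ((M'.consistent u 0).2 (h M' u 0)).symm
  · exact (h M 0 p).trans (h M' 0 p).symm

/-! ### The Gale-Shapley algorithm -/

section GaleShapley

variable {N L : ℕ} {V : Info N L}

/-- The outcome of the algorithm is stable: a user that `p` prefers to its match has had a proposal
of `p`, and the match of a user only improves over a run. -/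
lemma GSReturns.mem_stableSet {M : Matching N L} (h : GSReturns V M) : M ∈ stableSet V := by
  obtain ⟨Q, hQ, s, hs, hfin, hu, hp⟩ := h
  have inv : (∀ p, (s.queue p).Pairwise fun u u' => V (.inr p) (some u') ≤ V (.inr p) (some u)) ∧
      (∀ p u, s.prov p = some u → ∀ u' ∈ s.queue p, V (.inr p) (some u') ≤ V (.inr p) (some u)) ∧
      (∀ p u, u ∉ s.queue p →
        ∃ p', s.user u = some p' ∧ V (.inl u) (some p) ≤ V (.inl u) (some p')) := by
    clear hfin hu hp
    induction hs with
    | refl => exact ⟨fun p => (hQ p).2.2, by simp, fun p u h => absurd ((hQ p).2.1 u) h⟩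
    | tail _ step ih =>
      obtain ⟨i1, i2, i3⟩ := ih
      cases step with
      | accept p u rest hp hq hu =>
        have hsort := i1 p
        rw [hq, List.pairwise_cons] at hsort
        refine ⟨fun q => ?_, fun q v hv w hw => ?_, fun q v hv => ?_⟩
        · rcases eq_or_ne q p with rfl | h
          · simpa using hsort.2
          · simpa [h] using i1 q
        · rcases eq_or_ne q p with rfl | h
          · simp only [Function.update_self, Option.some.injEq] at hv hw
            exact hv ▸ hsort.1 w hw
          · simp only [Function.update_of_ne h] at hv hw
            exact i2 q v hv w hw
        · rcases eq_or_ne v u with rfl | hvu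
          · rcases eq_or_ne q p with rfl | h
            · exact ⟨q, by simp, le_rfl⟩
            · simp only [Function.update_of_ne h] at hv
              obtain ⟨p', h1, _⟩ := i3 q v hv
              rw [hu] at h1
              cases h1
          · obtain ⟨p', h1, h2⟩ := i3 q v fun hmem => hv <| by
              rcases eq_or_ne q p with rfl | h
              · rw [hq] at hmem
                simpa [hvu] using hmem
              · simpa [h] using hmem
            exact ⟨p', by simpa [hvu] using h1, h2⟩
      | switch p u rest p₀ hp hq hu hV =>
        have hsort := i1 p
        rw [hq, List.pairwise_cons] at hsort
        refine ⟨fun q => ?_, fun q v hv w hw => ?_, fun q v hv => ?_⟩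
        · rcases eq_or_ne q p with rfl | h
          · simpa using hsort.2
          · simpa [h] using i1 q
        · rcases eq_or_ne q p with rfl | h
          · simp only [Function.update_self, Option.some.injEq] at hv hw
            exact hv ▸ hsort.1 w hw
          · simp only [Function.update_of_ne h] at hv hw
            rcases eq_or_ne q p₀ with rfl | h0
            · simp at hv
            · simp only [Function.update_of_ne h0] at hv
              exact i2 q v hv w hw
        · rcases eq_or_ne v u with rfl | hvu
          · refine ⟨p, by simp, ?_⟩
            rcases eq_or_ne q p with rfl | h
            · exact le_rfl
            · simp only [Function.update_of_ne h] at hv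
              obtain ⟨p', h1, h2⟩ := i3 q v hv
              rw [hu] at h1
              cases h1
              exact h2.trans hV.le
          · obtain ⟨p', h1, h2⟩ := i3 q v fun hmem => hv <| by
              rcases eq_or_ne q p with rfl | h
              · rw [hq] at hmem
                simpa [hvu] using hmem
              · simpa [h] using hmem
            exact ⟨p', by simpa [hvu] using h1, h2⟩
      | reject p u rest p₀ hp hq hu hV =>
        have hsort := i1 p
        rw [hq, List.pairwise_cons] at hsort
        refine ⟨fun q => ?_, fun q v hv w hw => ?_, fun q v hv => ?_⟩
        · rcases eq_or_ne q p with rfl | h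
          · simpa using hsort.2
          · simpa [h] using i1 q
        · rcases eq_or_ne q p with rfl | h
          · simp [hp] at hv
          · simp only [Function.update_of_ne h] at hw
            exact i2 q v hv w hw
        · rcases eq_or_ne q p with rfl | h
          · rcases eq_or_ne v u with rfl | hvu
            · exact ⟨p₀, hu, not_lt.1 hV⟩
            · refine i3 q v fun hmem => hv ?_
              rw [hq] at hmem
              simpa [hvu] using hmem
          · exact i3 q v (by simpa [h] using hv)
  obtain ⟨-, i2, i3⟩ := inv
  rintro ⟨u, p, h1, h2⟩
  rw [← hu] at h1
  rw [← hp] at h2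
  obtain ⟨u₀, hu₀⟩ := Option.ne_none_iff_exists'.1 (hfin p)
  rw [hu₀] at h2
  obtain ⟨p', h3, h4⟩ := i3 p u fun hmem => h2.not_ge (i2 p u₀ hu₀ u hmem)
  rw [h3] at h1
  exact h1.not_ge h4

/-- If the favourite users `f p` of the providers are distinct, nobody is ever rejected. -/
lemma GSReturns.prov_eq_of_favourite {M : Matching N L} (h : GSReturns V M) {f : Fin L → Fin N}
    (hf : Function.Injective f)
    (hV : ∀ p u, u ≠ f p → V (.inr p) (some u) < V (.inr p) (some (f p))) (p : Fin L) :
    M.prov p = some (f p) := by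
  obtain ⟨Q, hQ, s, hs, hfin, hu, hp⟩ := h
  have inv : (∀ p, (s.prov p = none ∧ ∃ rest, s.queue p = f p :: rest) ∨ s.prov p = some (f p)) ∧
      (∀ u p, s.user u = some p → u = f p ∧ s.prov p = some u) := by
    clear hfin hu hp
    induction hs with
    | refl =>
      refine ⟨fun p => .inl ⟨rfl, ?_⟩, by simp⟩
      obtain ⟨-, h2, h3⟩ := hQ p
      cases hq : Q p with
      | nil => simpa [hq] using h2 (f p)
      | cons a rest =>
        have h4 := h2 (f p)
        rw [hq] at h3 h4
        rcases List.mem_cons.1 h4 with h | h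
        · exact ⟨rest, by rw [h]; exact hq⟩
        · have h5 := (List.pairwise_cons.1 h3).1 _ h
          by_cases ha : a = f p
          · exact ⟨rest, by rw [← ha]; exact hq⟩
          · exact absurd (hV p a ha) h5.not_gt
    | tail _ step ih =>
      obtain ⟨i1, i2⟩ := ih
      have head : ∀ {s : GSState N L} {p u rest},
          (∀ p, (s.prov p = none ∧ ∃ rest, s.queue p = f p :: rest) ∨ s.prov p = some (f p)) →
          s.prov p = none → s.queue p = u :: rest → u = f p := by
        intro s p u rest i1 hp hq
        rcases i1 p with ⟨-, r, hr⟩ | h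
        · rw [hq] at hr
          exact (List.cons.inj hr).1
        · simp [hp] at h
      cases step with
      | accept p u rest hp hq hu =>
        obtain rfl := head i1 hp hq
        refine ⟨fun q => ?_, fun v q hv => ?_⟩
        · rcases eq_or_ne q p with rfl | h
          · simp
          · simpa [h] using i1 q
        · rcases eq_or_ne v (f p) with rfl | hvu
          · simp only [Function.update_self, Option.some.injEq] at hv
            subst hv
            simp
          · simp only [Function.update_of_ne hvu] at hv
            obtain ⟨h1, h2⟩ := i2 v q hv
            have hqp : q ≠ p := by
              rintro rfl
              exact hvu h1
            exact ⟨h1, by simpa [hqp] using h2⟩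
      | switch p u rest p₀ hp hq hu hV =>
        obtain rfl := head i1 hp hq
        obtain ⟨h1, h2⟩ := i2 _ _ hu
        rw [hf h1] at hp
        simp [hp] at h2
      | reject p u rest p₀ hp hq hu hV =>
        obtain rfl := head i1 hp hq
        obtain ⟨h1, h2⟩ := i2 _ _ hu
        rw [hf h1] at hp
        simp [hp] at h2
  rw [← hp]
  exact (inv.1 p).resolve_left fun h => hfin p h.1

end GaleShapley

section Proportional

variable {N L : ℕ} {γ : ℝ} {mech : Info N L → Matching N L}

lemma proportional_payoff (ψ : Info N L) :
    (proportional γ mech).payoff ψ = fun a o => (1 - γ) * ψ a o := by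
  funext a o
  simp only [Platform.payoff, proportional]
  ring

lemma stableSet_proportional_payoff (hγ : γ < 1) (ψ : Info N L) :
    stableSet ((proportional γ mech).payoff ψ) = stableSet ψ := by
  have h : 0 < 1 - γ := by linarith
  simp only [stableSet, proportional_payoff, mul_lt_mul_iff_right₀ h]

end Proportional

/-! ### Measurability and independence of the past -/

namespace Env

variable {N L : ℕ} {m : Market N L} {Ω : Type u} [mΩ : MeasurableSpace Ω]

/-- The family of all initial samples and all rewards. -/
def sample (E : Env m Ω) (i : ((a : Agent N L) × Opp a) × (ℕ ⊕ ℕ)) : Ω → ℝ :=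
  Sum.elim (E.X₀ i.1.1 i.1.2) (E.X i.1.1 i.1.2) i.2

/-- The information generated by the initial samples and the rewards up to time `t`, those of
unmatched pairs included. -/
@[reducible] def past (E : Env m Ω) (t : ℕ) : MeasurableSpace Ω :=
  ⨆ i ∈ {i : ((a : Agent N L) × Opp a) × (ℕ ⊕ ℕ) | ∀ s, i.2 = .inr s → s ≤ t},
    MeasurableSpace.comap (E.sample i) inferInstance

lemma measurable_sample (E : Env m Ω) (i) : Measurable (E.sample i) := by
  rcases i with ⟨⟨a, b⟩, τ | t⟩
  · exact E.measurable₀ a b τ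
  · exact E.measurable a b t

lemma past_le (E : Env m Ω) (t : ℕ) : E.past t ≤ mΩ :=
  iSup₂_le fun i _ => (E.measurable_sample i).comap_le

lemma past_mono (E : Env m Ω) {s t : ℕ} (h : s ≤ t) : E.past s ≤ E.past t :=
  biSup_mono fun _ hi r hr => (hi r hr).trans h

lemma measurable_past_X₀ (E : Env m Ω) (t : ℕ) (a : Agent N L) (b : Opp a) (τ : ℕ) :
    Measurable[E.past t] (E.X₀ a b τ) := by
  have h : MeasurableSpace.comap (E.sample (⟨a, b⟩, .inl τ)) inferInstance ≤ E.past t :=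
    le_biSup (fun i => MeasurableSpace.comap (E.sample i) inferInstance) (by simp)
  exact (comap_measurable (E.sample (⟨a, b⟩, .inl τ))).mono h le_rfl

lemma measurable_past_X (E : Env m Ω) {s t : ℕ} (hst : s ≤ t) (a : Agent N L) (b : Opp a) :
    Measurable[E.past t] (E.X a b s) := by
  have h : MeasurableSpace.comap (E.sample (⟨a, b⟩, .inr s)) inferInstance ≤ E.past t :=
    le_biSup (fun i => MeasurableSpace.comap (E.sample i) inferInstance) (by
      intro r hr
      simp only [Sum.inr.injEq] at hr
      omega)
  exact (comap_measurable (E.sample (⟨a, b⟩, .inr s))).mono h le_rfl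

lemma indep_past (E : Env m Ω) (t : ℕ) (a : Agent N L) (b : Opp a) :
    Indep (E.past t) (MeasurableSpace.comap (E.X a b (t + 1)) inferInstance) E.P := by
  have h := indep_iSup_of_disjoint (fun i => (E.measurable_sample i).comap_le)
    (show iIndep (fun i => MeasurableSpace.comap (E.sample i) inferInstance) E.P from E.indep)
    (S := {i | ∀ s, i.2 = .inr s → s ≤ t}) (T := {(⟨a, b⟩, .inr (t + 1))})
    (Set.disjoint_singleton_right.2 fun h => by simpa using h (t + 1) rfl)
  rwa [iSup_singleton] at h

variable (E : Env m Ω) {F : Platform N L}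

lemma measurable_ucb {Ω' : Type*} {mΩ' : MeasurableSpace Ω'} {t : ℕ} {s : Ω' → Tally N L}
    (hc : ∀ a b, Measurable fun ω => (s ω).count a b)
    (ht : ∀ a b, Measurable fun ω => (s ω).total a b) :
    Measurable fun ω => E.ucb t (s ω) := by
  refine measurable_pi_iff.2 fun a => measurable_pi_iff.2 fun o => ?_
  cases o with
  | none => exact measurable_const
  | some b =>
    have h : Measurable fun ω => ((s ω).count a b : ℝ) := measurable_from_top.comp (hc a b)
    exact ((ht a b).div h).add (measurable_const.div h).sqrt

lemma measurable_past_tally (hF : Measurable F.mech) (t : ℕ) :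
    (∀ a b, Measurable[E.past t] fun ω => (E.tally F ω t).count a b) ∧
      ∀ a b, Measurable[E.past t] fun ω => (E.tally F ω t).total a b := by
  induction t with
  | zero =>
    exact ⟨fun a b => measurable_const,
      fun a b => Finset.measurable_sum (f := E.X₀ a b) (Finset.range (E.init a b))
        fun τ _ => E.measurable_past_X₀ 0 a b τ⟩
  | succ t ih =>
    have hM : Measurable[E.past (t + 1)] fun ω =>
        F.mech (E.ucb (t + 1) (E.tally F ω t)) :=
      (hF.comp (E.measurable_ucb ih.1 ih.2)).mono (E.past_mono t.le_succ) le_rfl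
    have hS : ∀ a b, MeasurableSet[E.past (t + 1)]
        {ω | (F.mech (E.ucb (t + 1) (E.tally F ω t))).partner a = some b} :=
      fun a b => hM (MeasurableSpace.measurableSet_top
        (s := {M : Matching N L | M.partner a = some b}))
    refine ⟨fun a b => ?_, fun a b => ?_⟩
    · exact ((ih.1 a b).mono (E.past_mono t.le_succ) le_rfl).add
        (Measurable.ite (hS a b) measurable_const measurable_const)
    · exact ((ih.2 a b).mono (E.past_mono t.le_succ) le_rfl).add
        (Measurable.ite (hS a b) (E.measurable_past_X le_rfl a b) measurable_const)

lemma measurable_past_ν (hF : Measurable F.mech) (t : ℕ) :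
    Measurable[E.past (t - 1)] fun ω => E.ν F t ω :=
  E.measurable_ucb (E.measurable_past_tally hF _).1 (E.measurable_past_tally hF _).2

lemma measurable_past_matched (hF : Measurable F.mech) (t : ℕ) :
    Measurable[E.past (t - 1)] fun ω => E.matched F t ω :=
  hF.comp (E.measurable_past_ν hF t)

lemma measurableSet_past_partner (hF : Measurable F.mech) (t : ℕ) (a : Agent N L)
    (o : Option (Opp a)) :
    MeasurableSet[E.past (t - 1)] {ω | (E.matched F t ω).partner a = o} :=
  E.measurable_past_matched hF t
    (MeasurableSpace.measurableSet_top (s := {M : Matching N L | M.partner a = o}))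

/-! ### Numbers of samples and estimates -/

/-- The number of samples `T_{t-1}(a, b)`, as a function of the time `t` at which it is used. -/
noncomputable def samples (F : Platform N L) (t : ℕ) (ω : Ω) (a : Agent N L) (b : Opp a) : ℕ :=
  (E.tally F ω (t - 1)).count a b

/-- The error of the empirical mean of `a`'s rewards from `b` at time `t`. -/
noncomputable def noise (F : Platform N L) (t : ℕ) (ω : Ω) (a : Agent N L) (b : Opp a) : ℝ :=
  (E.tally F ω (t - 1)).total a b / E.samples F t ω a b - m.μ a (some b)

/-- The half-width of the confidence interval with confidence parameter `β`; the mechanism uses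
`β = α`, the lower bound on exploration also uses `β = α / 2`. -/
noncomputable def width (F : Platform N L) (β : ℝ) (t : ℕ) (ω : Ω) (a : Agent N L) (b : Opp a) :
    ℝ :=
  Real.sqrt (2 * (E.σ : ℝ) ^ 2 * β * Real.log t / E.samples F t ω a b)

/-- The distance of the empirical mean from the confidence interval of parameter `β`. -/
noncomputable def excess (F : Platform N L) (β : ℝ) (t : ℕ) (ω : Ω) (a : Agent N L) (b : Opp a) :
    ℝ :=
  max (|E.noise F t ω a b| - E.width F β t ω a b) 0

lemma ν_none (F : Platform N L) (t : ℕ) (ω : Ω) (a : Agent N L) : E.ν F t ω a none = 0 := rfl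

lemma ν_some (F : Platform N L) (t : ℕ) (ω : Ω) (a : Agent N L) (b : Opp a) :
    E.ν F t ω a (some b) = m.μ a (some b) + E.noise F t ω a b + E.width F E.α t ω a b := by
  simp only [ν, ucb, noise, width, samples]
  ring

lemma width_nonneg (F : Platform N L) (β : ℝ) (t : ℕ) (ω : Ω) (a : Agent N L) (b : Opp a) :
    0 ≤ E.width F β t ω a b := Real.sqrt_nonneg _

lemma excess_nonneg (F : Platform N L) (β : ℝ) (t : ℕ) (ω : Ω) (a : Agent N L) (b : Opp a) :
    0 ≤ E.excess F β t ω a b := le_max_right _ _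

lemma abs_noise_le (F : Platform N L) (β : ℝ) (t : ℕ) (ω : Ω) (a : Agent N L) (b : Opp a) :
    |E.noise F t ω a b| ≤ E.width F β t ω a b + E.excess F β t ω a b := by
  have := le_max_left (|E.noise F t ω a b| - E.width F β t ω a b) 0
  unfold excess
  linarith

lemma init_pos (a : Agent N L) (b : Opp a) : 0 < E.init a b := by
  rcases a with u | p
  · exact E.T₀_pos u b
  · exact E.T₀_pos b p

lemma tally_count_succ (F : Platform N L) (ω : Ω) (t : ℕ) (a : Agent N L) (b : Opp a) :
    (E.tally F ω (t + 1)).count a b = (E.tally F ω t).count a b +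
      if (E.matched F (t + 1) ω).partner a = some b then 1 else 0 := rfl

lemma tally_total_succ (F : Platform N L) (ω : Ω) (t : ℕ) (a : Agent N L) (b : Opp a) :
    (E.tally F ω (t + 1)).total a b = (E.tally F ω t).total a b +
      if (E.matched F (t + 1) ω).partner a = some b then E.X a b (t + 1) ω else 0 := rfl

lemma init_le_count (F : Platform N L) (ω : Ω) (t : ℕ) (a : Agent N L) (b : Opp a) :
    E.init a b ≤ (E.tally F ω t).count a b := by
  induction t with
  | zero => exact le_rfl
  | succ t ih => exact ih.trans (Nat.le_add_right _ _)

lemma count_le (F : Platform N L) (ω : Ω) (t : ℕ) (a : Agent N L) (b : Opp a) :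
    (E.tally F ω t).count a b ≤ E.init a b + t := by
  induction t with
  | zero => exact le_rfl
  | succ t ih =>
    rw [tally_count_succ]
    split_ifs <;> omega

lemma samples_pos (F : Platform N L) (t : ℕ) (ω : Ω) (a : Agent N L) (b : Opp a) :
    0 < E.samples F t ω a b := (E.init_pos a b).trans_le (E.init_le_count F ω _ a b)

lemma samples_succ (F : Platform N L) {t : ℕ} (ht : 1 ≤ t) (ω : Ω) (a : Agent N L) (b : Opp a) :
    E.samples F (t + 1) ω a b = E.samples F t ω a b +
      if (E.matched F t ω).partner a = some b then 1 else 0 := by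
  obtain ⟨t, rfl⟩ := Nat.exists_eq_add_of_le' ht
  rfl

/-- Both agents of a pair have the same number of samples of each other. -/
lemma samples_symm (F : Platform N L) (t : ℕ) (ω : Ω) (u : Fin N) (p : Fin L) :
    E.samples F t ω (.inl u) p = E.samples F t ω (.inr p) u := by
  unfold samples
  induction t - 1 with
  | zero => rfl
  | succ t ih =>
    simp only [tally_count_succ, ih]
    congr 1
    exact if_congr (Matching.partner_inl_iff _ u p) rfl rfl

lemma width_symm (F : Platform N L) (β : ℝ) (t : ℕ) (ω : Ω) (u : Fin N) (p : Fin L) :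
    E.width F β t ω (.inl u) p = E.width F β t ω (.inr p) u := by
  simp only [width, samples_symm]

lemma measurable_samples (hF : Measurable F.mech) (t : ℕ) (a : Agent N L) (b : Opp a) :
    Measurable fun ω => (E.samples F t ω a b : ℝ) :=
  measurable_from_top.comp (((E.measurable_past_tally hF (t - 1)).1 a b).mono (E.past_le _) le_rfl)

lemma measurable_noise (hF : Measurable F.mech) (t : ℕ) (a : Agent N L) (b : Opp a) :
    Measurable fun ω => E.noise F t ω a b :=
  ((((E.measurable_past_tally hF (t - 1)).2 a b).mono (E.past_le _) le_rfl).div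
    (E.measurable_samples hF t a b)).sub measurable_const

lemma measurable_width (hF : Measurable F.mech) (β : ℝ) (t : ℕ) (a : Agent N L) (b : Opp a) :
    Measurable fun ω => E.width F β t ω a b :=
  (measurable_const.div (E.measurable_samples hF t a b)).sqrt

lemma measurable_excess (hF : Measurable F.mech) (β : ℝ) (t : ℕ) (a : Agent N L) (b : Opp a) :
    Measurable fun ω => E.excess F β t ω a b :=
  (((continuous_abs.measurable.comp (E.measurable_noise hF t a b))).sub
    (E.measurable_width hF β t a b)).max measurable_const

/-! ### The exponential supermartingale of the sampled rewards -/

lemma subGaussian_X (a : Agent N L) (b : Opp a) (t : ℕ) :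
    HasSubgaussianMGF (fun ω => E.X a b t ω - m.μ a (some b)) (E.σ ^ 2) E.P := by
  have h := E.subGaussian a b
  rw [← E.law a b t] at h
  exact h.of_map (E.measurable a b t).aemeasurable

lemma subGaussian_X₀ (a : Agent N L) (b : Opp a) (t : ℕ) :
    HasSubgaussianMGF (fun ω => E.X₀ a b t ω - m.μ a (some b)) (E.σ ^ 2) E.P := by
  have h := E.subGaussian a b
  rw [← E.law₀ a b t] at h
  exact h.of_map (E.measurable₀ a b t).aemeasurable

/-- The variable `exp (lS - n l²σ²/2)`, where `S` is the sum of the `n` centred samples that `a` has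
of `b` after time `t`, the initial ones included. -/
noncomputable def expDev (F : Platform N L) (l : ℝ) (t : ℕ) (ω : Ω) (a : Agent N L) (b : Opp a) :
    ℝ :=
  Real.exp (l * ((E.tally F ω t).total a b - (E.tally F ω t).count a b * m.μ a (some b))
    - (E.tally F ω t).count a b * (l ^ 2 * (E.σ : ℝ) ^ 2 / 2))

lemma measurable_past_expDev (hF : Measurable F.mech) (l : ℝ) (t : ℕ) (a : Agent N L) (b : Opp a) :
    Measurable[E.past t] fun ω => E.expDev F l t ω a b := by
  have h1 : Measurable[E.past t] fun ω => ((E.tally F ω t).count a b : ℝ) :=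
    measurable_from_top.comp ((E.measurable_past_tally hF t).1 a b)
  have h2 := (E.measurable_past_tally hF t).2 a b
  exact (((h2.sub (h1.mul_const _)).const_mul l).sub (h1.mul_const _)).exp

/-- Whether `a` samples `b` at time `t + 1` is decided before the reward is drawn; the new factor is
either `1` or independent of the past with mean at most `1`. -/
lemma lintegral_expDev_le (hF : Measurable F.mech) (l : ℝ) (t : ℕ) (a : Agent N L) (b : Opp a) :
    ∫⁻ ω, ENNReal.ofReal (E.expDev F l t ω a b) ∂E.P ≤ 1 := by
  have := E.isProb
  induction t with
  | zero =>
    have hsub : HasSubgaussianMGF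
        (fun ω => ∑ τ ∈ Finset.range (E.init a b), (E.X₀ a b τ ω - m.μ a (some b)))
        (∑ τ ∈ Finset.range (E.init a b), E.σ ^ 2) E.P := by
      refine HasSubgaussianMGF.sum_of_iIndepFun (X := fun τ ω => E.X₀ a b τ ω - m.μ a (some b)) ?_
        fun τ _ => E.subGaussian_X₀ a b τ
      exact (E.indep.precomp (g := fun τ : ℕ => ((⟨a, b⟩, .inl τ) :
        ((a : Agent N L) × Opp a) × (ℕ ⊕ ℕ))) (fun τ τ' h => by simpa using h)).comp
          (fun _ x => x - m.μ a (some b)) fun _ => measurable_id.sub_const _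
    have hZ : ∀ ω, E.expDev F l 0 ω a b = Real.exp (-(E.init a b * (l ^ 2 * (E.σ : ℝ) ^ 2 / 2))) *
        Real.exp (l * ∑ τ ∈ Finset.range (E.init a b), (E.X₀ a b τ ω - m.μ a (some b))) := by
      intro ω
      rw [← Real.exp_add, expDev]
      congr 1
      simp only [tally, Finset.sum_sub_distrib, Finset.sum_const, Finset.card_range, nsmul_eq_mul]
      ring
    simp only [hZ]
    rw [← ofReal_integral_eq_lintegral_ofReal ((hsub.integrable_exp_mul l).const_mul _)
      (Eventually.of_forall fun ω => by positivity), integral_const_mul]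
    refine ENNReal.ofReal_le_one.2 ?_
    have h := hsub.mgf_le l
    rw [mgf] at h
    refine (mul_le_mul_of_nonneg_left h (Real.exp_pos _).le).trans ?_
    rw [← Real.exp_add]
    refine Real.exp_le_one_iff.2 (le_of_eq ?_)
    push_cast [Finset.sum_const, Finset.card_range, nsmul_eq_mul]
    ring
  | succ t ih =>
    set A : Set Ω := {ω | (E.matched F (t + 1) ω).partner a = some b} with hA
    have hAm : MeasurableSet[E.past t] A := E.measurableSet_past_partner hF (t + 1) a (some b)
    have hZm := (E.measurable_past_expDev hF l t a b).ennreal_ofReal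
    set f : Ω → ENNReal := fun ω => ENNReal.ofReal (E.expDev F l t ω a b) with hf
    set g : Ω → ENNReal := fun ω => ENNReal.ofReal
      (Real.exp (l * (E.X a b (t + 1) ω - m.μ a (some b)) - l ^ 2 * (E.σ : ℝ) ^ 2 / 2)) with hg
    have hgm : Measurable[MeasurableSpace.comap (E.X a b (t + 1)) inferInstance] g := by
      have h : Measurable fun x : ℝ => ENNReal.ofReal
          (Real.exp (l * (x - m.μ a (some b)) - l ^ 2 * (E.σ : ℝ) ^ 2 / 2)) := by fun_prop
      exact h.comp (comap_measurable (E.X a b (t + 1)))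
    have hg1 : ∫⁻ ω, g ω ∂E.P ≤ 1 := by
      have hsub := E.subGaussian_X a b (t + 1)
      have hg' : ∀ ω, g ω = ENNReal.ofReal (Real.exp (-(l ^ 2 * (E.σ : ℝ) ^ 2 / 2)) *
          Real.exp (l * (E.X a b (t + 1) ω - m.μ a (some b)))) := by
        intro ω
        rw [hg, ← Real.exp_add]
        ring_nf
      simp only [hg']
      rw [← ofReal_integral_eq_lintegral_ofReal ((hsub.integrable_exp_mul l).const_mul _)
        (Eventually.of_forall fun ω => by positivity), integral_const_mul]
      refine ENNReal.ofReal_le_one.2 ?_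
      have h := hsub.mgf_le l
      rw [mgf] at h
      refine (mul_le_mul_of_nonneg_left h (Real.exp_pos _).le).trans ?_
      rw [← Real.exp_add]
      refine Real.exp_le_one_iff.2 (le_of_eq ?_)
      push_cast
      ring
    have hstep : ∀ ω, ENNReal.ofReal (E.expDev F l (t + 1) ω a b) =
        Aᶜ.indicator f ω + A.indicator f ω * g ω := by
      intro ω
      by_cases h : (E.matched F (t + 1) ω).partner a = some b
      · have h1 : ω ∈ A := h
        rw [Set.indicator_of_notMem (by simpa using h1), Set.indicator_of_mem h1, zero_add]
        simp only [hf, hg, expDev, tally_count_succ, tally_total_succ, if_pos h]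
        rw [← ENNReal.ofReal_mul (Real.exp_pos _).le, ← Real.exp_add]
        congr 2
        push_cast
        ring
      · have h1 : ω ∉ A := h
        rw [Set.indicator_of_mem (by simpa using h1), Set.indicator_of_notMem h1, zero_mul,
          add_zero]
        simp only [hf, expDev, tally_count_succ, tally_total_succ, if_neg h, add_zero]
    have hAm' := E.past_le t _ hAm
    have hfm : Measurable f := hZm.mono (E.past_le t) le_rfl
    simp only [hstep]
    rw [lintegral_add_left (hfm.indicator hAm'.compl),
      lintegral_mul_eq_lintegral_mul_lintegral_of_independent_measurableSpace (E.past_le t)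
        (E.measurable a b (t + 1)).comap_le (E.indep_past t a b) (hZm.indicator hAm) hgm]
    calc _ ≤ ∫⁻ ω, Aᶜ.indicator f ω ∂E.P + (∫⁻ ω, A.indicator f ω ∂E.P) * 1 := by gcongr
      _ = ∫⁻ ω, f ω ∂E.P := by
        rw [mul_one, ← lintegral_add_left (hfm.indicator hAm'.compl)]
        congr 1
        funext ω
        exact congrFun (Set.indicator_compl_add_self A f) ω
      _ ≤ 1 := ih

lemma integrable_expDev (hF : Measurable F.mech) (l : ℝ) (t : ℕ) (a : Agent N L) (b : Opp a) :
    Integrable (fun ω => E.expDev F l t ω a b) E.P := by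
  refine ⟨((E.measurable_past_expDev hF l t a b).mono
    (E.past_le t) le_rfl).aestronglyMeasurable, ?_⟩
  rw [hasFiniteIntegral_iff_ofReal (Eventually.of_forall fun ω =>
    (Real.exp_pos _).le : 0 ≤ᵐ[E.P] fun ω => E.expDev F l t ω a b)]
  exact (E.lintegral_expDev_le hF l t a b).trans_lt ENNReal.one_lt_top

lemma integral_expDev_le (hF : Measurable F.mech) (l : ℝ) (t : ℕ) (a : Agent N L) (b : Opp a) :
    ∫ ω, E.expDev F l t ω a b ∂E.P ≤ 1 := by
  have h := E.lintegral_expDev_le hF l t a b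
  rw [← ofReal_integral_eq_lintegral_ofReal (E.integrable_expDev hF l t a b)
    (Eventually.of_forall fun ω => (Real.exp_pos _).le)] at h
  exact ENNReal.ofReal_le_one.1 h

end Env

/-! ### Deviations of the empirical means -/

namespace Env

variable {N L : ℕ} {m : Market N L} {Ω : Type u} [mΩ : MeasurableSpace Ω]
variable (E : Env m Ω) {F : Platform N L}

lemma expDev_eq (F : Platform N L) (l : ℝ) (t : ℕ) (ω : Ω) (a : Agent N L) (b : Opp a) :
    E.expDev F l (t - 1) ω a b = Real.exp (l * (E.samples F t ω a b * E.noise F t ω a b)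
      - E.samples F t ω a b * (l ^ 2 * (E.σ : ℝ) ^ 2 / 2)) := by
  have h : (E.samples F t ω a b : ℝ) ≠ 0 := by exact_mod_cast (E.samples_pos F t ω a b).ne'
  rw [expDev, noise, mul_sub (E.samples F t ω a b : ℝ), mul_div_cancel₀ _ h]
  rfl

/-- For `σ = 0` the empirical means are almost surely exact: the exponentials for `l = 1` and
`l = -1` have means at most `1`, and their sum is `2` plus a square. -/
lemma noise_ae_eq_zero (hF : Measurable F.mech) (hσ : E.σ = 0) (t : ℕ) (a : Agent N L) (b : Opp a) :
    ∀ᵐ ω ∂E.P, E.noise F t ω a b = 0 := by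
  have := E.isProb
  set S : Ω → ℝ := fun ω => E.samples F t ω a b * E.noise F t ω a b with hS
  have hZ : ∀ l ω, E.expDev F l (t - 1) ω a b = Real.exp (l * S ω) := by
    intro l ω
    rw [expDev_eq, hσ]
    simp [hS]
  have hsq : ∀ ω, (Real.exp (S ω / 2) - Real.exp (-(S ω / 2))) ^ 2 =
      E.expDev F 1 (t - 1) ω a b + E.expDev F (-1) (t - 1) ω a b - 2 := by
    intro ω
    have h1 : Real.exp (S ω / 2) * Real.exp (-(S ω / 2)) = 1 := by
      rw [← Real.exp_add, add_neg_cancel, Real.exp_zero]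
    have h2 : Real.exp (S ω / 2) ^ 2 = Real.exp (1 * S ω) := by
      rw [← Real.exp_nat_mul]
      congr 1
      push_cast
      ring
    have h3 : Real.exp (-(S ω / 2)) ^ 2 = Real.exp (-1 * S ω) := by
      rw [← Real.exp_nat_mul]
      congr 1
      push_cast
      ring
    rw [hZ, hZ, sub_sq, h2, h3, mul_assoc, h1]
    ring
  have hi : ∀ l, Integrable (fun ω => E.expDev F l (t - 1) ω a b) E.P := fun l =>
    E.integrable_expDev hF l (t - 1) a b
  have hadd : Integrable
      (fun ω => E.expDev F 1 (t - 1) ω a b + E.expDev F (-1) (t - 1) ω a b) E.P :=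
    (hi 1).add (hi (-1))
  have hint : Integrable (fun ω => (Real.exp (S ω / 2) - Real.exp (-(S ω / 2))) ^ 2) E.P := by
    simp only [hsq]
    exact hadd.sub (integrable_const 2)
  have h0 : ∫ ω, (Real.exp (S ω / 2) - Real.exp (-(S ω / 2))) ^ 2 ∂E.P = 0 := by
    refine le_antisymm ?_ (integral_nonneg fun ω => sq_nonneg _)
    simp only [hsq]
    rw [integral_sub hadd (integrable_const 2), integral_add (hi 1) (hi (-1))]
    have h1 := E.integral_expDev_le hF 1 (t - 1) a b
    have h2 := E.integral_expDev_le hF (-1) (t - 1) a b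
    simp only [integral_const, probReal_univ, smul_eq_mul]
    linarith
  have h := (integral_eq_zero_iff_of_nonneg (fun ω => sq_nonneg _) hint).1 h0
  filter_upwards [h] with ω hω
  have h1 : Real.exp (S ω / 2) = Real.exp (-(S ω / 2)) := by
    have := pow_eq_zero_iff (two_ne_zero) |>.1 hω
    linarith
  have h2 : S ω = 0 := by
    have := Real.exp_injective h1
    linarith
  exact (mul_eq_zero.1 h2).resolve_left (by exact_mod_cast (E.samples_pos F t ω a b).ne')

/-- One random variable of mean `O(t ^ (1 - β))` dominates both the failure of a confidence interval
and its excess. It is a union bound over the possible numbers of samples `E.init a b + k`, `k < t`,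
in which each number of samples has its own optimal exponent. -/
lemma exists_dominating (hF : Measurable F.mech) (hσ : 0 < E.σ) {β : ℝ} (hβ : 1 ≤ β) {t : ℕ}
    (ht : 2 ≤ t) (a : Agent N L) (b : Opp a) :
    ∃ R : Ω → ℝ, Integrable R E.P ∧ ∫ ω, R ω ∂E.P ≤ 2 * (t : ℝ) ^ (1 - β) ∧ (∀ ω, 0 ≤ R ω) ∧
      (∀ ω, E.excess F β t ω a b ≤ E.σ * R ω) ∧
      ∀ ω, E.width F β t ω a b < |E.noise F t ω a b| → 1 ≤ R ω := by
  have hσ' : (0 : ℝ) < E.σ := hσ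
  have ht0 : (0 : ℝ) < t := by exact_mod_cast (by omega : 0 < t)
  have hlog : 1 / 2 ≤ β * Real.log t := by
    have h1 : Real.log 2 ≤ Real.log t := Real.log_le_log (by norm_num) (by exact_mod_cast ht)
    have h2 := Real.log_two_gt_d9
    nlinarith
  set w : ℕ → ℝ := fun k =>
    Real.sqrt (2 * (E.σ : ℝ) ^ 2 * β * Real.log t / (E.init a b + k : ℕ)) with hw
  set R : Ω → ℝ := fun ω => (t : ℝ) ^ (-β) * ∑ k ∈ Finset.range t,
    (E.expDev F (w k / E.σ ^ 2) (t - 1) ω a b + E.expDev F (-(w k / E.σ ^ 2)) (t - 1) ω a b) with hR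
  have hpos : ∀ l ω, 0 ≤ E.expDev F l (t - 1) ω a b := fun l ω => (Real.exp_pos _).le
  have hi : ∀ l, Integrable (fun ω => E.expDev F l (t - 1) ω a b) E.P := fun l =>
    E.integrable_expDev hF l (t - 1) a b
  have hadd : ∀ l l', Integrable
      (fun ω => E.expDev F l (t - 1) ω a b + E.expDev F l' (t - 1) ω a b) E.P := fun l l' =>
    (hi l).add (hi l')
  have key : ∀ ω, ∃ l : ℝ, 0 < l ∧ 1 / l ≤ E.σ ∧
      Real.exp (l * (|E.noise F t ω a b| - E.width F β t ω a b)) ≤ R ω := by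
    intro ω
    obtain ⟨k, hk⟩ := Nat.exists_eq_add_of_le (E.init_le_count F ω (t - 1) a b)
    have hkt : k < t := by
      have := E.count_le F ω (t - 1) a b
      omega
    have hs : E.samples F t ω a b = E.init a b + k := hk
    set s : ℝ := (E.samples F t ω a b : ℝ) with hsdef
    have hs1 : 1 ≤ s := by
      rw [hsdef]
      exact_mod_cast E.samples_pos F t ω a b
    have hwk : E.width F β t ω a b = w k := by
      simp only [width, hw, hs]
    have hw2 : w k ^ 2 * s = 2 * E.σ ^ 2 * (β * Real.log t) := by
      rw [← hwk, width, Real.sq_sqrt (by positivity), div_mul_cancel₀ _ (by positivity)]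
      ring
    have hwpos : 0 < w k := by
      have h0 : w k ^ 2 * s ≠ 0 := by
        rw [hw2]
        positivity
      have h1 : 0 ≤ w k := Real.sqrt_nonneg _
      refine lt_of_le_of_ne h1 fun h => h0 ?_
      rw [← h]
      ring
    set l := w k / E.σ ^ 2 with hl
    have hlpos : 0 < l := by positivity
    have hlw : l * s * w k = 2 * (β * Real.log t) := by
      have : l * s * w k = (w k ^ 2 * s) / E.σ ^ 2 := by
        rw [hl]
        ring
      rw [this, hw2]
      field_simp
    have hll : s * (l ^ 2 * (E.σ : ℝ) ^ 2 / 2) = β * Real.log t := by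
      have : s * (l ^ 2 * (E.σ : ℝ) ^ 2 / 2) = (w k ^ 2 * s) / E.σ ^ 2 / 2 := by
        rw [hl]
        field_simp
      rw [this, hw2]
      field_simp
    refine ⟨l * s, by positivity, ?_, ?_⟩
    · rw [div_le_iff₀ (by positivity)]
      have h1 : E.σ * (l * s) = w k * s / E.σ := by
        rw [hl]
        field_simp
      rw [h1, le_div_iff₀ hσ', one_mul]
      refine le_of_sq_le_sq ?_ (by positivity)
      have h2 : (w k * s) ^ 2 = 2 * E.σ ^ 2 * (β * Real.log t) * s := by
        rw [← hw2]
        ring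
      rw [h2]
      nlinarith [mul_le_mul hlog hs1 zero_le_one (by linarith), sq_nonneg (E.σ : ℝ)]
    · have h1 : Real.exp (l * s * (|E.noise F t ω a b| - E.width F β t ω a b)) =
          (t : ℝ) ^ (-β) * Real.exp (l * (s * |E.noise F t ω a b|)
            - s * (l ^ 2 * (E.σ : ℝ) ^ 2 / 2)) := by
        rw [Real.rpow_def_of_pos ht0, ← Real.exp_add, hll, hwk]
        congr 1
        rw [mul_sub, hlw]
        ring
      rw [h1, hR]
      refine mul_le_mul_of_nonneg_left ?_ (by positivity)
      refine le_trans ?_ (Finset.single_le_sum (f := fun k =>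
        E.expDev F (w k / E.σ ^ 2) (t - 1) ω a b + E.expDev F (-(w k / E.σ ^ 2)) (t - 1) ω a b)
        (fun k _ => add_nonneg (hpos _ ω) (hpos _ ω)) (Finset.mem_range.2 hkt))
      rcases abs_cases (E.noise F t ω a b) with ⟨h, -⟩ | ⟨h, -⟩
      · refine le_trans (le_of_eq ?_) (le_add_of_nonneg_right (hpos _ ω))
        rw [h, expDev_eq]
      · refine le_trans (le_of_eq ?_) (le_add_of_nonneg_left (hpos _ ω))
        rw [h, expDev_eq]
        congr 1
        ring
  have hRpos : ∀ ω, 0 ≤ R ω := fun ω => by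
    obtain ⟨l, -, -, h⟩ := key ω
    exact (Real.exp_pos _).le.trans h
  refine ⟨R, ?_, ?_, hRpos, fun ω => ?_, fun ω hω => ?_⟩
  · exact (integrable_finsetSum _ fun k _ => hadd _ _).const_mul _
  · rw [hR, integral_const_mul, integral_finsetSum _ fun k _ => hadd _ _]
    have h1 : ∑ k ∈ Finset.range t, ∫ ω, (E.expDev F (w k / E.σ ^ 2) (t - 1) ω a b +
        E.expDev F (-(w k / E.σ ^ 2)) (t - 1) ω a b) ∂E.P ≤ ∑ k ∈ Finset.range t, 2 := by
      refine Finset.sum_le_sum fun k _ => ?_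
      rw [integral_add (hi _) (hi _)]
      have h1 := E.integral_expDev_le hF (w k / E.σ ^ 2) (t - 1) a b
      have h2 := E.integral_expDev_le hF (-(w k / E.σ ^ 2)) (t - 1) a b
      linarith
    refine (mul_le_mul_of_nonneg_left h1 (by positivity)).trans (le_of_eq ?_)
    rw [Finset.sum_const, Finset.card_range, nsmul_eq_mul, sub_eq_neg_add, Real.rpow_add ht0,
      Real.rpow_one]
    ring
  · obtain ⟨l, hl, hlσ, h⟩ := key ω
    refine max_le ?_ (mul_nonneg hσ'.le (hRpos ω))
    have h1 := Real.add_one_le_exp (l * (|E.noise F t ω a b| - E.width F β t ω a b))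
    calc |E.noise F t ω a b| - E.width F β t ω a b
        = 1 / l * (l * (|E.noise F t ω a b| - E.width F β t ω a b)) := by field_simp
      _ ≤ 1 / l * R ω := by
        refine mul_le_mul_of_nonneg_left ?_ (by positivity)
        linarith
      _ ≤ E.σ * R ω := mul_le_mul_of_nonneg_right hlσ (hRpos ω)
  · obtain ⟨l, hl, hlσ, h⟩ := key ω
    exact (Real.one_le_exp (mul_nonneg hl.le (by linarith))).trans h

/-- Confidence intervals fail with probability `O(t ^ (1 - β))`. -/
lemma measureReal_width_lt_le (hF : Measurable F.mech) {β : ℝ} (hβ : 1 ≤ β) {t : ℕ}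
    (ht : 2 ≤ t) (a : Agent N L) (b : Opp a) :
    E.P.real {ω | E.width F β t ω a b < |E.noise F t ω a b|} ≤ 2 * (t : ℝ) ^ (1 - β) := by
  have := E.isProb
  have hm : MeasurableSet {ω | E.width F β t ω a b < |E.noise F t ω a b|} :=
    measurableSet_lt (E.measurable_width hF β t a b)
      (continuous_abs.measurable.comp (E.measurable_noise hF t a b))
  rcases eq_or_lt_of_le (zero_le : 0 ≤ E.σ) with hσ | hσ
  · have h0 : E.P {ω | E.width F β t ω a b < |E.noise F t ω a b|} = 0 := by
      rw [measure_eq_zero_iff_ae_notMem]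
      filter_upwards [E.noise_ae_eq_zero hF hσ.symm t a b] with ω hω h
      have h' : E.width F β t ω a b < |E.noise F t ω a b| := h
      rw [hω, abs_zero] at h'
      exact h'.not_ge (E.width_nonneg F β t ω a b)
    rw [measureReal_def, h0, ENNReal.toReal_zero]
    positivity
  · obtain ⟨R, hi, hle, h0, -, h1⟩ := E.exists_dominating hF hσ hβ ht a b
    refine le_trans ?_ hle
    rw [← integral_indicator_one hm]
    refine integral_mono ((integrable_const (1 : ℝ)).indicator hm) hi fun ω => ?_
    by_cases hω : ω ∈ {ω | E.width F β t ω a b < |E.noise F t ω a b|}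
    · rw [Set.indicator_of_mem hω]
      exact h1 ω hω
    · rw [Set.indicator_of_notMem hω]
      exact h0 ω

lemma integrable_excess_and_integral_le (hF : Measurable F.mech) {β : ℝ} (hβ : 1 ≤ β) {t : ℕ}
    (ht : 2 ≤ t) (a : Agent N L) (b : Opp a) :
    Integrable (fun ω => E.excess F β t ω a b) E.P ∧
      ∫ ω, E.excess F β t ω a b ∂E.P ≤ 2 * E.σ * (t : ℝ) ^ (1 - β) := by
  have := E.isProb
  rcases eq_or_lt_of_le (zero_le : 0 ≤ E.σ) with hσ | hσ
  · have h0 : (fun ω => E.excess F β t ω a b) =ᵐ[E.P] fun _ => 0 := by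
      filter_upwards [E.noise_ae_eq_zero hF hσ.symm t a b] with ω hω
      rw [excess, hω, abs_zero, zero_sub]
      exact max_eq_right (neg_nonpos.2 (E.width_nonneg F β t ω a b))
    refine ⟨(integrable_const (0 : ℝ)).congr h0.symm, ?_⟩
    rw [integral_congr_ae h0, integral_zero]
    positivity
  · obtain ⟨R, hi, hle, h0, h1, -⟩ := E.exists_dominating hF hσ hβ ht a b
    have hint : Integrable (fun ω => E.excess F β t ω a b) E.P := by
      refine (hi.const_mul (E.σ : ℝ)).mono' (E.measurable_excess hF β t a b).aestronglyMeasurable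
        (Eventually.of_forall fun ω => ?_)
      rw [Real.norm_of_nonneg (E.excess_nonneg F β t ω a b)]
      exact h1 ω
    refine ⟨hint, (integral_mono hint (hi.const_mul _) h1).trans ?_⟩
    rw [integral_const_mul]
    calc (E.σ : ℝ) * ∫ ω, R ω ∂E.P ≤ E.σ * (2 * (t : ℝ) ^ (1 - β)) := by gcongr
      _ = _ := by ring

/-- At time `1` the confidence intervals are degenerate, and the excess is the error itself. -/
lemma integrable_excess_one_and_integral_le (hF : Measurable F.mech) (β : ℝ)
    (a : Agent N L) (b : Opp a) :
    Integrable (fun ω => E.excess F β 1 ω a b) E.P ∧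
      ∫ ω, E.excess F β 1 ω a b ∂E.P ≤ 2 * E.σ := by
  have := E.isProb
  have hex : ∀ ω, E.excess F β 1 ω a b = |E.noise F 1 ω a b| := by
    intro ω
    simp [excess, width]
  simp only [hex]
  rcases eq_or_lt_of_le (zero_le : 0 ≤ E.σ) with hσ | hσ
  · have h0 : (fun ω => |E.noise F 1 ω a b|) =ᵐ[E.P] fun _ => 0 := by
      filter_upwards [E.noise_ae_eq_zero hF hσ.symm 1 a b] with ω hω
      rw [hω, abs_zero]
    refine ⟨(integrable_const (0 : ℝ)).congr h0.symm, ?_⟩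
    rw [integral_congr_ae h0, integral_zero]
    positivity
  · have hσ' : (0 : ℝ) < E.σ := hσ
    set s : ℝ := (E.init a b : ℝ) with hs
    have hs1 : 1 ≤ s := by
      rw [hs]
      exact_mod_cast E.init_pos a b
    -- the exponent that makes the variance term of the supermartingale equal to `1 / 2`
    set l : ℝ := 1 / (E.σ * Real.sqrt s) with hl
    have hsq : Real.sqrt s ^ 2 = s := Real.sq_sqrt (by linarith)
    have hsq0 : 0 < Real.sqrt s := Real.sqrt_pos.2 (by linarith)
    have hlpos : 0 < l := by positivity
    have hi : ∀ l, Integrable (fun ω => E.expDev F l 0 ω a b) E.P := fun l =>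
      E.integrable_expDev hF l 0 a b
    have hZ : ∀ l ω, E.expDev F l 0 ω a b = Real.exp (l * (s * E.noise F 1 ω a b)
        - s * (l ^ 2 * (E.σ : ℝ) ^ 2 / 2)) := fun l ω => E.expDev_eq F l 1 ω a b
    have hvar : s * (l ^ 2 * (E.σ : ℝ) ^ 2 / 2) = 1 / 2 := by
      have : s * (l ^ 2 * (E.σ : ℝ) ^ 2 / 2) = s / (2 * Real.sqrt s ^ 2) := by
        rw [hl]
        field_simp
      rw [this, hsq]
      field_simp
    have hpt : ∀ ω, |E.noise F 1 ω a b| ≤ E.σ *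
        (E.expDev F l 0 ω a b + E.expDev F (-l) 0 ω a b) := by
      intro ω
      have h1 : l * (s * |E.noise F 1 ω a b|) ≤ E.expDev F l 0 ω a b + E.expDev F (-l) 0 ω a b := by
        have h2 := Real.add_one_le_exp (l * (s * |E.noise F 1 ω a b|) - 1 / 2)
        have h3 : Real.exp (l * (s * |E.noise F 1 ω a b|) - 1 / 2) ≤
            E.expDev F l 0 ω a b + E.expDev F (-l) 0 ω a b := by
          rw [hZ, hZ, neg_sq, hvar]
          rcases abs_cases (E.noise F 1 ω a b) with ⟨h, -⟩ | ⟨h, -⟩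
          · rw [h]
            exact le_add_of_nonneg_right (Real.exp_pos _).le
          · rw [h]
            refine le_trans (le_of_eq ?_) (le_add_of_nonneg_left (Real.exp_pos _).le)
            congr 1
            ring
        linarith
      have h4 : 1 ≤ E.σ * (l * s) := by
        have : E.σ * (l * s) = Real.sqrt s := by
          rw [hl]
          field_simp
          exact hsq.symm
        rw [this]
        exact Real.one_le_sqrt.2 hs1
      calc |E.noise F 1 ω a b| ≤ E.σ * (l * s) * |E.noise F 1 ω a b| :=
            le_mul_of_one_le_left (abs_nonneg _) h4
        _ = E.σ * (l * (s * |E.noise F 1 ω a b|)) := by ring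
        _ ≤ _ := mul_le_mul_of_nonneg_left h1 hσ'.le
    have hdom := ((hi l).add (hi (-l))).const_mul (E.σ : ℝ)
    have hint : Integrable (fun ω => |E.noise F 1 ω a b|) E.P := by
      refine hdom.mono' (continuous_abs.measurable.comp
        (E.measurable_noise hF 1 a b)).aestronglyMeasurable (Eventually.of_forall fun ω => ?_)
      rw [Real.norm_of_nonneg (abs_nonneg _)]
      exact hpt ω
    refine ⟨hint, (integral_mono hint hdom hpt).trans ?_⟩
    simp only [Pi.add_apply]
    rw [integral_const_mul, integral_add (hi _) (hi _), mul_comm]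
    refine mul_le_mul_of_nonneg_right ?_ hσ'.le
    have h1 := E.integral_expDev_le hF l 0 a b
    have h2 := E.integral_expDev_le hF (-l) 0 a b
    linarith

end Env

/-! ### Gaps of the true preferences -/

namespace Market

variable {N L : ℕ} (m : Market N L)

lemma sub_le_gapMax (a : Agent N L) (o o' : Option (Opp a)) : m.μ a o - m.μ a o' ≤ m.gapMax a :=
  le_ciSup (f := fun x : Option (Opp a) × Option (Opp a) => m.μ a x.1 - m.μ a x.2)
    (Set.finite_range _).bddAbove (o, o')

lemma gapMin_le_abs {a : Agent N L} {o o' : Option (Opp a)} (h : o ≠ o') :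
    m.gapMin ≤ |m.μ a o - m.μ a o'| :=
  ciInf_le (f := fun x : {x : (a : Agent N L) × (Option (Opp a) × Option (Opp a)) //
      x.2.1 ≠ x.2.2} => |m.μ x.1.1 x.1.2.1 - m.μ x.1.1 x.1.2.2|)
    (Set.finite_range _).bddBelow ⟨⟨a, o, o'⟩, h⟩

lemma gapMin_le_sub {a : Agent N L} {o o' : Option (Opp a)} (h : m.μ a o' < m.μ a o) :
    m.gapMin ≤ m.μ a o - m.μ a o' := by
  have h1 := m.gapMin_le_abs (a := a) (o := o) (o' := o') (by rintro rfl; exact lt_irrefl _ h)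
  rwa [abs_of_pos (sub_pos.2 h)] at h1

lemma gapMin_pos : 0 < m.gapMin := by
  have : Nonempty {x : (a : Agent N L) × (Option (Opp a) × Option (Opp a)) // x.2.1 ≠ x.2.2} :=
    ⟨⟨⟨.inr ⟨0, m.pos⟩, none, some (⟨0, m.pos.trans_le m.le⟩ : Fin N)⟩, by simp⟩⟩
  obtain ⟨⟨⟨a, o, o'⟩, h⟩, hx⟩ := exists_eq_ciInf_of_finite
    (f := fun x : {x : (a : Agent N L) × (Option (Opp a) × Option (Opp a)) // x.2.1 ≠ x.2.2} =>
      |m.μ x.1.1 x.1.2.1 - m.μ x.1.1 x.1.2.2|)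
  rw [gapMin, ← hx]
  exact abs_pos.2 (sub_ne_zero.2 fun h' => h (m.no_ties a h'))

lemma nonempty_opp {N L : ℕ} (m : Market N L) (a : Agent N L) : Nonempty (Opp a) := by
  rcases a with u | p
  · exact ⟨(⟨0, m.pos⟩ : Fin L)⟩
  · exact ⟨(⟨0, m.pos.trans_le m.le⟩ : Fin N)⟩

lemma gapMin_le_gapMax (a : Agent N L) : m.gapMin ≤ m.gapMax a := by
  obtain ⟨b⟩ := m.nonempty_opp a
  have h1 := m.gapMin_le_abs (a := a) (o := some b) (o' := none) (by simp)
  rw [m.none_eq, sub_zero, abs_of_nonneg (m.nonneg _ _)] at h1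
  have h2 := m.sub_le_gapMax a (some b) none
  rw [m.none_eq, sub_zero] at h2
  exact h1.trans h2

lemma card_opp_le {N L : ℕ} (m : Market N L) (a : Agent N L) : Fintype.card (Opp a) ≤ N := by
  rcases a with u | p
  · exact (Fintype.card_fin L).le.trans m.le
  · exact (Fintype.card_fin N).le

end Market

/-! ### Sums along a trajectory -/

/-- The right-hand side is the increment of the potential `2B√x - dx`, frozen at its maximum
`x = B²/d²`; summing over `k` telescopes. -/
lemma max_div_sqrt_sub_le {B d : ℝ} (hB : 0 ≤ B) (hd : 0 < d) (k : ℕ) :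
    max (B / Real.sqrt (k + 1 : ℕ) - d) 0 ≤
      (2 * B * Real.sqrt (min ((k + 1 : ℕ) : ℝ) (B ^ 2 / d ^ 2))
          - d * min ((k + 1 : ℕ) : ℝ) (B ^ 2 / d ^ 2))
        - (2 * B * Real.sqrt (min (k : ℝ) (B ^ 2 / d ^ 2)) - d * min (k : ℝ) (B ^ 2 / d ^ 2)) := by
  set M := B ^ 2 / d ^ 2 with hM
  have hM0 : 0 ≤ M := by positivity
  have hsM : Real.sqrt M = B / d := by
    rw [hM, ← div_pow, Real.sqrt_sq (by positivity)]
  have hk : (0 : ℝ) ≤ k := by positivity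
  have hk1 : ((k + 1 : ℕ) : ℝ) = k + 1 := by push_cast; ring
  rw [hk1]
  -- monotonicity of the potential
  have hmono : 0 ≤ (2 * B * Real.sqrt (min (k + 1 : ℝ) M) - d * min (k + 1 : ℝ) M)
      - (2 * B * Real.sqrt (min (k : ℝ) M) - d * min (k : ℝ) M) := by
    set x := min (k : ℝ) M
    set y := min (k + 1 : ℝ) M
    have hx0 : 0 ≤ x := le_min hk hM0
    have hxy : x ≤ y := min_le_min_right M (by linarith)
    have hyM : y ≤ M := min_le_right _ _
    have h1 := Real.sqrt_le_sqrt hxy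
    have h2 : Real.sqrt y ≤ B / d := hsM ▸ Real.sqrt_le_sqrt hyM
    rw [le_div_iff₀ hd] at h2
    have hx2 := Real.sq_sqrt hx0
    have hy2 := Real.sq_sqrt (hx0.trans hxy)
    have : (2 * B * Real.sqrt y - d * y) - (2 * B * Real.sqrt x - d * x) =
        (Real.sqrt y - Real.sqrt x) * (2 * B - (Real.sqrt y * d + Real.sqrt x * d)) := by
      rw [← hx2, ← hy2, Real.sqrt_sq (Real.sqrt_nonneg _), Real.sqrt_sq (Real.sqrt_nonneg _)]
      ring
    rw [this]
    refine mul_nonneg (by linarith) ?_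
    have := mul_le_mul_of_nonneg_right h1 hd.le
    linarith
  refine max_le ?_ hmono
  have hs : 0 < Real.sqrt (k + 1 : ℝ) := Real.sqrt_pos.2 (by linarith)
  rcases le_or_gt (k + 1 : ℝ) M with h | h
  · rw [min_eq_left h, min_eq_left (by linarith : (k : ℝ) ≤ M)]
    have h1 : B / Real.sqrt (k + 1 : ℝ) ≤ 2 * B * (Real.sqrt (k + 1 : ℝ) - Real.sqrt k) := by
      rw [div_le_iff₀ hs]
      have h2 := Real.sq_sqrt (by linarith : (0 : ℝ) ≤ k + 1)
      have h3 := Real.sq_sqrt hk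
      have h4 : 1 ≤ 2 * (Real.sqrt (k + 1 : ℝ) - Real.sqrt k) * Real.sqrt (k + 1 : ℝ) := by
        nlinarith [sq_nonneg (Real.sqrt (k + 1 : ℝ) - Real.sqrt k)]
      nlinarith [mul_le_mul_of_nonneg_left h4 hB]
    linarith
  · refine le_trans ?_ hmono
    have h1 : B / d < Real.sqrt (k + 1 : ℝ) := hsM ▸ Real.sqrt_lt_sqrt hM0 h
    rw [div_lt_iff₀ hd] at h1
    rw [sub_nonpos, div_le_iff₀ hs]
    linarith

namespace Env

variable {N L : ℕ} {m : Market N L} {Ω : Type u} [mΩ : MeasurableSpace Ω]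
variable (E : Env m Ω) {F : Platform N L}

/-- Over the times at which `a` is matched to `b`, the parts of the confidence widths above a
threshold have a bounded sum, since every such time adds a sample. -/
lemma sum_max_div_sqrt_le (F : Platform N L) (ω : Ω) (a : Agent N L) (b : Opp a) {B d : ℝ}
    (hB : 0 ≤ B) (hd : 0 < d) (T : ℕ) :
    ∑ t ∈ Finset.Icc 1 T, (if (E.matched F t ω).partner a = some b then
      max (B / Real.sqrt (E.samples F t ω a b) - d) 0 else 0) ≤ B ^ 2 / d := by
  set φ : ℝ → ℝ := fun x => 2 * B * Real.sqrt (min x (B ^ 2 / d ^ 2))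
    - d * min x (B ^ 2 / d ^ 2) with hφ
  have key : ∃ k : ℕ, E.samples F (T + 1) ω a b = E.init a b + k ∧
      ∑ t ∈ Finset.Icc 1 T, (if (E.matched F t ω).partner a = some b then
      max (B / Real.sqrt (E.samples F t ω a b) - d) 0 else 0) ≤ φ k := by
    induction T with
    | zero =>
      refine ⟨0, rfl, ?_⟩
      have : min (0 : ℝ) (B ^ 2 / d ^ 2) = 0 := min_eq_left (by positivity)
      simp [hφ, this]
    | succ T ih =>
      obtain ⟨k, hk, hle⟩ := ih
      rw [Finset.sum_Icc_succ_top (by omega), E.samples_succ F (by omega)]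
      by_cases h : (E.matched F (T + 1) ω).partner a = some b
      · refine ⟨k + 1, by rw [if_pos h, hk, add_assoc], ?_⟩
        rw [if_pos h]
        have h1 := max_div_sqrt_sub_le hB hd k
        have h2 : max (B / Real.sqrt (E.samples F (T + 1) ω a b) - d) 0 ≤
            max (B / Real.sqrt (k + 1 : ℕ) - d) 0 := by
          have h3 : ((k + 1 : ℕ) : ℝ) ≤ E.samples F (T + 1) ω a b := by
            have := E.init_pos a b
            exact_mod_cast (by omega : k + 1 ≤ E.samples F (T + 1) ω a b)
          gcongr
        simp only [hφ] at hle ⊢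
        linarith
      · refine ⟨k, by rw [if_neg h, hk, add_zero], ?_⟩
        rwa [if_neg h, add_zero]
  obtain ⟨k, -, hk⟩ := key
  refine hk.trans ?_
  set x := min (k : ℝ) (B ^ 2 / d ^ 2) with hx
  have hx0 : 0 ≤ x := le_min (by positivity) (by positivity)
  have h1 : B ^ 2 / d - (2 * B * Real.sqrt x - d * Real.sqrt x ^ 2) =
      (d * Real.sqrt x - B) ^ 2 / d := by
    field_simp
    ring
  rw [Real.sq_sqrt hx0] at h1
  have h2 : 0 ≤ (d * Real.sqrt x - B) ^ 2 / d := by positivity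
  simp only [hφ, ← hx]
  linarith

/-- A pair is matched at most `x` times while it has at most `x` samples. -/
lemma sum_samples_le_le (F : Platform N L) (ω : Ω) (a : Agent N L) (b : Opp a) {x : ℝ}
    (hx : 0 ≤ x) (T : ℕ) :
    ∑ t ∈ Finset.Icc 1 T, (if (E.matched F t ω).partner a = some b ∧
      (E.samples F t ω a b : ℝ) ≤ x then (1 : ℝ) else 0) ≤ x := by
  have key : ∃ k : ℕ, E.samples F (T + 1) ω a b = E.init a b + k ∧
      ∑ t ∈ Finset.Icc 1 T, (if (E.matched F t ω).partner a = some b ∧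
      (E.samples F t ω a b : ℝ) ≤ x then (1 : ℝ) else 0) ≤ min (k : ℝ) x := by
    induction T with
    | zero => exact ⟨0, rfl, by simp [hx]⟩
    | succ T ih =>
      obtain ⟨k, hk, hle⟩ := ih
      rw [Finset.sum_Icc_succ_top (by omega), E.samples_succ F (by omega)]
      by_cases h : (E.matched F (T + 1) ω).partner a = some b
      · refine ⟨k + 1, by rw [if_pos h, hk, add_assoc], ?_⟩
        have h3 : (k : ℝ) + 1 ≤ E.samples F (T + 1) ω a b := by
          have := E.init_pos a b
          exact_mod_cast (by omega : k + 1 ≤ E.samples F (T + 1) ω a b)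
        have h4 := hle.trans (min_le_left _ _)
        have h5 := hle.trans (min_le_right _ _)
        push_cast
        split_ifs with h6
        · refine le_min (by linarith) ?_
          linarith [h6.2]
        · exact le_min (by linarith) (by linarith)
      · refine ⟨k, by rw [if_neg h, hk, add_zero], ?_⟩
        rwa [if_neg (fun h' => h h'.1), add_zero]
  obtain ⟨k, -, hk⟩ := key
  exact hk.trans (min_le_right _ _)

lemma width_le_div_sqrt (F : Platform N L) {t T : ℕ} (ht : 1 ≤ t) (htT : t ≤ T) (ω : Ω)
    (a : Agent N L) (b : Opp a) :
    E.width F E.α t ω a b ≤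
      Real.sqrt (2 * (E.σ : ℝ) ^ 2 * E.α * Real.log T) / Real.sqrt (E.samples F t ω a b) := by
  have hα := E.two_lt
  have ht0 : (0 : ℝ) < t := by exact_mod_cast ht
  have h1 : Real.log t ≤ Real.log T := Real.log_le_log ht0 (by exact_mod_cast htT)
  rw [width, Real.sqrt_div' _ (Nat.cast_nonneg _)]
  gcongr

/-! ### Overvalued matches -/

/-- Some agent prefers another option to its match, but does not rank it higher at time `t`. -/
def Overvalued (F : Platform N L) (t : ℕ) (ω : Ω) : Prop :=
  ∃ (a : Agent N L) (o : Option (Opp a)), m.μ a ((E.matched F t ω).partner a) < m.μ a o ∧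
    E.ν F t ω a o ≤ E.ν F t ω a ((E.matched F t ω).partner a)

/-- All preferences lie in the confidence intervals of time `t`. -/
def Clean (F : Platform N L) (t : ℕ) (ω : Ω) : Prop :=
  ∀ (a : Agent N L) (b : Opp a), |E.noise F t ω a b| ≤ E.width F E.α t ω a b

variable {E} in
lemma Clean.le_ν {t : ℕ} {ω : Ω} (h : E.Clean F t ω) (a : Agent N L) (o : Option (Opp a)) :
    m.μ a o ≤ E.ν F t ω a o := by
  cases o with
  | none => rw [m.none_eq, E.ν_none]
  | some b =>
    rw [E.ν_some]
    have := abs_le.1 (h a b)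
    linarith

variable {E} in
lemma Clean.ν_le {t : ℕ} {ω : Ω} (h : E.Clean F t ω) (a : Agent N L) (b : Opp a) :
    E.ν F t ω a (some b) ≤ m.μ a (some b) + 2 * E.width F E.α t ω a b := by
  rw [E.ν_some]
  have := abs_le.1 (h a b)
  linarith

/-- A pair whose confidence width is at least `w` has few samples. -/
lemma samples_le_of_le_width {F : Platform N L} {t T : ℕ} (ht : 1 ≤ t) (htT : t ≤ T) {ω : Ω}
    {a : Agent N L} {b : Opp a} {w : ℝ} (hw : 0 < w) (h : w ≤ E.width F E.α t ω a b) :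
    (E.samples F t ω a b : ℝ) ≤ 2 * (E.σ : ℝ) ^ 2 * E.α * Real.log T / w ^ 2 := by
  have hα := E.two_lt
  have hlog : 0 ≤ Real.log T := Real.log_natCast_nonneg T
  have hs : (0 : ℝ) < E.samples F t ω a b := by exact_mod_cast E.samples_pos F t ω a b
  have h1 := h.trans (E.width_le_div_sqrt F ht htT ω a b)
  rw [le_div_iff₀ (Real.sqrt_pos.2 hs)] at h1
  rw [le_div_iff₀ (by positivity)]
  have h2 := pow_le_pow_left₀ (by positivity) h1 2
  rw [mul_pow, Real.sq_sqrt hs.le, Real.sq_sqrt (by positivity)] at h2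
  linarith

/-- When the confidence intervals are correct, an overvalued match has a large confidence width and
hence few samples. -/
lemma exists_samples_le_of_overvalued {F : Platform N L} {t T : ℕ} (ht : 1 ≤ t) (htT : t ≤ T)
    {ω : Ω} (hc : E.Clean F t ω) (ho : E.Overvalued F t ω) :
    ∃ (u : Fin N) (p : Fin L), (E.matched F t ω).partner (.inl u) = some p ∧
      (E.samples F t ω (.inl u) p : ℝ) ≤
        8 * (E.σ : ℝ) ^ 2 * E.α * Real.log T / m.gapMin ^ 2 := by
  obtain ⟨a, o, hμ, hν⟩ := ho
  have hG := m.gapMin_pos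
  have h2 := hc.le_ν a o
  cases hM : (E.matched F t ω).partner a with
  | none =>
    rw [hM, E.ν_none] at hν
    rw [hM, m.none_eq] at hμ
    linarith
  | some b =>
  rw [hM] at hμ hν
  have h1 := m.gapMin_le_sub hμ
  have h3 := hc.ν_le a b
  have h4 := E.samples_le_of_le_width ht htT (w := m.gapMin / 2) (by linarith)
    (by linarith : m.gapMin / 2 ≤ E.width F E.α t ω a b)
  have h5 : 2 * (E.σ : ℝ) ^ 2 * E.α * Real.log T / (m.gapMin / 2) ^ 2 =
      8 * (E.σ : ℝ) ^ 2 * E.α * Real.log T / m.gapMin ^ 2 := by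
    field_simp
    ring
  rw [h5] at h4
  rcases a with u | p
  · exact ⟨u, b, hM, h4⟩
  · refine ⟨b, p, (Matching.partner_inl_iff _ b p).2 hM, ?_⟩
    rwa [E.samples_symm]

open Classical in
/-- Every overvalued match is charged to a sample of a pair with few samples, or to a failure of the
confidence intervals. -/
lemma sum_overvalued_le (F : Platform N L) (ω : Ω) (T : ℕ) :
    ∑ t ∈ Finset.Icc 1 T, (if E.Overvalued F t ω then (1 : ℝ) else 0) ≤
      N * L * (8 * (E.σ : ℝ) ^ 2 * E.α * Real.log T / m.gapMin ^ 2) +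
        ∑ t ∈ Finset.Icc 1 T, (if E.Clean F t ω then (0 : ℝ) else 1) := by
  set x := 8 * (E.σ : ℝ) ^ 2 * E.α * Real.log T / m.gapMin ^ 2 with hx
  have hx0 : 0 ≤ x := by
    have := E.two_lt
    have := Real.log_natCast_nonneg T
    positivity
  have h1 : ∀ t ∈ Finset.Icc 1 T, (if E.Overvalued F t ω then (1 : ℝ) else 0) ≤
      (∑ u : Fin N, ∑ p : Fin L, (if (E.matched F t ω).partner (.inl u) = some p ∧
        (E.samples F t ω (.inl u) p : ℝ) ≤ x then (1 : ℝ) else 0)) +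
        (if E.Clean F t ω then (0 : ℝ) else 1) := by
    intro t ht
    rw [Finset.mem_Icc] at ht
    have h0 : ∀ (u : Fin N) (p : Fin L), (0 : ℝ) ≤
        (if (E.matched F t ω).partner (.inl u) = some p ∧
        (E.samples F t ω (.inl u) p : ℝ) ≤ x then (1 : ℝ) else 0) := by
      intro u p
      split_ifs <;> norm_num
    have h00 := Finset.sum_nonneg fun (u : Fin N) (_ : u ∈ Finset.univ) =>
      Finset.sum_nonneg fun (p : Fin L) (_ : p ∈ Finset.univ) => h0 u p
    by_cases hc : E.Clean F t ω
    · by_cases ho : E.Overvalued F t ω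
      · obtain ⟨u, p, hM, hs⟩ := E.exists_samples_le_of_overvalued ht.1 ht.2 hc ho
        rw [if_pos ho, if_pos hc, add_zero]
        calc (1 : ℝ) = (if (E.matched F t ω).partner (.inl u) = some p ∧
              (E.samples F t ω (.inl u) p : ℝ) ≤ x then (1 : ℝ) else 0) :=
              (if_pos ⟨hM, hs⟩).symm
          _ ≤ ∑ p : Fin L, (if (E.matched F t ω).partner (.inl u) = some p ∧
              (E.samples F t ω (.inl u) p : ℝ) ≤ x then (1 : ℝ) else 0) :=
              Finset.single_le_sum (f := fun p : Fin L =>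
                (if (E.matched F t ω).partner (.inl u) = some p ∧
                  (E.samples F t ω (.inl u) p : ℝ) ≤ x then (1 : ℝ) else 0))
                (fun p _ => h0 u p) (Finset.mem_univ p)
          _ ≤ _ := Finset.single_le_sum (f := fun u : Fin N => ∑ p : Fin L,
                (if (E.matched F t ω).partner (.inl u) = some p ∧
                  (E.samples F t ω (.inl u) p : ℝ) ≤ x then (1 : ℝ) else 0))
                (fun u _ => Finset.sum_nonneg fun p _ => h0 u p) (Finset.mem_univ u)
      · rw [if_neg ho, if_pos hc, add_zero]
        exact h00
    · rw [if_neg hc]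
      split_ifs <;> linarith
  refine (Finset.sum_le_sum h1).trans ?_
  rw [Finset.sum_add_distrib, Finset.sum_comm]
  gcongr
  calc _ ≤ ∑ u : Fin N, ∑ p : Fin L, x := by
        refine Finset.sum_le_sum fun u _ => ?_
        rw [Finset.sum_comm]
        exact Finset.sum_le_sum fun p _ => E.sum_samples_le_le F ω (.inl u) p hx0 T
    _ = _ := by
        simp only [Finset.sum_const, Finset.card_univ, Fintype.card_fin, nsmul_eq_mul]
        ring

/-! ### Expected numbers of failures -/

lemma one_le_alpha : 1 ≤ E.α := by linarith [E.two_lt]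

lemma measurableSet_clean (hF : Measurable F.mech) (t : ℕ) :
    MeasurableSet {ω | E.Clean F t ω} := by
  have h : {ω | E.Clean F t ω} = ⋂ (a : Agent N L), ⋂ (b : Opp a),
      {ω | |E.noise F t ω a b| ≤ E.width F E.α t ω a b} := by
    ext ω
    simp [Clean]
  rw [h]
  exact MeasurableSet.iInter fun a => MeasurableSet.iInter fun b => measurableSet_le
    (continuous_abs.measurable.comp (E.measurable_noise hF t a b)) (E.measurable_width hF E.α t a b)

open Classical in
lemma integrable_not_clean (hF : Measurable F.mech) (t : ℕ) :
    Integrable (fun ω => if E.Clean F t ω then (0 : ℝ) else 1) E.P := by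
  have := E.isProb
  refine Integrable.mono' (integrable_const (1 : ℝ)) (Measurable.ite (E.measurableSet_clean hF t)
    measurable_const measurable_const).aestronglyMeasurable (Eventually.of_forall fun ω => ?_)
  split_ifs <;> simp

lemma card_pairs (N L : ℕ) (c : ℝ) : ∑ a : Agent N L, ∑ _b : Opp a, c = 2 * N * L * c := by
  rw [Fintype.sum_sum_type]
  have h1 : ∀ u : Fin N, ∑ _b : Opp (.inl u : Agent N L), c = L * c := fun u => by
    change ∑ _b : Fin L, c = L * c
    simp
  have h2 : ∀ p : Fin L, ∑ _b : Opp (.inr p : Agent N L), c = N * c := fun p => by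
    change ∑ _b : Fin N, c = N * c
    simp
  simp only [h1, h2, Finset.sum_const, Finset.card_univ, Fintype.card_fin, nsmul_eq_mul]
  ring

open Classical in
lemma integral_not_clean_le (hF : Measurable F.mech) {t : ℕ} (ht : 2 ≤ t) :
    ∫ ω, (if E.Clean F t ω then (0 : ℝ) else 1) ∂E.P ≤ 4 * N * L * (t : ℝ) ^ (1 - E.α) := by
  have := E.isProb
  have h1 : ∀ ω, (if E.Clean F t ω then (0 : ℝ) else 1) =
      ({ω | E.Clean F t ω}ᶜ).indicator 1 ω := by
    intro ω
    by_cases h : E.Clean F t ω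
    · rw [if_pos h, Set.indicator_of_notMem (show ω ∉ {ω | E.Clean F t ω}ᶜ from not_not.2 h)]
    · rw [if_neg h, Set.indicator_of_mem (show ω ∈ {ω | E.Clean F t ω}ᶜ from h), Pi.one_apply]
  simp only [h1]
  rw [integral_indicator_one (E.measurableSet_clean hF t).compl]
  have h2 : {ω | E.Clean F t ω}ᶜ ⊆ ⋃ (a : Agent N L), ⋃ (b : Opp a),
      {ω | E.width F E.α t ω a b < |E.noise F t ω a b|} := by
    intro ω hω
    have h3 : ¬ E.Clean F t ω := hω
    simp only [Clean, not_forall, not_le] at h3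
    obtain ⟨a, b, h⟩ := h3
    exact Set.mem_iUnion.2 ⟨a, Set.mem_iUnion.2 ⟨b, h⟩⟩
  refine (measureReal_mono h2).trans ?_
  calc _ ≤ ∑ a : Agent N L, ∑ _b : Opp a, 2 * (t : ℝ) ^ (1 - E.α) := by
        refine (measureReal_iUnion_fintype_le _).trans (Finset.sum_le_sum fun a _ => ?_)
        exact (measureReal_iUnion_fintype_le _).trans (Finset.sum_le_sum fun b _ =>
          E.measureReal_width_lt_le hF E.one_le_alpha ht a b)
    _ = _ := by
        rw [card_pairs]
        ring

open Classical in
/-- The expected number of times at which some confidence interval fails. -/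
lemma sum_integral_not_clean_le (hF : Measurable F.mech) (T : ℕ) :
    ∑ t ∈ Finset.Icc 1 T, ∫ ω, (if E.Clean F t ω then (0 : ℝ) else 1) ∂E.P ≤
      1 + 4 * N * L * ∑ t ∈ Finset.Icc 2 T, (t : ℝ) ^ (1 - E.α) := by
  have := E.isProb
  have h0 : (0 : ℝ) ≤ ∑ t ∈ Finset.Icc 2 T, (t : ℝ) ^ (1 - E.α) :=
    Finset.sum_nonneg fun t _ => by positivity
  rcases Nat.eq_zero_or_pos T with rfl | hT
  · simp
  rw [← Finset.add_sum_Ioc_eq_sum_Icc hT, show Finset.Ioc 1 T = Finset.Icc 2 T from rfl,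
    Finset.mul_sum]
  refine add_le_add ?_ (Finset.sum_le_sum fun t ht =>
    E.integral_not_clean_le hF (Finset.mem_Icc.1 ht).1)
  refine (integral_mono (E.integrable_not_clean hF 1) (integrable_const 1) fun ω => ?_).trans
    (by simp)
  dsimp only
  split_ifs <;> norm_num

lemma sum_integral_excess_le (hF : Measurable F.mech) {β : ℝ} (hβ : 1 ≤ β) (a : Agent N L)
    (b : Opp a) (T : ℕ) :
    ∑ t ∈ Finset.Icc 1 T, ∫ ω, E.excess F β t ω a b ∂E.P ≤
      2 * E.σ * (1 + ∑ t ∈ Finset.Icc 2 T, (t : ℝ) ^ (1 - β)) := by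
  have h0 : (0 : ℝ) ≤ ∑ t ∈ Finset.Icc 2 T, (t : ℝ) ^ (1 - β) :=
    Finset.sum_nonneg fun t _ => by positivity
  rcases Nat.eq_zero_or_pos T with rfl | hT
  · simp
  rw [← Finset.add_sum_Ioc_eq_sum_Icc hT, show Finset.Ioc 1 T = Finset.Icc 2 T from rfl, mul_add,
    mul_one, Finset.mul_sum]
  exact add_le_add (E.integrable_excess_one_and_integral_le hF β a b).2
    (Finset.sum_le_sum fun t ht =>
      (E.integrable_excess_and_integral_le hF hβ (Finset.mem_Icc.1 ht).1 a b).2)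

lemma integrable_excess (hF : Measurable F.mech) {β : ℝ} (hβ : 1 ≤ β) {t : ℕ} (ht : 1 ≤ t)
    (a : Agent N L) (b : Opp a) : Integrable (fun ω => E.excess F β t ω a b) E.P := by
  rcases ht.eq_or_lt with rfl | h
  · exact (E.integrable_excess_one_and_integral_le hF β a b).1
  · exact (E.integrable_excess_and_integral_le hF hβ h a b).1

end Env

/-! ### The expected regret in terms of the information state -/

/-- A bound on the moment generating function that has no linear term forces the mean to vanish. -/
lemma ProbabilityTheory.HasSubgaussianMGF.integral_eq_zero {Ω : Type*}
    {mΩ : MeasurableSpace Ω} {P : Measure Ω} [IsProbabilityMeasure P]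
    {Y : Ω → ℝ} {c : ℝ≥0} (h : HasSubgaussianMGF Y c P) :
    ∫ ω, Y ω ∂P = 0 := by
  set r := ∫ ω, Y ω ∂P with hr
  have key : ∀ l : ℝ, l * r ≤ c * l ^ 2 / 2 := by
    intro l
    have hi : Integrable (fun ω => l * (Y ω - r) + 1) P :=
      ((h.integrable.sub (integrable_const r)).const_mul l).add (integrable_const 1)
    have h1 : Real.exp (l * r) ≤ mgf Y P l := by
      have h2 : ∫ ω, Real.exp (l * r) * (l * (Y ω - r) + 1) ∂P ≤ ∫ ω, Real.exp (l * Y ω) ∂P := by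
        refine integral_mono (hi.const_mul _) (h.integrable_exp_mul l) fun ω => ?_
        calc Real.exp (l * r) * (l * (Y ω - r) + 1)
            ≤ Real.exp (l * r) * Real.exp (l * (Y ω - r)) :=
              mul_le_mul_of_nonneg_left (Real.add_one_le_exp _) (Real.exp_pos _).le
          _ = Real.exp (l * Y ω) := by
              rw [← Real.exp_add]
              congr 1
              ring
      have h3 : ∫ ω, (l * (Y ω - r) + 1) ∂P = 1 := by
        have hi' : Integrable (fun ω => Y ω - r) P := h.integrable.sub (integrable_const r)
        rw [integral_add (hi'.const_mul l) (integrable_const 1), integral_const_mul,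
          integral_sub h.integrable (integrable_const r)]
        simp [← hr]
      rw [integral_const_mul, h3, mul_one] at h2
      exact h2
    exact Real.exp_le_exp.1 (h1.trans (h.mgf_le l))
  have h1 := key (r / (c + 1))
  have hc : (0 : ℝ) < c + 1 := by positivity
  have h2 : r ^ 2 * (c + 1) ≤ c * r ^ 2 / 2 := by
    have e1 : r / (c + 1) * r = r ^ 2 * (c + 1) / (c + 1) ^ 2 := by
      field_simp
    have e2 : (c : ℝ) * (r / (c + 1)) ^ 2 / 2 = c * r ^ 2 / 2 / (c + 1) ^ 2 := by
      field_simp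
    rw [e1, e2] at h1
    exact (div_le_div_iff_of_pos_right (by positivity)).1 h1
  have h3 : r ^ 2 ≤ 0 := by
    have : 0 ≤ (c : ℝ) * r ^ 2 := by positivity
    nlinarith
  exact pow_eq_zero_iff two_ne_zero |>.1 (le_antisymm h3 (sq_nonneg r))

namespace Env

variable {N L : ℕ} {m : Market N L} {Ω : Type u} [mΩ : MeasurableSpace Ω]
variable (E : Env m Ω) {F : Platform N L}

/-- The conditional mean, given the past, of the observed payoff `U_t(a, o)` under proportional
costs of rate `γ`. -/
noncomputable def netValue (γ : ℝ) (F : Platform N L) (t : ℕ) (ω : Ω) (a : Agent N L)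
    (o : Option (Opp a)) : ℝ :=
  m.μ a o - γ * E.ν F t ω a o

/-- The centred reward `X_t(a, o) - μ(a, o)`. -/
noncomputable def innovation (t : ℕ) (ω : Ω) (a : Agent N L) (o : Option (Opp a)) : ℝ :=
  E.reward t ω a o - m.μ a o

lemma innovation_none (t : ℕ) (ω : Ω) (a : Agent N L) : E.innovation t ω a none = 0 := by
  simp [innovation, reward, m.none_eq]

lemma integral_innovation (t : ℕ) (a : Agent N L) (o : Option (Opp a)) :
    Integrable (fun ω => E.innovation t ω a o) E.P ∧ ∫ ω, E.innovation t ω a o ∂E.P = 0 := by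
  have := E.isProb
  cases o with
  | none => simp [innovation_none]
  | some b =>
    exact ⟨(E.subGaussian_X a b t).integrable,
      HasSubgaussianMGF.integral_eq_zero (E.subGaussian_X a b t)⟩

lemma sum_ite_partner {M : Matching N L} {a : Agent N L} (f : Option (Opp a) → ℝ)
    (h0 : f none = 0) :
    ∑ b, (if M.partner a = some b then f (some b) else 0) = f (M.partner a) := by
  cases h : M.partner a with
  | none => simp [h0]
  | some b => simp

/-- The reward of time `t` is independent of the match of time `t`. -/
lemma integral_innovation_matched (hF : Measurable F.mech) {t : ℕ} (ht : 1 ≤ t)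
    (a : Agent N L) :
    Integrable (fun ω => E.innovation t ω a ((E.matched F t ω).partner a)) E.P ∧
      ∫ ω, E.innovation t ω a ((E.matched F t ω).partner a) ∂E.P = 0 := by
  have := E.isProb
  obtain ⟨t, rfl⟩ := Nat.exists_eq_add_of_le' ht
  have hS : ∀ b, MeasurableSet[E.past t] {ω | (E.matched F (t + 1) ω).partner a = some b} :=
    fun b => E.measurableSet_past_partner hF (t + 1) a (some b)
  have h1 : ∀ ω, E.innovation (t + 1) ω a ((E.matched F (t + 1) ω).partner a) = ∑ b,
      {ω | (E.matched F (t + 1) ω).partner a = some b}.indicator 1 ω *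
        (E.X a b (t + 1) ω - m.μ a (some b)) := by
    intro ω
    rw [← sum_ite_partner _ (E.innovation_none (t + 1) ω a)]
    refine Finset.sum_congr rfl fun b _ => ?_
    by_cases h : (E.matched F (t + 1) ω).partner a = some b
    · rw [if_pos h, Set.indicator_of_mem (by exact h), Pi.one_apply, one_mul]
      rfl
    · rw [if_neg h, Set.indicator_of_notMem (by exact h), zero_mul]
  have hind : ∀ b, IndepFun
      ({ω | (E.matched F (t + 1) ω).partner a = some b}.indicator (1 : Ω → ℝ))
      (fun ω => E.X a b (t + 1) ω - m.μ a (some b)) E.P := by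
    intro b
    refine indep_of_indep_of_le_left (indep_of_indep_of_le_right (E.indep_past t a b) ?_) ?_
    · exact ((measurable_id.sub_const (m.μ a (some b))).comp
        (comap_measurable (E.X a b (t + 1)))).comap_le
    · exact Measurable.comap_le ((measurable_const (a := (1 : ℝ))).indicator (hS b))
  have hm : ∀ b, MeasurableSet {ω | (E.matched F (t + 1) ω).partner a = some b} :=
    fun b => E.past_le t _ (hS b)
  have hi : ∀ b, Integrable (fun ω =>
      {ω | (E.matched F (t + 1) ω).partner a = some b}.indicator (1 : Ω → ℝ) ω *
        (E.X a b (t + 1) ω - m.μ a (some b))) E.P := by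
    intro b
    refine ((E.subGaussian_X a b (t + 1)).integrable.indicator (hm b)).congr
      (Eventually.of_forall fun ω => ?_)
    dsimp only
    by_cases h : (E.matched F (t + 1) ω).partner a = some b
    · rw [Set.indicator_of_mem (by exact h), Set.indicator_of_mem (by exact h), Pi.one_apply,
        one_mul]
    · rw [Set.indicator_of_notMem (by exact h), Set.indicator_of_notMem (by exact h), zero_mul]
  simp only [h1]
  refine ⟨integrable_finsetSum _ fun b _ => hi b, ?_⟩
  rw [integral_finsetSum _ fun b _ => hi b]
  refine Finset.sum_eq_zero fun b _ => ?_
  rw [(hind b).integral_fun_mul_eq_mul_integral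
    ((measurable_const (a := (1 : ℝ))).indicator (hm b)).aestronglyMeasurable
    (E.subGaussian_X a b (t + 1)).aestronglyMeasurable,
    HasSubgaussianMGF.integral_eq_zero (E.subGaussian_X a b (t + 1)), mul_zero]

lemma width_le (F : Platform N L) {t : ℕ} (ht : 1 ≤ t) (ω : Ω) (a : Agent N L) (b : Opp a) :
    E.width F E.α t ω a b ≤ Real.sqrt (2 * (E.σ : ℝ) ^ 2 * E.α * Real.log t) := by
  refine (E.width_le_div_sqrt F ht le_rfl ω a b).trans (div_le_self (Real.sqrt_nonneg _) ?_)
  exact Real.one_le_sqrt.2 (by exact_mod_cast E.samples_pos F t ω a b)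

lemma integrable_width (hF : Measurable F.mech) {t : ℕ} (ht : 1 ≤ t) (a : Agent N L) (b : Opp a) :
    Integrable (fun ω => E.width F E.α t ω a b) E.P := by
  have := E.isProb
  refine Integrable.mono' (integrable_const (Real.sqrt (2 * (E.σ : ℝ) ^ 2 * E.α * Real.log t)))
    (E.measurable_width hF E.α t a b).aestronglyMeasurable (Eventually.of_forall fun ω => ?_)
  rw [Real.norm_of_nonneg (E.width_nonneg F _ t ω a b)]
  exact E.width_le F ht ω a b

lemma integrable_noise (hF : Measurable F.mech) {t : ℕ} (ht : 1 ≤ t) (a : Agent N L) (b : Opp a) :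
    Integrable (fun ω => E.noise F t ω a b) E.P :=
  ((E.integrable_width hF ht a b).add (E.integrable_excess hF E.one_le_alpha ht a b)).mono'
    (E.measurable_noise hF t a b).aestronglyMeasurable
    (Eventually.of_forall fun ω => E.abs_noise_le F E.α t ω a b)

lemma integrable_netValue (γ : ℝ) (hF : Measurable F.mech) {t : ℕ} (ht : 1 ≤ t) (a : Agent N L)
    (o : Option (Opp a)) : Integrable (fun ω => E.netValue γ F t ω a o) E.P := by
  have := E.isProb
  refine (integrable_const _).sub (Integrable.const_mul ?_ γ)
  cases o with
  | none => exact integrable_const 0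
  | some b =>
    simp only [ν_some]
    exact ((integrable_const _).add (E.integrable_noise hF ht a b)).add
      (E.integrable_width hF ht a b)

lemma integrable_netValue_matched (γ : ℝ) (hF : Measurable F.mech) {t : ℕ} (ht : 1 ≤ t)
    (a : Agent N L) :
    Integrable (fun ω => E.netValue γ F t ω a ((E.matched F t ω).partner a)) E.P := by
  have h1 : ∀ ω, E.netValue γ F t ω a ((E.matched F t ω).partner a) = ∑ b,
      {ω | (E.matched F t ω).partner a = some b}.indicator
        (fun ω => E.netValue γ F t ω a (some b)) ω := by
    intro ω
    rw [← sum_ite_partner (E.netValue γ F t ω a) (by simp [netValue, ν_none, m.none_eq])]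
    refine Finset.sum_congr rfl fun b _ => ?_
    by_cases h : (E.matched F t ω).partner a = some b
    · rw [if_pos h, Set.indicator_of_mem (by exact h)]
    · rw [if_neg h, Set.indicator_of_notMem (by exact h)]
  simp only [h1]
  exact integrable_finsetSum _ fun b _ => (E.integrable_netValue γ hF ht a (some b)).indicator
    (E.past_le _ _ (E.measurableSet_past_partner hF t a (some b)))

lemma U_proportional {γ : ℝ} {mech : Info N L → Matching N L} (t : ℕ) (ω : Ω) (a : Agent N L)
    (o : Option (Opp a)) : E.U (proportional γ mech) t ω a o =
      E.innovation t ω a o + E.netValue γ (proportional γ mech) t ω a o := by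
  simp only [U, innovation, netValue, proportional]
  ring

section

variable {γ : ℝ} {mech : Info N L → Matching N L}

lemma integral_U (hmech : Measurable mech) {t : ℕ} (ht : 1 ≤ t) (a : Agent N L)
    (o : Option (Opp a)) : ∫ ω, E.U (proportional γ mech) t ω a o ∂E.P =
      ∫ ω, E.netValue γ (proportional γ mech) t ω a o ∂E.P := by
  simp only [U_proportional]
  rw [integral_add (E.integral_innovation t a o).1
    (E.integrable_netValue γ (F := proportional γ mech) hmech ht a o),
    (E.integral_innovation t a o).2, zero_add]

lemma integrable_U (hmech : Measurable mech) {t : ℕ} (ht : 1 ≤ t) (a : Agent N L)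
    (o : Option (Opp a)) : Integrable (fun ω => E.U (proportional γ mech) t ω a o) E.P := by
  simp only [U_proportional]
  exact (E.integral_innovation t a o).1.add
    (E.integrable_netValue γ (F := proportional γ mech) hmech ht a o)

lemma integrable_U_matched (hmech : Measurable mech) {t : ℕ} (ht : 1 ≤ t) (a : Agent N L) :
    Integrable (fun ω => E.U (proportional γ mech) t ω a
      ((E.matched (proportional γ mech) t ω).partner a)) E.P := by
  simp only [U_proportional]
  exact (E.integral_innovation_matched (F := proportional γ mech) hmech ht a).1.add
    (E.integrable_netValue_matched γ (F := proportional γ mech) hmech ht a)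

lemma integral_U_matched (hmech : Measurable mech) {t : ℕ} (ht : 1 ≤ t) (a : Agent N L) :
    ∫ ω, E.U (proportional γ mech) t ω a ((E.matched (proportional γ mech) t ω).partner a) ∂E.P =
      ∫ ω, E.netValue γ (proportional γ mech) t ω a
        ((E.matched (proportional γ mech) t ω).partner a) ∂E.P := by
  simp only [U_proportional]
  rw [integral_add (E.integral_innovation_matched (F := proportional γ mech) hmech ht a).1
    (E.integrable_netValue_matched γ (F := proportional γ mech) hmech ht a),
    (E.integral_innovation_matched (F := proportional γ mech) hmech ht a).2, zero_add]

/-- The expected total shortfall of the matches of `a` compared with the options `o t`. -/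
lemma integral_regret (hmech : Measurable mech) (a : Agent N L) (o : ℕ → Option (Opp a)) (T : ℕ) :
    ∫ ω, ∑ t ∈ Finset.Icc 1 T, (E.U (proportional γ mech) t ω a (o t) -
      E.U (proportional γ mech) t ω a ((E.matched (proportional γ mech) t ω).partner a)) ∂E.P =
    ∑ t ∈ Finset.Icc 1 T, (∫ ω, E.U (proportional γ mech) t ω a (o t) ∂E.P -
      ∫ ω, E.netValue γ (proportional γ mech) t ω a
        ((E.matched (proportional γ mech) t ω).partner a) ∂E.P) := by
  have hi : ∀ t ∈ Finset.Icc 1 T, Integrable (fun ω => E.U (proportional γ mech) t ω a (o t) -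
      E.U (proportional γ mech) t ω a ((E.matched (proportional γ mech) t ω).partner a)) E.P :=
    fun t ht => (E.integrable_U hmech (Finset.mem_Icc.1 ht).1 a (o t)).sub
      (E.integrable_U_matched hmech (Finset.mem_Icc.1 ht).1 a)
  rw [integral_finsetSum _ hi]
  refine Finset.sum_congr rfl fun t ht => ?_
  rw [integral_sub (E.integrable_U hmech (Finset.mem_Icc.1 ht).1 a (o t))
    (E.integrable_U_matched hmech (Finset.mem_Icc.1 ht).1 a),
    E.integral_U_matched hmech (Finset.mem_Icc.1 ht).1 a]

/-! ### The logarithmic bound -/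

variable (γ) in
open Classical in
/-- The optimism in the report on the match costs `γ` times up to two widths. The threshold
`(1 - γ) * m.gapMin / 2` on it is paid by the gap of the true preferences when the match is better
than `o`, and by the factor `3 / 2` when it is worse. -/
lemma netValue_sub_le (hγ₀ : 0 ≤ γ) (hγ₁ : γ < 1) (F : Platform N L) (t : ℕ) (ω : Ω)
    (a : Agent N L) (o : Option (Opp a)) :
    E.netValue γ F t ω a o - E.netValue γ F t ω a ((E.matched F t ω).partner a) ≤
      3 / 2 * ((1 - γ) * m.gapMax a) *
          (if m.μ a ((E.matched F t ω).partner a) < m.μ a o then 1 else 0) +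
        ∑ b, (if (E.matched F t ω).partner a = some b then
          max (2 * γ * E.width F E.α t ω a b - (1 - γ) * m.gapMin / 2) 0 else 0) +
        γ * ∑ b, E.excess F E.α t ω a b := by
  set M := (E.matched F t ω).partner a with hM
  set d := (1 - γ) * m.gapMin / 2 with hd
  have hG := m.gapMin_pos
  have hGD := m.gapMin_le_gapMax a
  have hγ' : 0 < 1 - γ := by linarith
  have hd0 : 0 < d := by positivity
  have hdD : d ≤ (1 - γ) * m.gapMax a / 2 := by
    rw [hd]
    gcongr
  set e : Option (Opp a) → ℝ := fun o => o.elim 0 (E.excess F E.α t ω a) with he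
  set w : Option (Opp a) → ℝ := fun o => o.elim 0 fun b =>
    max (2 * γ * E.width F E.α t ω a b - d) 0 with hw
  have he0 : ∀ o, 0 ≤ e o := by
    rintro (_ | b)
    · exact le_rfl
    · exact E.excess_nonneg F _ t ω a b
  have hw0 : 0 ≤ w M := by
    rcases M with _ | b
    · exact le_rfl
    · exact le_max_right _ _
  have hwM : ∑ b, (if M = some b then
      max (2 * γ * E.width F E.α t ω a b - d) 0 else 0) = w M :=
    sum_ite_partner w rfl
  have hes : 0 ≤ ∑ b, E.excess F E.α t ω a b :=
    Finset.sum_nonneg fun b _ => E.excess_nonneg F _ t ω a b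
  rw [hwM]
  have hlow : -e o ≤ E.ν F t ω a o - m.μ a o := by
    rcases o with _ | b
    · simp [he, E.ν_none, m.none_eq]
    · have h1 := E.abs_noise_le F E.α t ω a b
      have h2 := (abs_le.1 h1).1
      rw [E.ν_some]
      simp only [he, Option.elim_some]
      linarith
  have hup : γ * (E.ν F t ω a M - m.μ a M) ≤ d + w M + γ * e M := by
    rcases M with _ | b
    · simp [he, hw, E.ν_none, m.none_eq, hd0.le]
    · have h1 := E.abs_noise_le F E.α t ω a b
      have h2 := (abs_le.1 h1).2
      rw [E.ν_some]
      simp only [he, hw, Option.elim_some]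
      have h3 := le_max_left (2 * γ * E.width F E.α t ω a b - d) 0
      have h4 := mul_le_mul_of_nonneg_left h2 hγ₀
      linarith
  by_cases hMo : M = o
  · rw [hMo, sub_self, if_neg (lt_irrefl _)]
    rw [hMo] at hw0
    have := mul_nonneg hγ₀ hes
    linarith
  · have hee : e M + e o ≤ ∑ b, E.excess F E.α t ω a b := by
      have hs : ∑ b, E.excess F E.α t ω a b = ∑ o : Option (Opp a), e o := by
        rw [Fintype.sum_option]
        simp [he]
      rw [hs, ← Finset.sum_pair hMo]
      exact Finset.sum_le_sum_of_subset_of_nonneg (Finset.subset_univ _) fun o _ _ => he0 o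
    have hee' := mul_le_mul_of_nonneg_left hee hγ₀
    have hlow' := mul_le_mul_of_nonneg_left hlow hγ₀
    have hmain : E.netValue γ F t ω a o - E.netValue γ F t ω a M ≤
        (1 - γ) * (m.μ a o - m.μ a M) + d + w M + γ * ∑ b, E.excess F E.α t ω a b := by
      simp only [netValue]
      linarith
    split_ifs with h
    · have h1 := mul_le_mul_of_nonneg_left (m.sub_le_gapMax a o M) hγ'.le
      linarith
    · have h1 : m.μ a o < m.μ a M :=
        lt_of_le_of_ne (not_lt.1 h) fun h' => hMo (m.no_ties a h').symm
      have h2 := mul_le_mul_of_nonneg_left (m.gapMin_le_sub h1) hγ'.le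
      have h3 : (1 - γ) * m.gapMin = 2 * d := by
        rw [hd]
        ring
      linarith

lemma sum_max_width_le (hγ₀ : 0 ≤ γ) (F : Platform N L) (ω : Ω) (a : Agent N L) {d : ℝ}
    (hd : 0 < d) (T : ℕ) :
    ∑ t ∈ Finset.Icc 1 T, ∑ b, (if (E.matched F t ω).partner a = some b then
      max (2 * γ * E.width F E.α t ω a b - d) 0 else 0) ≤
      Fintype.card (Opp a) * (8 * γ ^ 2 * (E.σ : ℝ) ^ 2 * E.α * Real.log T / d) := by
  have hα := E.two_lt
  have hlog := Real.log_natCast_nonneg T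
  set B := 2 * γ * Real.sqrt (2 * (E.σ : ℝ) ^ 2 * E.α * Real.log T) with hB
  have hB2 : B ^ 2 / d = 8 * γ ^ 2 * (E.σ : ℝ) ^ 2 * E.α * Real.log T / d := by
    rw [hB, mul_pow, Real.sq_sqrt (by positivity)]
    ring
  rw [Finset.sum_comm, ← hB2, ← nsmul_eq_mul, ← Finset.card_univ, ← Finset.sum_const]
  refine Finset.sum_le_sum fun b _ => ?_
  refine le_trans (Finset.sum_le_sum fun t ht => ?_)
    (E.sum_max_div_sqrt_le F ω a b (B := B) (by positivity) hd T)
  rw [Finset.mem_Icc] at ht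
  have h1 := E.width_le_div_sqrt F ht.1 ht.2 ω a b
  have h2 : 2 * γ * E.width F E.α t ω a b ≤ B / Real.sqrt (E.samples F t ω a b) := by
    rw [hB, mul_div_assoc]
    exact mul_le_mul_of_nonneg_left h1 (by positivity)
  split_ifs
  · exact max_le_max (by linarith) le_rfl
  · exact le_rfl

/-- The expected shortfall of `a` compared with any options `o t` is logarithmic, provided that all
matches worse than these options are due to a wrong ranking of a match. -/
theorem sum_regret_le (hγ₀ : 0 ≤ γ) (hγ₁ : γ < 1) (hmech : Measurable mech) (a : Agent N L)
    (o : ℕ → Option (Opp a)) (T : ℕ)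
    (ho : ∀ t ∈ Finset.Icc 1 T, ∀ ω,
      m.μ a ((E.matched (proportional γ mech) t ω).partner a) < m.μ a (o t) →
        E.Overvalued (proportional γ mech) t ω) :
    ∑ t ∈ Finset.Icc 1 T, (∫ ω, E.U (proportional γ mech) t ω a (o t) ∂E.P -
      ∫ ω, E.netValue γ (proportional γ mech) t ω a
        ((E.matched (proportional γ mech) t ω).partner a) ∂E.P) ≤
    3 / 2 * ((1 - γ) * m.gapMax a) *
        (N * L * (8 * (E.σ : ℝ) ^ 2 * E.α * Real.log T / m.gapMin ^ 2) +
          (1 + 4 * N * L * ∑ t ∈ Finset.Icc 2 T, (t : ℝ) ^ (1 - E.α))) +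
      N * (16 * γ ^ 2 * (E.σ : ℝ) ^ 2 * E.α * Real.log T / ((1 - γ) * m.gapMin)) +
      γ * (N * (2 * E.σ * (1 + ∑ t ∈ Finset.Icc 2 T, (t : ℝ) ^ (1 - E.α)))) := by
  classical
  have := E.isProb
  set F := proportional γ mech with hFdef
  have hF : Measurable F.mech := hmech
  have hG := m.gapMin_pos
  have hGD := m.gapMin_le_gapMax a
  have hγ' : 0 < 1 - γ := by linarith
  have hα := E.two_lt
  have hlog := Real.log_natCast_nonneg T
  have hcard : (Fintype.card (Opp a) : ℝ) ≤ N := by exact_mod_cast m.card_opp_le a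
  have hx : (0 : ℝ) ≤ ∑ t ∈ Finset.Icc 2 T, (t : ℝ) ^ (1 - E.α) :=
    Finset.sum_nonneg fun t _ => by positivity
  set y := 3 / 2 * ((1 - γ) * m.gapMax a) with hy
  have hy0 : 0 ≤ y := by
    have := hG.trans_le hGD
    positivity
  set D : ℕ → Ω → ℝ := fun t ω =>
    E.netValue γ F t ω a (o t) - E.netValue γ F t ω a ((E.matched F t ω).partner a) with hD
  have hDi : ∀ t ∈ Finset.Icc 1 T, Integrable (D t) E.P := fun t ht =>
    (E.integrable_netValue γ hF (Finset.mem_Icc.1 ht).1 a (o t)).sub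
      (E.integrable_netValue_matched γ hF (Finset.mem_Icc.1 ht).1 a)
  set C : ℝ := y * (N * L * (8 * (E.σ : ℝ) ^ 2 * E.α * Real.log T / m.gapMin ^ 2)) +
    N * (16 * γ ^ 2 * (E.σ : ℝ) ^ 2 * E.α * Real.log T / ((1 - γ) * m.gapMin)) with hC
  set R : Ω → ℝ := fun ω => C + y * ∑ t ∈ Finset.Icc 1 T, (if E.Clean F t ω then (0 : ℝ) else 1) +
    γ * ∑ b, ∑ t ∈ Finset.Icc 1 T, E.excess F E.α t ω a b with hR
  have hpt : ∀ ω, ∑ t ∈ Finset.Icc 1 T, D t ω ≤ R ω := by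
    intro ω
    have h1 : ∀ t ∈ Finset.Icc 1 T, D t ω ≤ y * (if E.Overvalued F t ω then (1 : ℝ) else 0) +
        ∑ b, (if (E.matched F t ω).partner a = some b then
          max (2 * γ * E.width F E.α t ω a b - (1 - γ) * m.gapMin / 2) 0 else 0) +
        γ * ∑ b, E.excess F E.α t ω a b := by
      intro t ht
      refine (E.netValue_sub_le γ hγ₀ hγ₁ F t ω a (o t)).trans ?_
      gcongr
      split_ifs with h2 h3 <;> try norm_num
      exact absurd (ho t ht ω h2) h3
    have h2 := E.sum_max_width_le hγ₀ F ω a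
      (by positivity : 0 < (1 - γ) * m.gapMin / 2) T
    have h3 : (Fintype.card (Opp a) : ℝ) *
        (8 * γ ^ 2 * (E.σ : ℝ) ^ 2 * E.α * Real.log T / ((1 - γ) * m.gapMin / 2)) ≤
        N * (16 * γ ^ 2 * (E.σ : ℝ) ^ 2 * E.α * Real.log T / ((1 - γ) * m.gapMin)) := by
      have : 8 * γ ^ 2 * (E.σ : ℝ) ^ 2 * E.α * Real.log T / ((1 - γ) * m.gapMin / 2) =
          16 * γ ^ 2 * (E.σ : ℝ) ^ 2 * E.α * Real.log T / ((1 - γ) * m.gapMin) := by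
        field_simp
        ring
      rw [this]
      gcongr
    have h4 := mul_le_mul_of_nonneg_left (E.sum_overvalued_le F ω T) hy0
    refine (Finset.sum_le_sum h1).trans ?_
    rw [Finset.sum_add_distrib, Finset.sum_add_distrib, ← Finset.mul_sum, ← Finset.mul_sum,
      Finset.sum_comm (s := Finset.Icc 1 T) (f := fun t b => E.excess F E.α t ω a b)]
    simp only [hR, hC]
    linarith
  have hci : ∀ t ∈ Finset.Icc 1 T,
      Integrable (fun ω => if E.Clean F t ω then (0 : ℝ) else 1) E.P :=
    fun t _ => E.integrable_not_clean hF t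
  have hei : ∀ b, ∀ t ∈ Finset.Icc 1 T, Integrable (fun ω => E.excess F E.α t ω a b) E.P :=
    fun b t ht => E.integrable_excess hF E.one_le_alpha (Finset.mem_Icc.1 ht).1 a b
  have hci' : Integrable (fun ω => y * ∑ t ∈ Finset.Icc 1 T,
      (if E.Clean F t ω then (0 : ℝ) else 1)) E.P := (integrable_finsetSum _ hci).const_mul y
  have hei' : Integrable (fun ω => γ * ∑ b, ∑ t ∈ Finset.Icc 1 T, E.excess F E.α t ω a b) E.P :=
    (integrable_finsetSum _ fun b _ => integrable_finsetSum _ (hei b)).const_mul γ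
  have hCi : Integrable (fun ω => C + y * ∑ t ∈ Finset.Icc 1 T,
      (if E.Clean F t ω then (0 : ℝ) else 1)) E.P := (integrable_const C).add hci'
  calc _ = ∫ ω, ∑ t ∈ Finset.Icc 1 T, D t ω ∂E.P := by
        rw [integral_finsetSum _ hDi]
        refine Finset.sum_congr rfl fun t ht => ?_
        rw [E.integral_U hmech (Finset.mem_Icc.1 ht).1,
          integral_sub (E.integrable_netValue γ hF (Finset.mem_Icc.1 ht).1 a (o t))
            (E.integrable_netValue_matched γ hF (Finset.mem_Icc.1 ht).1 a)]
    _ ≤ ∫ ω, R ω ∂E.P := integral_mono (integrable_finsetSum _ hDi) (hCi.add hei') hpt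
    _ = C + y * ∑ t ∈ Finset.Icc 1 T, ∫ ω, (if E.Clean F t ω then (0 : ℝ) else 1) ∂E.P +
        γ * ∑ b, ∑ t ∈ Finset.Icc 1 T, ∫ ω, E.excess F E.α t ω a b ∂E.P := by
      rw [hR, integral_add hCi hei', integral_add (integrable_const C) hci', integral_const_mul,
        integral_const_mul, integral_finsetSum _ hci,
        integral_finsetSum _ fun b _ => integrable_finsetSum _ (hei b)]
      simp only [integral_const, probReal_univ, one_smul]
      congr 2
      exact Finset.sum_congr rfl fun b _ => integral_finsetSum _ (hei b)
    _ ≤ C + y * (1 + 4 * N * L * ∑ t ∈ Finset.Icc 2 T, (t : ℝ) ^ (1 - E.α)) +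
        γ * (N * (2 * E.σ * (1 + ∑ t ∈ Finset.Icc 2 T, (t : ℝ) ^ (1 - E.α)))) := by
      gcongr
      · exact E.sum_integral_not_clean_le hF T
      · calc _ ≤ ∑ _b : Opp a, 2 * E.σ * (1 + ∑ t ∈ Finset.Icc 2 T, (t : ℝ) ^ (1 - E.α)) :=
            Finset.sum_le_sum fun b _ => E.sum_integral_excess_le hF E.one_le_alpha a b T
          _ ≤ _ := by
            rw [Finset.sum_const, Finset.card_univ, nsmul_eq_mul]
            gcongr
    _ = _ := by
      rw [hC]
      ring

end

end Env

/-! ### Incentive compatibility and pessimal regret -/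

lemma sum_rpow_le_log {α : ℝ} (hα : 2 < α) {T : ℕ} (hT : 1 ≤ T) :
    ∑ t ∈ Finset.Icc 2 T, (t : ℝ) ^ (1 - α) ≤ Real.log T := by
  induction T, hT using Nat.le_induction with
  | base => simp
  | succ T hT ih =>
    rw [Finset.sum_Icc_succ_top (by omega)]
    have hT0 : (0 : ℝ) < T := by exact_mod_cast hT
    have h1 : ((T + 1 : ℕ) : ℝ) ^ (1 - α) ≤ ((T + 1 : ℕ) : ℝ)⁻¹ := by
      rw [← Real.rpow_neg_one]
      exact Real.rpow_le_rpow_of_exponent_le (by push_cast; linarith) (by linarith)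
    have h2 := Real.one_sub_inv_le_log_of_pos (x := ((T + 1 : ℕ) : ℝ) / T) (by positivity)
    rw [Real.log_div (by positivity) (by positivity)] at h2
    have h3 : 1 - (((T + 1 : ℕ) : ℝ) / T)⁻¹ = ((T + 1 : ℕ) : ℝ)⁻¹ := by
      push_cast
      field_simp
      ring
    linarith

lemma sum_rpow_le_inv {α : ℝ} (hα : 2 < α) (T : ℕ) :
    ∑ t ∈ Finset.Icc 2 T, (t : ℝ) ^ (1 - α) ≤ 1 / (α - 2) := by
  have hp : 0 < α - 2 := by linarith
  rcases Nat.eq_zero_or_pos T with rfl | hT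
  · simp [hp.le]
  have key : ∑ t ∈ Finset.Icc 2 T, (t : ℝ) ^ (1 - α) ≤ (1 - (T : ℝ) ^ (2 - α)) / (α - 2) := by
    induction T, hT using Nat.le_induction with
    | base => simp
    | succ T hT ih =>
      rw [Finset.sum_Icc_succ_top (by omega)]
      have hT0 : (0 : ℝ) < T := by exact_mod_cast hT
      set s : ℝ := ((T + 1 : ℕ) : ℝ) with hs
      have hs0 : 0 < s := by positivity
      have hsT : s = T + 1 := by rw [hs]; push_cast; ring
      have h2 := Real.one_sub_inv_le_log_of_pos (x := s / T) (by positivity)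
      have h3 : 1 - (s / T)⁻¹ = s⁻¹ := by
        rw [hsT]
        field_simp
        ring
      rw [h3, Real.log_div hs0.ne' hT0.ne'] at h2
      have h4 : s ^ (2 - α) * (1 + (α - 2) * s⁻¹) ≤ (T : ℝ) ^ (2 - α) := by
        have h5 : (T : ℝ) ^ (2 - α) =
            s ^ (2 - α) * Real.exp ((α - 2) * (Real.log s - Real.log T)) := by
          rw [Real.rpow_def_of_pos hT0, Real.rpow_def_of_pos hs0, ← Real.exp_add]
          congr 1
          ring
        rw [h5]
        refine mul_le_mul_of_nonneg_left ?_ (by positivity)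
        have h6 := Real.add_one_le_exp ((α - 2) * (Real.log s - Real.log T))
        have h7 := mul_le_mul_of_nonneg_left h2 hp.le
        linarith
      have h8 : s ^ (1 - α) = s ^ (2 - α) * s⁻¹ := by
        rw [← Real.rpow_neg_one s, ← Real.rpow_add hs0]
        congr 1
        ring
      rw [le_div_iff₀ hp] at ih ⊢
      rw [h8]
      linarith
  refine key.trans ((div_le_div_iff_of_pos_right hp).2 ?_)
  have : (0 : ℝ) ≤ (T : ℝ) ^ (2 - α) := by positivity
  linarith

lemma noise_le_budget {s y x ℓ A : ℝ} (hy : 0 < y) (hx : 0 ≤ x) (hxℓ : x ≤ ℓ)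
    (hℓ : 2 / 3 ≤ ℓ) (hA : 16 * s ^ 2 * ℓ ≤ A * y * y) :
    s * (1 + x) ≤ A * y / 4 + 13 / 8 * y + y * x := by
  refine le_of_mul_le_mul_right ?_ hy
  have h1 : 16 * s ^ 2 * (1 / 3 + x / 2) ≤ A * y * y :=
    (mul_le_mul_of_nonneg_left (by linarith) (by positivity)).trans hA
  have h2 : s * y ≤ 4 / 3 * s ^ 2 + 13 / 8 * y ^ 2 := by nlinarith [sq_nonneg (s - y), sq_nonneg y]
  have h3 : x * (s * y) ≤ x * (2 * s ^ 2 + y ^ 2) := by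
    refine mul_le_mul_of_nonneg_left ?_ hx
    nlinarith [sq_nonneg (s - y), sq_nonneg s, sq_nonneg y]
  linarith

/-- The arithmetic of the pessimal regret bound. The errors of the estimates are of order
`s (1 + x)`, with `s` the standard deviation; by the inequality of arithmetic and geometric means
they are dominated by the logarithmic and the constant part of the bound together. -/
lemma regret_bound_arith {n k g s α ℓ D G x : ℝ} (hn : 2 ≤ n) (hk : 1 ≤ k) (hg₀ : 0 ≤ g)
    (hg₁ : g < 1) (hs : 0 ≤ s) (hα : 2 < α) (hG : 0 < G) (hGD : G ≤ D) (hx : 0 ≤ x) (hxℓ : x ≤ ℓ)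
    (hxα : x ≤ 1 / (α - 2)) (hℓ : g = 0 ∨ 2 / 3 ≤ ℓ) :
    3 / 2 * ((1 - g) * D) * (n * k * (8 * s ^ 2 * α * ℓ / G ^ 2) + (1 + 4 * n * k * x)) +
      n * (16 * g ^ 2 * s ^ 2 * α * ℓ / ((1 - g) * G)) + g * (n * (2 * s * (1 + x))) ≤
    2 * n ^ 2 * k * (1 - g) * D *
      (8 * s ^ 2 * α * ℓ / ((1 - g) ^ 2 * G ^ 2) + α / (α - 2)) := by
  have hg' : 0 < 1 - g := by linarith
  have hℓ0 : 0 ≤ ℓ := hx.trans hxℓ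
  have hD : 0 < D := hG.trans_le hGD
  set y := (1 - g) * D with hy
  have hy0 : 0 < y := by positivity
  set A := 8 * s ^ 2 * α * ℓ / ((1 - g) ^ 2 * G ^ 2) with hA
  have hA0 : 0 ≤ A := by positivity
  set z := 1 / (α - 2) with hz
  have hz0 : 0 < z := by
    have : 0 < α - 2 := by linarith
    positivity
  have hαz : α / (α - 2) = 1 + 2 * z := by
    have : α - 2 ≠ 0 := by linarith
    rw [hz]
    field_simp
    ring
  have h1 : 8 * s ^ 2 * α * ℓ / G ^ 2 ≤ A := by
    have : 8 * s ^ 2 * α * ℓ / G ^ 2 = (1 - g) ^ 2 * A := by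
      rw [hA]
      field_simp
    rw [this]
    exact mul_le_of_le_one_left hA0 (by nlinarith)
  have h2 : 16 * g ^ 2 * s ^ 2 * α * ℓ / ((1 - g) * G) ≤ 2 * (A * y) := by
    have : 16 * g ^ 2 * s ^ 2 * α * ℓ / ((1 - g) * G) = 2 * g ^ 2 * A * ((1 - g) * G) := by
      rw [hA]
      field_simp
      ring
    rw [this, hy]
    have h3 : g ^ 2 ≤ 1 := by nlinarith
    have h4 : (1 - g) * G ≤ (1 - g) * D := by gcongr
    calc 2 * g ^ 2 * A * ((1 - g) * G) ≤ 2 * 1 * A * ((1 - g) * D) := by gcongr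
      _ = _ := by ring
  -- the noise term
  have h3 : g * (2 * s * (1 + x)) ≤ 2 * (A * y / 4 + 13 / 8 * y + y * x) := by
    rcases hℓ with rfl | hℓ
    · rw [zero_mul]
      positivity
    · have hAy : 16 * s ^ 2 * ℓ ≤ A * y * y := by
        have : A * y * y = 8 * s ^ 2 * α * ℓ * (D ^ 2 / G ^ 2) := by
          rw [hA, hy]
          field_simp
        rw [this]
        have h5 : 1 ≤ D ^ 2 / G ^ 2 := by
          rw [le_div_iff₀ (by positivity), one_mul]
          gcongr
        calc 16 * s ^ 2 * ℓ = 8 * s ^ 2 * 2 * ℓ * 1 := by ring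
          _ ≤ 8 * s ^ 2 * α * ℓ * (D ^ 2 / G ^ 2) := by gcongr
      have h6 : s * (1 + x) ≤ A * y / 4 + 13 / 8 * y + y * x := by
        exact noise_le_budget hy0 hx hxℓ hℓ hAy
      have h9 : g * (2 * s * (1 + x)) ≤ 1 * (2 * s * (1 + x)) := by gcongr
      linarith
  have hnk : n ≤ n * k := le_mul_of_one_le_right (by linarith) hk
  have hn2k : 2 * (n * k) ≤ n ^ 2 * k := by
    have := mul_le_mul_of_nonneg_right hn (by positivity : 0 ≤ n * k)
    linarith
  -- the budget left over by the other two terms, `(N² L) (A y / 4 + 13 y / 8 + y x)`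
  have b1 : 3 / 2 * (n * k) + 2 * n + n ^ 2 * k / 4 ≤ 2 * (n ^ 2 * k) := by linarith
  have b2 : 3 / 2 + n ^ 2 * k * (13 / 8) ≤ 2 * (n ^ 2 * k) := by linarith
  have b3 : 6 * (n * k) * x + n ^ 2 * k * x ≤ 4 * (n ^ 2 * k) * z := by
    have h10 : 6 * (n * k) * x + n ^ 2 * k * x ≤ 4 * (n ^ 2 * k) * x := by
      have := mul_le_mul_of_nonneg_right hn2k hx
      linarith
    exact h10.trans (by gcongr)
  have b4 : n * (2 * (A * y / 4 + 13 / 8 * y + y * x)) ≤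
      n ^ 2 * k * (A * y / 4 + 13 / 8 * y + y * x) := by
    have h11 : 0 ≤ A * y / 4 + 13 / 8 * y + y * x := by positivity
    have := mul_le_mul_of_nonneg_right (by linarith : n * 2 ≤ n ^ 2 * k) h11
    linarith
  rw [hαz]
  have e1 : 3 / 2 * y * (n * k * (8 * s ^ 2 * α * ℓ / G ^ 2)) ≤ 3 / 2 * y * (n * k * A) := by
    gcongr
  have e2 : n * (16 * g ^ 2 * s ^ 2 * α * ℓ / ((1 - g) * G)) ≤ n * (2 * (A * y)) := by gcongr
  have e3 : g * (n * (2 * s * (1 + x))) ≤ n * (2 * (A * y / 4 + 13 / 8 * y + y * x)) := by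
    calc _ = n * (g * (2 * s * (1 + x))) := by ring
      _ ≤ _ := by gcongr
  have f1 := mul_le_mul_of_nonneg_right b1 (mul_nonneg hA0 hy0.le)
  have f2 := mul_le_mul_of_nonneg_right b2 hy0.le
  have f3 := mul_le_mul_of_nonneg_right b3 hy0.le
  have e4 : 2 * n ^ 2 * k * (1 - g) * D * (A + (1 + 2 * z)) =
      2 * n ^ 2 * k * y * (A + (1 + 2 * z)) := by
    rw [hy]
    ring
  rw [e4]
  linarith

namespace Env

variable {N L : ℕ} {m : Market N L} {Ω : Type u} [mΩ : MeasurableSpace Ω] (E : Env m Ω)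
variable {γ : ℝ} {mech : Info N L → Matching N L}

lemma matched_mem_stableSet {F : Platform N L} (hGS : F.IsGaleShapley) (t : ℕ) (ω : Ω) :
    E.matched F t ω ∈ stableSet (F.payoff (E.ν F t ω)) :=
  (hGS (E.ν F t ω)).mem_stableSet

/-- A match that is not truly stable has an agent that wrongly ranks its match above a partner in a
blocking pair. -/
lemma overvalued_of_notMem {F : Platform N L} {t : ℕ} {ω : Ω}
    (h : E.matched F t ω ∈ stableSet (E.ν F t ω)) (h' : E.matched F t ω ∉ stableSet m.μ) :
    E.Overvalued F t ω := by
  have h1 : ∃ (u : Fin N) (p : Fin L),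
      m.μ (.inl u) ((E.matched F t ω).user u) < m.μ (.inl u) (some p) ∧
        m.μ (.inr p) ((E.matched F t ω).prov p) < m.μ (.inr p) (some u) := not_not.1 h'
  obtain ⟨u, p, hu, hp⟩ := h1
  by_contra hno
  refine h ⟨u, p, ?_, ?_⟩
  · by_contra h2
    exact hno ⟨.inl u, some p, hu, not_lt.1 h2⟩
  · by_contra h2
    exact hno ⟨.inr p, some u, hp, not_lt.1 h2⟩

lemma optimalMatching_spec {F : Platform N L} (hne : (stableSet (F.payoff m.μ)).Nonempty)
    (a : Agent N L) (t : ℕ) : E.IsOptimal F a t (E.optimalMatching F a t) := by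
  have h : ∃ M, E.IsOptimal F a t M := by
    obtain ⟨M, hM, hmax⟩ := Set.exists_max_image (stableSet (F.payoff m.μ))
      (fun M => ∫ ω, E.U F t ω a (M.partner a) ∂E.P) (Set.toFinite _) hne
    exact ⟨M, hM, hmax⟩
  rw [optimalMatching, dif_pos h]
  exact h.choose_spec

lemma pessimalMatching_spec {F : Platform N L} (hne : (stableSet (F.payoff m.μ)).Nonempty)
    (a : Agent N L) (t : ℕ) : E.IsPessimal F a t (E.pessimalMatching F a t) := by
  have h : ∃ M, E.IsPessimal F a t M := by
    obtain ⟨M, hM, hmin⟩ := Set.exists_min_image (stableSet (F.payoff m.μ))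
      (fun M => ∫ ω, E.U F t ω a (M.partner a) ∂E.P) (Set.toFinite _) hne
    exact ⟨M, hM, hmin⟩
  rw [pessimalMatching, dif_pos h]
  exact h.choose_spec

/-- Compared with the truly worst stable match of `a`, worse matches are not truly stable. -/
theorem pessimalRegret_le (hγ₀ : 0 ≤ γ) (hγ₁ : γ < 1) (hmech : Measurable mech)
    (hGS : (proportional γ mech).IsGaleShapley) {T : ℕ} (hT : 0 < T) (hγT : γ = 0 ∨ 2 ≤ T)
    (a : Agent N L) :
    E.pessimalRegret (proportional γ mech) a T ≤
      2 * (N : ℝ) ^ 2 * L * (1 - γ) * m.gapMax a *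
        (8 * (E.σ : ℝ) ^ 2 * E.α * Real.log T / ((1 - γ) ^ 2 * m.gapMin ^ 2)
          + E.α / (E.α - 2)) := by
  have hα := E.two_lt
  have hG := m.gapMin_pos
  have hGD := m.gapMin_le_gapMax a
  have hlog := Real.log_natCast_nonneg T
  have hγ' : 0 < 1 - γ := by linarith
  have hα' : 0 < E.α - 2 := by linarith
  have hN1 : 1 ≤ N := m.pos.trans_le m.le
  rcases hN1.eq_or_lt with hN | hN
  · have h0 : E.pessimalRegret (proportional γ mech) a T = 0 := by
      have : ∀ ω, ∑ t ∈ Finset.Icc 1 T, (E.U (proportional γ mech) t ω a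
          ((E.pessimalMatching (proportional γ mech) a t).partner a) -
          E.U (proportional γ mech) t ω a
            ((E.matched (proportional γ mech) t ω).partner a)) = 0 := by
        intro ω
        refine Finset.sum_eq_zero fun t _ => ?_
        rw [Matching.partner_eq_of_card_one hN.symm m.pos m.le _
          (E.matched (proportional γ mech) t ω) a,
          sub_self]
      simp only [pessimalRegret, this, integral_zero]
    rw [h0]
    have := hG.trans_le hGD
    positivity
  have hne : (stableSet ((proportional γ mech).payoff m.μ)).Nonempty := ⟨_, (hGS m.μ).mem_stableSet⟩
  obtain ⟨M₁, hM₁, hmin⟩ := Set.exists_min_image (stableSet m.μ) (fun M => m.μ a (M.partner a))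
    (Set.toFinite _) (by rwa [stableSet_proportional_payoff hγ₁] at hne)
  have h1 : E.pessimalRegret (proportional γ mech) a T ≤
      ∑ t ∈ Finset.Icc 1 T, (∫ ω, E.U (proportional γ mech) t ω a (M₁.partner a) ∂E.P -
      ∫ ω, E.netValue γ (proportional γ mech) t ω a
        ((E.matched (proportional γ mech) t ω).partner a) ∂E.P) := by
    rw [pessimalRegret, E.integral_regret hmech]
    refine Finset.sum_le_sum fun t _ => sub_le_sub_right ?_ _
    refine (E.pessimalMatching_spec hne a t).2 M₁ ?_
    rwa [stableSet_proportional_payoff hγ₁]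
  have h2 := E.sum_regret_le hγ₀ hγ₁ hmech a (fun _ => M₁.partner a) T fun t _ ω h => by
    refine E.overvalued_of_notMem ?_ fun h' => (hmin _ h').not_gt h
    have := E.matched_mem_stableSet hGS t ω
    rwa [stableSet_proportional_payoff hγ₁] at this
  refine (h1.trans h2).trans ?_
  refine regret_bound_arith (by exact_mod_cast hN) (by exact_mod_cast m.pos) hγ₀ hγ₁
    E.σ.coe_nonneg hα hG hGD (Finset.sum_nonneg fun t _ => by positivity)
    (sum_rpow_le_log hα hT) (sum_rpow_le_inv hα T) ?_
  refine hγT.imp_right fun h => ?_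
  have h3 : Real.log 2 ≤ Real.log T := Real.log_le_log (by norm_num) (by exact_mod_cast h)
  have := Real.log_two_gt_d9
  linarith

end Env

/-! ### Low social welfare -/

lemma eventually_log_add_le (C K : ℝ) {c : ℝ} (hc : 0 < c) :
    ∀ᶠ T : ℕ in atTop, C * Real.log T + K ≤ c * T := by
  have h1 : (fun T : ℕ => C * Real.log T + K) =o[atTop] fun T : ℕ => (T : ℝ) := by
    refine Asymptotics.IsLittleO.add ?_ ?_
    · exact (Real.isLittleO_log_id_atTop.comp_tendsto tendsto_natCast_atTop_atTop).const_mul_left C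
    · exact Asymptotics.isLittleO_const_left.2 (.inr
        (tendsto_norm_atTop_atTop.comp tendsto_natCast_atTop_atTop))
  filter_upwards [h1.def hc] with T hT
  rw [Real.norm_of_nonneg (by positivity : (0 : ℝ) ≤ T)] at hT
  exact (le_abs_self _).trans hT

/-- One provider, two users. The provider has a slight preference for user `0`, which makes this
match the only stable one, but user `1` gains far more from being matched. -/
noncomputable def welfareMarket : Market 2 1 where
  pos := by norm_num
  le := by norm_num
  μ
    | .inl u => fun o : Option (Fin 1) => o.elim 0 fun _ => if u = 0 then 1 else 100
    | .inr _ => fun o : Option (Fin 2) => o.elim 0 fun u => if u = 0 then 2 else 1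
  nonneg := by
    rintro (u | p) (_ | b)
    · exact le_rfl
    · dsimp only [Option.elim]
      split_ifs <;> norm_num
    · exact le_rfl
    · dsimp only [Option.elim]
      split_ifs <;> norm_num
  none_eq := by
    rintro (u | p) <;> rfl
  no_ties := by
    rintro (u | p)
    · change Function.Injective fun o : Option (Fin 1) =>
        o.elim (0 : ℝ) fun _ => if u = 0 then 1 else 100
      rintro (_ | b) (_ | b') h
      · rfl
      · dsimp only [Option.elim] at h
        split_ifs at h <;> norm_num at h
      · dsimp only [Option.elim] at h
        split_ifs at h <;> norm_num at h
      · rw [Subsingleton.elim b b']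
    · change Function.Injective fun o : Option (Fin 2) =>
        o.elim (0 : ℝ) fun u => if u = 0 then 2 else 1
      rintro (_ | b) (_ | b') h
      · rfl
      · dsimp only [Option.elim] at h
        split_ifs at h <;> norm_num at h
      · dsimp only [Option.elim] at h
        split_ifs at h <;> norm_num at h
      · dsimp only [Option.elim] at h
        split_ifs at h with h1 h2 h2
        · rw [h1, h2]
        · norm_num at h
        · norm_num at h
        · rw [show b = b' by omega]

namespace welfareMarket

lemma prov_cases (M : Matching 2 1) :
    (M.prov 0 = some 0 ∧ M.user 0 = some 0 ∧ M.user 1 = none) ∨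
      (M.prov 0 = some 1 ∧ M.user 0 = none ∧ M.user 1 = some 0) := by
  have hnone : ∀ u, M.prov 0 ≠ some u → M.user u = none := by
    intro u h
    by_contra h'
    obtain ⟨p, hp⟩ := Option.ne_none_iff_exists'.1 h'
    obtain rfl : p = 0 := Subsingleton.elim _ _
    exact h ((M.consistent u 0).1 hp)
  obtain ⟨u, hu⟩ := Option.ne_none_iff_exists'.1 (M.full 0)
  obtain rfl | rfl : u = 0 ∨ u = 1 := by omega
  · exact .inl ⟨hu, (M.consistent 0 0).2 hu, hnone 1 (by simp [hu])⟩
  · exact .inr ⟨hu, hnone 0 (by simp [hu]), (M.consistent 1 0).2 hu⟩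

/-- The matching of the provider with user `1`. -/
def highMatching : Matching 2 1 where
  user u := if u = 1 then some 0 else none
  prov _ := some 1
  consistent u p := by
    obtain rfl : p = 0 := Subsingleton.elim _ _
    obtain rfl | rfl : u = 0 ∨ u = 1 := by omega
    · simp
    · simp
  full := by simp

variable {γ : ℝ} {mech : Info 2 1 → Matching 2 1} {Ω : Type u} [MeasurableSpace Ω]

lemma not_highWelfare (hγ₁ : γ < 1) (E : Env welfareMarket Ω) {t : ℕ} {ω : Ω}
    (hM : (E.matched (proportional γ mech) t ω).prov 0 = some 0)
    (hc : E.Clean (proportional γ mech) t ω)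
    (hw : E.width (proportional γ mech) E.α t ω (.inl 0) (0 : Fin 1) < 1) :
    ¬ E.HighWelfare (proportional γ mech) t ω := by
  set F := proportional γ mech with hF
  intro h
  have hγ' : 0 < 1 - γ := by linarith
  have hle : E.welfare F t ω highMatching ≤ ⨆ M : Matching 2 1, E.welfare F t ω M :=
    le_ciSup (Set.finite_range _).bddAbove _
  have h1 : (1 / 2 : ℝ) * E.welfare F t ω highMatching ≤
      E.welfare F t ω (E.matched F t ω) := by
    refine le_trans ?_ h
    gcongr
  have hwel : ∀ M, E.welfare F t ω M = (1 - γ) * (E.ν F t ω (.inl 0) (M.user 0) +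
      E.ν F t ω (.inl 1) (M.user 1) + E.ν F t ω (.inr 0) (M.prov 0)) := by
    intro M
    simp only [Env.welfare, hF, proportional_payoff, Fintype.sum_sum_type, Fin.sum_univ_two,
      Fin.sum_univ_one, Matching.partner]
    ring
  obtain ⟨-, hu0, hu1⟩ : _ ∧ _ ∧ _ := (prov_cases (E.matched F t ω)).resolve_right fun h' => by
    rw [hM] at h'
    simp at h'
  rw [hwel, hwel, hM, hu0, hu1] at h1
  have e1 : E.ν F t ω (.inl 0) (highMatching.user 0) = 0 := rfl
  have e2 : E.ν F t ω (.inl 1) none = 0 := rfl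
  have l1 : (100 : ℝ) ≤ E.ν F t ω (.inl 1) (highMatching.user 1) :=
    hc.le_ν (.inl 1) (some (0 : Fin 1))
  have l2 : (1 : ℝ) ≤ E.ν F t ω (.inr 0) (highMatching.prov 0) :=
    hc.le_ν (.inr 0) (some (1 : Fin 2))
  have u1 : E.ν F t ω (.inl 0) (some (0 : Fin 1)) ≤
      1 + 2 * E.width F E.α t ω (.inl 0) (0 : Fin 1) :=
    hc.ν_le (.inl 0) (0 : Fin 1)
  have u2 : E.ν F t ω (.inr 0) (some (0 : Fin 2)) ≤
      2 + 2 * E.width F E.α t ω (.inr 0) (0 : Fin 2) :=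
    hc.ν_le (.inr 0) (0 : Fin 2)
  rw [← E.width_symm] at u2
  rw [e1, e2] at h1
  have h2 : (1 / 2 : ℝ) * (0 + E.ν F t ω (.inl 1) (highMatching.user 1) +
      E.ν F t ω (.inr 0) (highMatching.prov 0)) ≤
      E.ν F t ω (.inl 0) (some (0 : Fin 1)) + 0 + E.ν F t ω (.inr 0) (some (0 : Fin 2)) := by
    refine le_of_mul_le_mul_left ?_ hγ'
    linarith
  linarith

lemma overvalued_of_prov_ne (E : Env welfareMarket Ω) {F : Platform 2 1} {t : ℕ} {ω : Ω}
    (h : E.matched F t ω ∈ stableSet (E.ν F t ω)) (hM : (E.matched F t ω).prov 0 ≠ some 0) :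
    E.Overvalued F t ω := by
  obtain ⟨h1, h2, -⟩ := (prov_cases (E.matched F t ω)).resolve_left fun h' => hM h'.1
  refine E.overvalued_of_notMem h fun hS => hS ⟨0, 0, ?_, ?_⟩
  · rw [h2]
    change (0 : ℝ) < 1
    norm_num
  · rw [h1]
    change (1 : ℝ) < 2
    norm_num

/-- The stable match is chosen at most times, and its welfare estimate is soon accurate. -/
theorem eventually_not_highWelfare (hγ₁ : γ < 1) (E : Env welfareMarket Ω)
    (hmech : Measurable mech) (hIC : ∀ T : ℕ, E.IncentiveCompatible (proportional γ mech) T) :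
    ∀ᶠ T : ℕ in atTop, ¬ ∀ᵐ ω ∂E.P, ∀ t ∈ Finset.Icc 1 T,
      E.HighWelfare (proportional γ mech) t ω := by
  classical
  have := E.isProb
  set F := proportional γ mech with hFdef
  have hF : Measurable F.mech := hmech
  have hG := welfareMarket.gapMin_pos
  set C : ℝ := (2 : ℕ) * (1 : ℕ) * (8 * (E.σ : ℝ) ^ 2 * E.α / welfareMarket.gapMin ^ 2) +
    2 * (E.σ : ℝ) ^ 2 * E.α with hC
  set K : ℝ := 2 * (1 + 4 * (2 : ℕ) * (1 : ℕ) * (1 / (E.α - 2))) with hK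
  filter_upwards [eventually_log_add_le C K (c := 1 / 2) (by norm_num), eventually_ge_atTop 1]
    with T hT hT1 hae
  have hα := E.two_lt
  have hlog := Real.log_natCast_nonneg T
  set x : ℝ := 2 * (E.σ : ℝ) ^ 2 * E.α * Real.log T with hx
  have hx0 : 0 ≤ x := by positivity
  set R : Ω → ℝ := fun ω => C * Real.log T +
    2 * ∑ t ∈ Finset.Icc 1 T, (if E.Clean F t ω then (0 : ℝ) else 1) with hR
  have hpt : ∀ ω, (∀ t ∈ Finset.Icc 1 T, E.HighWelfare F t ω) → (T : ℝ) ≤ R ω := by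
    intro ω hω
    have h1 : ∀ t ∈ Finset.Icc 1 T, (1 : ℝ) ≤ (if E.Overvalued F t ω then (1 : ℝ) else 0) +
        (if E.Clean F t ω then (0 : ℝ) else 1) +
        (if (E.matched F t ω).partner (.inl 0) = some (0 : Fin 1) ∧
          (E.samples F t ω (.inl 0) (0 : Fin 1) : ℝ) ≤ x then (1 : ℝ) else 0) := by
      intro t ht
      have hti := Finset.mem_Icc.1 ht
      by_cases ho : E.Overvalued F t ω
      · rw [if_pos ho]
        split_ifs <;> norm_num
      by_cases hc : E.Clean F t ω
      · have hS : E.matched F t ω ∈ stableSet (E.ν F t ω) := by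
          have := hIC T t ht ω
          rwa [stableSet_proportional_payoff hγ₁] at this
        have hM : (E.matched F t ω).prov 0 = some 0 := by
          by_contra h
          exact ho (overvalued_of_prov_ne E hS h)
        have hw : 1 ≤ E.width F E.α t ω (.inl 0) (0 : Fin 1) := by
          by_contra h
          exact not_highWelfare hγ₁ E hM hc (not_le.1 h) (hω t ht)
        have hs := E.samples_le_of_le_width hti.1 hti.2 one_pos hw
        rw [one_pow, div_one] at hs
        rw [if_neg ho, if_pos hc, if_pos ⟨((E.matched F t ω).consistent 0 0).2 hM, hs⟩]
        norm_num
      · rw [if_neg hc]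
        split_ifs <;> norm_num
    have h2 := Finset.sum_le_sum h1
    rw [Finset.sum_add_distrib, Finset.sum_add_distrib, Finset.sum_const, Nat.card_Icc,
      nsmul_eq_mul, mul_one, Nat.add_sub_cancel] at h2
    have h3 := E.sum_overvalued_le F ω T
    have h4 := E.sum_samples_le_le F ω (.inl 0) (0 : Fin 1) hx0 T
    have h5 : C * Real.log T = (2 : ℕ) * (1 : ℕ) *
        (8 * (E.σ : ℝ) ^ 2 * E.α * Real.log T / welfareMarket.gapMin ^ 2) + x := by
      rw [hC, hx]
      ring
    simp only [hR, h5]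
    linarith
  have hci : ∀ t ∈ Finset.Icc 1 T,
      Integrable (fun ω => if E.Clean F t ω then (0 : ℝ) else 1) E.P :=
    fun t _ => E.integrable_not_clean hF t
  have hci' := (integrable_finsetSum _ hci).const_mul 2
  have h6 : (T : ℝ) ≤ ∫ ω, R ω ∂E.P := by
    have := integral_mono_ae (integrable_const (T : ℝ)) ((integrable_const (C * Real.log T)).add
      hci') (hae.mono fun ω hω => hpt ω hω)
    simpa using this
  have h7 : ∫ ω, R ω ∂E.P ≤ C * Real.log T + K := by
    rw [hR, integral_add (integrable_const _) hci', integral_const_mul (2 : ℝ),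
      integral_finsetSum _ hci]
    simp only [integral_const, probReal_univ, one_smul]
    have h8 := E.sum_integral_not_clean_le hF T
    have h9 := sum_rpow_le_inv hα T
    rw [hK]
    gcongr
    refine h8.trans ?_
    gcongr
  have hT' : (1 : ℝ) ≤ T := by exact_mod_cast hT1
  linarith

end welfareMarket

/-! ### Unfairness and linear optimal regret -/

lemma eventually_sum_rpow_le {β : ℝ} (hβ : 1 < β) {c : ℝ} (hc : 0 < c) :
    ∀ᶠ T : ℕ in atTop, ∑ t ∈ Finset.Icc 2 T, (t : ℝ) ^ (1 - β) ≤ c * T := by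
  have h0 : Tendsto (fun n : ℕ => (n : ℝ) ^ (1 - β)) atTop (nhds 0) := by
    have h := (tendsto_rpow_neg_atTop (y := β - 1) (by linarith)).comp
      (tendsto_natCast_atTop_atTop (R := ℝ))
    refine h.congr fun n => ?_
    simp only [Function.comp_apply, neg_sub]
  have h1 := (tendsto_order.1 h0.cesaro).2 (c / 2) (by positivity)
  filter_upwards [(tendsto_add_atTop_nat 1).eventually h1, eventually_ge_atTop 1] with T hT hT1
  have hT1' : (1 : ℝ) ≤ T := by exact_mod_cast hT1
  rw [inv_mul_lt_iff₀ (by positivity)] at hT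
  have h2 : ∑ t ∈ Finset.Icc 2 T, (t : ℝ) ^ (1 - β) ≤
      ∑ t ∈ Finset.range (T + 1), (t : ℝ) ^ (1 - β) := by
    refine Finset.sum_le_sum_of_subset_of_nonneg (fun t ht => ?_) fun t _ _ => by positivity
    rw [Finset.mem_Icc] at ht
    exact Finset.mem_range.2 (by omega)
  push_cast at hT
  nlinarith

/-- Two users and two providers. User `i` prefers provider `i`, and provider `i` prefers the other
user by `δ`. Both perfect matchings are stable; the one that the providers prefer is the worst for
the users. -/
noncomputable def crossedMarket (δ : ℝ) (hδ : 0 < δ) : Market 2 2 where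
  pos := by norm_num
  le := le_rfl
  μ
    | .inl u => fun o : Option (Fin 2) => o.elim 0 fun p => if p = u then 2 else 1
    | .inr p => fun o : Option (Fin 2) => o.elim 0 fun u => if u = p then 1 else 1 + δ
  nonneg := by
    rintro (u | p) (_ | b)
    · exact le_rfl
    · dsimp only [Option.elim]
      split_ifs <;> norm_num
    · exact le_rfl
    · dsimp only [Option.elim]
      split_ifs <;> linarith
  none_eq := by
    rintro (u | p) <;> rfl
  no_ties := by
    rintro (u | p)
    · change Function.Injective fun o : Option (Fin 2) =>
        o.elim (0 : ℝ) fun p => if p = u then 2 else 1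
      rintro (_ | b) (_ | b') h
      · rfl
      · dsimp only [Option.elim] at h
        split_ifs at h <;> norm_num at h
      · dsimp only [Option.elim] at h
        split_ifs at h <;> norm_num at h
      · dsimp only [Option.elim] at h
        split_ifs at h with h1 h2 h2
        · rw [h1, h2]
        · norm_num at h
        · norm_num at h
        · rw [show b = b' by omega]
    · change Function.Injective fun o : Option (Fin 2) =>
        o.elim (0 : ℝ) fun u => if u = p then 1 else 1 + δ
      rintro (_ | b) (_ | b') h
      · rfl
      · dsimp only [Option.elim] at h
        split_ifs at h <;> linarith
      · dsimp only [Option.elim] at h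
        split_ifs at h <;> linarith
      · dsimp only [Option.elim] at h
        split_ifs at h with h1 h2 h2
        · rw [h1, h2]
        · linarith
        · linarith
        · rw [show b = b' by omega]

namespace crossedMarket

lemma matching_cases (M : Matching 2 2) :
    (∀ p, M.prov p = some p.rev) ∨ ∀ p, M.prov p = some p := by
  obtain ⟨u₀, h0⟩ := Option.ne_none_iff_exists'.1 (M.full 0)
  obtain ⟨u₁, h1⟩ := Option.ne_none_iff_exists'.1 (M.full 1)
  have hne : u₀ ≠ u₁ := by
    rintro rfl
    have := ((M.consistent _ _).2 h0).symm.trans ((M.consistent _ _).2 h1)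
    simp at this
  rcases (by omega : (u₀ = 1 ∧ u₁ = 0) ∨ (u₀ = 0 ∧ u₁ = 1)) with ⟨rfl, rfl⟩ | ⟨rfl, rfl⟩
  · left
    intro p
    obtain rfl | rfl : p = 0 ∨ p = 1 := by omega
    · exact h0
    · exact h1
  · right
    intro p
    obtain rfl | rfl : p = 0 ∨ p = 1 := by omega
    · exact h0
    · exact h1

lemma rev_ne (p : Fin 2) : p.rev ≠ p := by
  revert p
  decide

/-- The matching of user `i` with provider `i`. -/
def diagonal : Matching 2 2 where
  user := some
  prov := some
  consistent u p := by simp [eq_comm]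
  full := by simp

variable {γ δ : ℝ} {hδ : 0 < δ} {mech : Info 2 2 → Matching 2 2} {Ω : Type u} [MeasurableSpace Ω]

lemma μ_user_self (u : Fin 2) : (crossedMarket δ hδ).μ (.inl u) (some u) = 2 := if_pos rfl

lemma μ_user_rev (u : Fin 2) : (crossedMarket δ hδ).μ (.inl u) (some u.rev) = 1 :=
  if_neg (rev_ne _)

lemma μ_prov_self (p : Fin 2) : (crossedMarket δ hδ).μ (.inr p) (some p) = 1 := if_pos rfl

lemma μ_prov_rev (p : Fin 2) : (crossedMarket δ hδ).μ (.inr p) (some p.rev) = 1 + δ :=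
  if_neg (rev_ne _)

lemma μ_user_le (u : Fin 2) (o : Option (Fin 2)) :
    (crossedMarket δ hδ).μ (.inl u) o ≤ 2 := by
  rcases o with _ | p
  · rw [Market.none_eq]
    norm_num
  · change (if p = u then (2 : ℝ) else 1) ≤ 2
    split_ifs <;> norm_num

lemma μ_prov_le (p : Fin 2) (o : Option (Fin 2)) :
    (crossedMarket δ hδ).μ (.inr p) o ≤ 1 + δ := by
  rcases o with _ | u
  · rw [Market.none_eq]
    linarith
  · change (if u = p then (1 : ℝ) else 1 + δ) ≤ 1 + δ
    split_ifs <;> linarith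

lemma diagonal_mem_stableSet : diagonal ∈ stableSet (crossedMarket δ hδ).μ := by
  rintro ⟨u, p, h, -⟩
  have h1 : (crossedMarket δ hδ).μ (.inl u) (diagonal.user u) = 2 := μ_user_self u
  rw [h1] at h
  exact h.not_ge (μ_user_le u (some p))

/-- The favourites of the providers differ, so providers that rank truthfully both get them. -/
lemma prov_eq_rev_or_overvalued (hγ₁ : γ < 1) (hGS : (proportional γ mech).IsGaleShapley)
    (E : Env (crossedMarket δ hδ) Ω) (t : ℕ) (ω : Ω) :
    (∀ p, (E.matched (proportional γ mech) t ω).prov p = some p.rev) ∨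
      E.Overvalued (proportional γ mech) t ω := by
  set F := proportional γ mech with hF
  rcases matching_cases (E.matched F t ω) with h | h
  · exact .inl h
  right
  have hγ' : 0 < 1 - γ := by linarith
  by_contra hno
  have hlt : ∀ p : Fin 2, E.ν F t ω (.inr p) (some p) < E.ν F t ω (.inr p) (some p.rev) := by
    intro p
    by_contra h1
    refine hno ⟨.inr p, some p.rev, ?_, ?_⟩
    · change (crossedMarket δ hδ).μ (.inr p) ((E.matched F t ω).prov p) <
        (crossedMarket δ hδ).μ (.inr p) (some p.rev)
      rw [h, μ_prov_self, μ_prov_rev]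
      linarith
    · change E.ν F t ω (.inr p) (some p.rev) ≤ E.ν F t ω (.inr p) ((E.matched F t ω).prov p)
      rw [h]
      exact not_lt.1 h1
  have h2 := (hGS (E.ν F t ω)).prov_eq_of_favourite Fin.rev_injective (fun p u hu => by
    obtain rfl : u = p := by
      revert hu u p
      decide
    rw [hF, proportional_payoff]
    exact mul_lt_mul_of_pos_left (hlt u) hγ') 0
  exact rev_ne 0 (Option.some.inj (h2.symm.trans (h 0)))

/-- Provider `0` has its favourite unless some match is overvalued, so it loses little compared with
any options at all, in particular with the optimal matches. -/
theorem exists_optimalRegret_provider_le (hγ₀ : 0 ≤ γ) (hγ₁ : γ < 1) (hmech : Measurable mech)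
    (hGS : (proportional γ mech).IsGaleShapley) (E : Env (crossedMarket δ hδ) Ω) :
    ∃ C : ℝ, ∀ᶠ T : ℕ in atTop,
      E.optimalRegret (proportional γ mech) (.inr 0) T ≤ C * Real.log T := by
  set G := (crossedMarket δ hδ).gapMin with hGdef
  set y := 3 / 2 * ((1 - γ) * (crossedMarket δ hδ).gapMax (.inr 0)) with hy
  set z := 1 / (E.α - 2) with hz
  have hα := E.two_lt
  have hα' : 0 < E.α - 2 := by linarith
  have hz0 : 0 < z := by positivity
  have hG : 0 < G := (crossedMarket δ hδ).gapMin_pos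
  have hD : 0 < (crossedMarket δ hδ).gapMax (.inr 0) :=
    hG.trans_le ((crossedMarket δ hδ).gapMin_le_gapMax _)
  have hγ' : 0 < 1 - γ := by linarith
  have hy0 : 0 ≤ y := by positivity
  set C₁ : ℝ := y * ((2 : ℕ) * (2 : ℕ) * (8 * (E.σ : ℝ) ^ 2 * E.α / G ^ 2)) +
    (2 : ℕ) * (16 * γ ^ 2 * (E.σ : ℝ) ^ 2 * E.α / ((1 - γ) * G)) with hC₁
  set C₂ : ℝ := y * (1 + 4 * (2 : ℕ) * (2 : ℕ) * z) + γ * ((2 : ℕ) * (2 * E.σ * (1 + z))) with hC₂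
  have hC₂0 : 0 ≤ C₂ := by positivity
  refine ⟨C₁ + C₂, ?_⟩
  filter_upwards [eventually_ge_atTop 3] with T hT
  have hlog : 1 ≤ Real.log T := by
    rw [Real.le_log_iff_exp_le (by positivity)]
    have h3 : (3 : ℝ) ≤ T := by exact_mod_cast hT
    linarith [Real.exp_one_lt_three]
  have h1 := E.sum_regret_le hγ₀ hγ₁ hmech (.inr 0) (fun t =>
    (E.optimalMatching (proportional γ mech) (.inr 0) t).partner (.inr 0)) T fun t _ ω h => by
      refine (prov_eq_rev_or_overvalued hγ₁ hGS E t ω).resolve_left fun h' => ?_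
      have h2 : (E.matched (proportional γ mech) t ω).partner (.inr 0) =
        some ((0 : Fin 2).rev) := h' 0
      rw [h2] at h
      exact h.not_ge ((μ_prov_le 0 _).trans (μ_prov_rev 0).ge)
  rw [Env.optimalRegret, E.integral_regret hmech]
  rw [← hGdef, ← hy] at h1
  refine h1.trans ?_
  have hx := sum_rpow_le_inv hα T
  have h2 : C₂ ≤ C₂ * Real.log T := le_mul_of_one_le_right hC₂0 hlog
  have h3 : y * (1 + 4 * (2 : ℕ) * (2 : ℕ) * ∑ t ∈ Finset.Icc 2 T, (t : ℝ) ^ (1 - E.α)) +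
      γ * ((2 : ℕ) * (2 * E.σ * (1 + ∑ t ∈ Finset.Icc 2 T, (t : ℝ) ^ (1 - E.α)))) ≤ C₂ := by
    rw [hC₂]
    gcongr
  have h4 : C₁ * Real.log T =
      y * ((2 : ℕ) * (2 : ℕ) * (8 * (E.σ : ℝ) ^ 2 * E.α * Real.log T / G ^ 2)) +
      (2 : ℕ) * (16 * γ ^ 2 * (E.σ : ℝ) ^ 2 * E.α * Real.log T / ((1 - γ) * G)) := by
    rw [hC₁]
    ring
  rw [add_mul, h4]
  refine le_of_eq_of_le ?_ (add_le_add_right (h3.trans h2) _)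
  ring

end crossedMarket

namespace Env

variable {N L : ℕ} {m : Market N L} {Ω : Type u} [mΩ : MeasurableSpace Ω] (E : Env m Ω)

/-- Halving the confidence parameter divides the width by `√2`. -/
lemma width_half_le (F : Platform N L) (t : ℕ) (ω : Ω) (a : Agent N L) (b : Opp a) :
    E.width F (E.α / 2) t ω a b ≤ 3 / 4 * E.width F E.α t ω a b := by
  have hα := E.two_lt
  have hlog := Real.log_natCast_nonneg t
  have h1 : E.width F (E.α / 2) t ω a b ^ 2 * 2 = E.width F E.α t ω a b ^ 2 := by
    rw [width, width, Real.sq_sqrt (by positivity), Real.sq_sqrt (by positivity)]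
    ring
  have h2 := E.width_nonneg F E.α t ω a b
  have h3 := E.width_nonneg F (E.α / 2) t ω a b
  nlinarith

end Env

namespace crossedMarket

variable {γ δ : ℝ} {hδ : 0 < δ} {mech : Info 2 2 → Matching 2 2} {Ω : Type u} [MeasurableSpace Ω]

/-- When user `0` is matched to provider `1`, provider `0` does not rank user `0` above user `1`,
or user `0` itself ranks provider `0` below provider `1`. As unsampled pairs have large upper
confidence bounds, the pair of user `0` and provider `0` has been explored: its width is at most
proportional to `δ`, up to the widths of the current matches and to excesses. -/
lemma width_diagonal_le (E : Env (crossedMarket δ hδ) Ω) {F : Platform 2 2} {t : ℕ} {ω : Ω}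
    (hS : E.matched F t ω ∈ stableSet (E.ν F t ω))
    (hM : ∀ p, (E.matched F t ω).prov p = some p.rev) :
    E.width F E.α t ω (.inl 0) (0 : Fin 2) ≤ 4 * (δ +
      2 * (E.width F E.α t ω (.inl 0) (1 : Fin 2) + E.width F E.α t ω (.inr 0) (1 : Fin 2)) +
      ∑ b, E.excess F (E.α / 2) t ω (.inl 0) b + ∑ b, E.excess F (E.α / 2) t ω (.inr 0) b) := by
  have hu : (E.matched F t ω).user 0 = some 1 := ((E.matched F t ω).consistent 0 1).2 (hM 1)
  have hp : (E.matched F t ω).prov 0 = some 1 := hM 0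
  have e1 : ∑ b, E.excess F (E.α / 2) t ω (.inl 0) b =
      E.excess F (E.α / 2) t ω (.inl 0) (0 : Fin 2) +
        E.excess F (E.α / 2) t ω (.inl 0) (1 : Fin 2) := Fin.sum_univ_two _
  have e2 : ∑ b, E.excess F (E.α / 2) t ω (.inr 0) b =
      E.excess F (E.α / 2) t ω (.inr 0) (0 : Fin 2) +
        E.excess F (E.α / 2) t ω (.inr 0) (1 : Fin 2) := Fin.sum_univ_two _
  rw [e1, e2]
  have n1 := E.excess_nonneg F (E.α / 2) t ω (.inl 0) (0 : Fin 2)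
  have n2 := E.excess_nonneg F (E.α / 2) t ω (.inl 0) (1 : Fin 2)
  have n3 := E.excess_nonneg F (E.α / 2) t ω (.inr 0) (0 : Fin 2)
  have n4 := E.excess_nonneg F (E.α / 2) t ω (.inr 0) (1 : Fin 2)
  have w2 := E.width_nonneg F E.α t ω (.inl 0) (1 : Fin 2)
  have w4 := E.width_nonneg F E.α t ω (.inr 0) (1 : Fin 2)
  by_cases h : E.ν F t ω (.inl 0) ((E.matched F t ω).user 0) < E.ν F t ω (.inl 0) (some (0 : Fin 2))
  · have h1 : E.ν F t ω (.inr 0) (some (0 : Fin 2)) ≤ E.ν F t ω (.inr 0) (some (1 : Fin 2)) := by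
      rw [← hp]
      by_contra h'
      exact hS ⟨0, 0, h, not_le.1 h'⟩
    rw [E.ν_some, E.ν_some] at h1
    have v0 : (crossedMarket δ hδ).μ (.inr 0) (some (0 : Fin 2)) = 1 := μ_prov_self 0
    have v1 : (crossedMarket δ hδ).μ (.inr 0) (some (1 : Fin 2)) = 1 + δ := μ_prov_rev 0
    rw [v0, v1] at h1
    have a1 := (abs_le.1 (E.abs_noise_le F (E.α / 2) t ω (.inr 0) (0 : Fin 2))).1
    have a2 := (abs_le.1 (E.abs_noise_le F (E.α / 2) t ω (.inr 0) (1 : Fin 2))).2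
    have b1 := E.width_half_le F t ω (.inr 0) (0 : Fin 2)
    have b2 := E.width_half_le F t ω (.inr 0) (1 : Fin 2)
    rw [E.width_symm F E.α t ω 0 0]
    linarith
  · rw [hu, not_lt, E.ν_some, E.ν_some] at h
    have v0 : (crossedMarket δ hδ).μ (.inl 0) (some (0 : Fin 2)) = 2 := μ_user_self 0
    have v1 : (crossedMarket δ hδ).μ (.inl 0) (some (1 : Fin 2)) = 1 := μ_user_rev 0
    rw [v0, v1] at h
    have a1 := (abs_le.1 (E.abs_noise_le F (E.α / 2) t ω (.inl 0) (0 : Fin 2))).1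
    have a2 := (abs_le.1 (E.abs_noise_le F (E.α / 2) t ω (.inl 0) (1 : Fin 2))).2
    have b1 := E.width_half_le F t ω (.inl 0) (0 : Fin 2)
    have b2 := E.width_half_le F t ω (.inl 0) (1 : Fin 2)
    linarith

open Classical in
/-- User `0` prefers provider `0` by `1`, of which `γ` times the widths and the noise may be lost to
the cost. With `δ = (1 - γ) / 16` the width bound for the diagonal pair leaves `(1 - γ) / 4`, up to
terms whose sums over time are small. -/
lemma le_netValue_sub (hγ₀ : 0 ≤ γ) (hγ₁ : γ < 1) (hδγ : δ = (1 - γ) / 16)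
    (hGS : (proportional γ mech).IsGaleShapley) (E : Env (crossedMarket δ hδ) Ω) (t : ℕ) (ω : Ω) :
    (1 - γ) / 4 - (1 - γ) / 2 * (if E.Overvalued (proportional γ mech) t ω then 1 else 0) -
      16 * ((∑ b, if (E.matched (proportional γ mech) t ω).partner (.inl 0) = some b then
          max (2 * (1 / 2) * E.width (proportional γ mech) E.α t ω (.inl 0) b - (1 - γ) / 128) 0
          else 0) +
        ∑ b, if (E.matched (proportional γ mech) t ω).partner (.inr 0) = some b then
          max (2 * (1 / 2) * E.width (proportional γ mech) E.α t ω (.inr 0) b - (1 - γ) / 128) 0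
          else 0) -
      9 * (∑ b, E.excess (proportional γ mech) (E.α / 2) t ω (.inl 0) b +
        ∑ b, E.excess (proportional γ mech) (E.α / 2) t ω (.inr 0) b) ≤
    E.netValue γ (proportional γ mech) t ω (.inl 0) (some (0 : Fin 2)) -
      E.netValue γ (proportional γ mech) t ω (.inl 0)
        ((E.matched (proportional γ mech) t ω).partner (.inl 0)) := by
  set F := proportional γ mech with hF
  have hγ' : 0 < 1 - γ := by linarith
  have hex : ∀ a : Agent 2 2, 0 ≤ ∑ b, E.excess F (E.α / 2) t ω a b := fun a =>
    Finset.sum_nonneg fun b _ => E.excess_nonneg F _ t ω a b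
  have hmax : ∀ a : Agent 2 2, 0 ≤ ∑ b, if (E.matched F t ω).partner a = some b then
      max (2 * (1 / 2) * E.width F E.α t ω a b - (1 - γ) / 128) 0 else 0 := fun a =>
    Finset.sum_nonneg fun b _ => by
      split_ifs
      · exact le_max_right _ _
      · exact le_rfl
  have hS : E.matched F t ω ∈ stableSet (E.ν F t ω) := by
    have := E.matched_mem_stableSet hGS t ω
    rwa [stableSet_proportional_payoff hγ₁] at this
  have x1 := hex (.inl 0)
  have x2 := hex (.inr 0)
  have x3 := hmax (.inl 0)
  have x4 := hmax (.inr 0)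
  rcases matching_cases (E.matched F t ω) with hM | hM
  · have hu : (E.matched F t ω).partner (.inl 0) = some (1 : Fin 2) :=
      ((E.matched F t ω).consistent 0 1).2 (hM 1)
    have hp : (E.matched F t ω).partner (.inr 0) = some (1 : Fin 2) := hM 0
    have s1 : ∑ b, (if (E.matched F t ω).partner (.inl 0) = some b then
        max (2 * (1 / 2) * E.width F E.α t ω (.inl 0) b - (1 - γ) / 128) 0 else 0) =
        max (2 * (1 / 2) * E.width F E.α t ω (.inl 0) (1 : Fin 2) - (1 - γ) / 128) 0 := by
      rw [Finset.sum_eq_single (1 : Fin 2) (fun b _ hb => if_neg fun h => hb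
        (Option.some.inj (h.symm.trans hu))) (fun h => absurd (Finset.mem_univ _) h), if_pos hu]
    have s2 : ∑ b, (if (E.matched F t ω).partner (.inr 0) = some b then
        max (2 * (1 / 2) * E.width F E.α t ω (.inr 0) b - (1 - γ) / 128) 0 else 0) =
        max (2 * (1 / 2) * E.width F E.α t ω (.inr 0) (1 : Fin 2) - (1 - γ) / 128) 0 := by
      rw [Finset.sum_eq_single (1 : Fin 2) (fun b _ hb => if_neg fun h => hb
        (Option.some.inj (h.symm.trans hp))) (fun h => absurd (Finset.mem_univ _) h), if_pos hp]
    have hw := width_diagonal_le E hS hM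
    rw [s1, s2, hu]
    have m1 := le_max_left
      (2 * (1 / 2) * E.width F E.α t ω (.inl 0) (1 : Fin 2) - (1 - γ) / 128) 0
    have m2 := le_max_left
      (2 * (1 / 2) * E.width F E.α t ω (.inr 0) (1 : Fin 2) - (1 - γ) / 128) 0
    have v0 : (crossedMarket δ hδ).μ (.inl 0) (some (0 : Fin 2)) = 2 := μ_user_self 0
    have v1 : (crossedMarket δ hδ).μ (.inl 0) (some (1 : Fin 2)) = 1 := μ_user_rev 0
    have e1 : ∑ b, E.excess F (E.α / 2) t ω (.inl 0) b =
        E.excess F (E.α / 2) t ω (.inl 0) (0 : Fin 2) +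
          E.excess F (E.α / 2) t ω (.inl 0) (1 : Fin 2) := Fin.sum_univ_two _
    have a1 := (abs_le.1 (E.abs_noise_le F (E.α / 2) t ω (.inl 0) (0 : Fin 2))).2
    have a2 := (abs_le.1 (E.abs_noise_le F (E.α / 2) t ω (.inl 0) (1 : Fin 2))).1
    have b1 := E.width_half_le F t ω (.inl 0) (0 : Fin 2)
    have b2 := E.width_half_le F t ω (.inl 0) (1 : Fin 2)
    have w1 := E.width_nonneg F E.α t ω (.inl 0) (0 : Fin 2)
    have w2 := E.width_nonneg F E.α t ω (.inl 0) (1 : Fin 2)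
    have hdiff : E.netValue γ F t ω (.inl 0) (some (0 : Fin 2)) -
        E.netValue γ F t ω (.inl 0) (some (1 : Fin 2)) = (1 - γ) -
          γ * ((E.noise F t ω (.inl 0) (0 : Fin 2) + E.width F E.α t ω (.inl 0) (0 : Fin 2)) -
            (E.noise F t ω (.inl 0) (1 : Fin 2) + E.width F E.α t ω (.inl 0) (1 : Fin 2))) := by
      simp only [Env.netValue, E.ν_some]
      rw [v0, v1]
      ring
    have hcost : γ * ((E.noise F t ω (.inl 0) (0 : Fin 2) +
          E.width F E.α t ω (.inl 0) (0 : Fin 2)) -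
            (E.noise F t ω (.inl 0) (1 : Fin 2) + E.width F E.α t ω (.inl 0) (1 : Fin 2))) ≤
        2 * E.width F E.α t ω (.inl 0) (0 : Fin 2) + ∑ b, E.excess F (E.α / 2) t ω (.inl 0) b := by
      have h1 : (E.noise F t ω (.inl 0) (0 : Fin 2) + E.width F E.α t ω (.inl 0) (0 : Fin 2)) -
            (E.noise F t ω (.inl 0) (1 : Fin 2) + E.width F E.α t ω (.inl 0) (1 : Fin 2)) ≤
          2 * E.width F E.α t ω (.inl 0) (0 : Fin 2) +
            ∑ b, E.excess F (E.α / 2) t ω (.inl 0) b := by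
        rw [e1]
        linarith
      refine (mul_le_mul_of_nonneg_left h1 hγ₀).trans ?_
      exact mul_le_of_le_one_left (by positivity) hγ₁.le
    rw [hdiff]
    split_ifs
    · linarith
    · linarith
  · have ho : E.Overvalued F t ω :=
      (prov_eq_rev_or_overvalued hγ₁ hGS E t ω).resolve_left fun h => by
        exact rev_ne 0 (Option.some.inj ((h 0).symm.trans (hM 0)))
    have hu : (E.matched F t ω).partner (.inl 0) = some (0 : Fin 2) :=
      ((E.matched F t ω).consistent 0 0).2 (hM 0)
    have h0 : E.netValue γ F t ω (.inl 0) (some (0 : Fin 2)) -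
        E.netValue γ F t ω (.inl 0) ((E.matched F t ω).partner (.inl 0)) = 0 := by
      rw [hu, sub_self]
    rw [h0, if_pos ho]
    linarith

/-- The users keep being matched to their second choices. -/
theorem eventually_le_optimalRegret_user (hγ₀ : 0 ≤ γ) (hγ₁ : γ < 1) (hδγ : δ = (1 - γ) / 16)
    (hmech : Measurable mech) (hGS : (proportional γ mech).IsGaleShapley)
    (E : Env (crossedMarket δ hδ) Ω) :
    ∀ᶠ T : ℕ in atTop,
      (1 - γ) / 8 * T ≤ E.optimalRegret (proportional γ mech) (.inl 0) T := by
  classical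
  have := E.isProb
  set F := proportional γ mech with hFdef
  have hF : Measurable F.mech := hmech
  have hγ' : 0 < 1 - γ := by linarith
  have hα := E.two_lt
  have hβ : 1 < E.α / 2 := by linarith
  set z := 1 / (E.α - 2) with hz
  set d := (1 - γ) / 128 with hd
  have hd0 : 0 < d := by positivity
  set C : ℝ := (1 - γ) / 2 * ((2 : ℕ) * (2 : ℕ) *
      (8 * (E.σ : ℝ) ^ 2 * E.α / (crossedMarket δ hδ).gapMin ^ 2)) +
    16 * (2 * (2 * (8 * (1 / 2) ^ 2 * (E.σ : ℝ) ^ 2 * E.α / d))) with hC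
  set K : ℝ := (1 - γ) / 2 * (1 + 4 * (2 : ℕ) * (2 : ℕ) * z) + 72 * E.σ with hK
  have hq : 0 < (1 - γ) / 16 / (72 * (E.σ + 1)) := by positivity
  filter_upwards [eventually_log_add_le C K (c := (1 - γ) / 16) (by positivity),
    eventually_sum_rpow_le hβ hq] with T hT hT'
  set x : ℝ := ∑ t ∈ Finset.Icc 2 T, (t : ℝ) ^ (1 - E.α / 2) with hx
  have hx0 : 0 ≤ x := Finset.sum_nonneg fun t _ => by positivity
  have hne : (stableSet (F.payoff (crossedMarket δ hδ).μ)).Nonempty :=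
    ⟨_, (hGS (crossedMarket δ hδ).μ).mem_stableSet⟩
  set D : ℕ → Ω → ℝ := fun t ω => E.netValue γ F t ω (.inl 0) (some (0 : Fin 2)) -
    E.netValue γ F t ω (.inl 0) ((E.matched F t ω).partner (.inl 0)) with hD
  have hDi : ∀ t ∈ Finset.Icc 1 T, Integrable (D t) E.P := fun t ht =>
    (E.integrable_netValue γ hF (Finset.mem_Icc.1 ht).1 _ _).sub
      (E.integrable_netValue_matched γ hF (Finset.mem_Icc.1 ht).1 _)
  -- compare with the matching that is optimal for the users
  have hreg : ∫ ω, ∑ t ∈ Finset.Icc 1 T, D t ω ∂E.P ≤ E.optimalRegret F (.inl 0) T := by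
    rw [Env.optimalRegret, E.integral_regret hmech, integral_finsetSum _ hDi]
    refine Finset.sum_le_sum fun t ht => ?_
    have ht1 := (Finset.mem_Icc.1 ht).1
    rw [hD, integral_sub (E.integrable_netValue γ hF ht1 _ _)
      (E.integrable_netValue_matched γ hF ht1 _), ← E.integral_U hmech ht1]
    refine sub_le_sub_right ((E.optimalMatching_spec hne (.inl 0) t).2 diagonal ?_) _
    rw [hFdef, stableSet_proportional_payoff hγ₁]
    exact diagonal_mem_stableSet
  set Ex : Ω → ℝ := fun ω => ∑ b, ∑ t ∈ Finset.Icc 1 T, E.excess F (E.α / 2) t ω (.inl 0) b +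
    ∑ b, ∑ t ∈ Finset.Icc 1 T, E.excess F (E.α / 2) t ω (.inr 0) b with hEx
  set Cl : Ω → ℝ := fun ω => ∑ t ∈ Finset.Icc 1 T, (if E.Clean F t ω then (0 : ℝ) else 1) with hCl
  have hpt : ∀ ω, (1 - γ) / 4 * T - C * Real.log T - (1 - γ) / 2 * Cl ω - 9 * Ex ω ≤
      ∑ t ∈ Finset.Icc 1 T, D t ω := by
    intro ω
    refine le_trans ?_ (Finset.sum_le_sum fun t _ => le_netValue_sub hγ₀ hγ₁ hδγ hGS E t ω)
    rw [Finset.sum_sub_distrib, Finset.sum_sub_distrib, Finset.sum_sub_distrib, Finset.sum_const,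
      Nat.card_Icc, Nat.add_sub_cancel, nsmul_eq_mul, ← Finset.mul_sum, ← Finset.mul_sum,
      ← Finset.mul_sum, Finset.sum_add_distrib, Finset.sum_add_distrib,
      Finset.sum_comm (s := Finset.Icc 1 T) (f := fun t b => E.excess F (E.α / 2) t ω (.inl 0) b),
      Finset.sum_comm (s := Finset.Icc 1 T) (f := fun t b => E.excess F (E.α / 2) t ω (.inr 0) b)]
    have h1 := mul_le_mul_of_nonneg_left (E.sum_overvalued_le F ω T)
      (by positivity : 0 ≤ (1 - γ) / 2)
    have h2 := E.sum_max_width_le (γ := 1 / 2) (by norm_num) F ω (.inl 0) hd0 T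
    have h3 := E.sum_max_width_le (γ := 1 / 2) (by norm_num) F ω (.inr 0) hd0 T
    have c1 : (Fintype.card (Opp (.inl 0 : Agent 2 2)) : ℝ) = 2 := by
      exact_mod_cast Fintype.card_fin 2
    have c2 : (Fintype.card (Opp (.inr 0 : Agent 2 2)) : ℝ) = 2 := by
      exact_mod_cast Fintype.card_fin 2
    rw [c1] at h2
    rw [c2] at h3
    have h4 : C * Real.log T = (1 - γ) / 2 *
        ((2 : ℕ) * (2 : ℕ) *
          (8 * (E.σ : ℝ) ^ 2 * E.α * Real.log T / (crossedMarket δ hδ).gapMin ^ 2)) +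
        16 * (2 * (2 * (8 * (1 / 2) ^ 2 * (E.σ : ℝ) ^ 2 * E.α * Real.log T / d))) := by
      rw [hC]
      ring
    rw [h4]
    simp only [hEx, hCl]
    linarith
  have hci : ∀ t ∈ Finset.Icc 1 T,
      Integrable (fun ω => if E.Clean F t ω then (0 : ℝ) else 1) E.P :=
    fun t _ => E.integrable_not_clean hF t
  have hei : ∀ a, ∀ b, ∀ t ∈ Finset.Icc 1 T,
      Integrable (fun ω => E.excess F (E.α / 2) t ω a b) E.P :=
    fun a b t ht => E.integrable_excess hF hβ.le (Finset.mem_Icc.1 ht).1 a b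
  have hei1 : ∀ a, Integrable
      (fun ω => ∑ b, ∑ t ∈ Finset.Icc 1 T, E.excess F (E.α / 2) t ω a b) E.P :=
    fun a => integrable_finsetSum _ fun b _ => integrable_finsetSum _ (hei a b)
  have hCli : Integrable Cl E.P := integrable_finsetSum _ hci
  have hExi : Integrable Ex E.P := (hei1 (.inl 0)).add (hei1 (.inr 0))
  have hExb : ∀ a : Agent 2 2,
      ∫ ω, ∑ b, ∑ t ∈ Finset.Icc 1 T, E.excess F (E.α / 2) t ω a b ∂E.P ≤
        2 * (2 * E.σ * (1 + x)) := by
    intro a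
    rw [integral_finsetSum _ fun b _ => integrable_finsetSum _ (hei a b)]
    calc _ ≤ ∑ _b : Opp a, 2 * E.σ * (1 + x) := by
          refine Finset.sum_le_sum fun b _ => ?_
          rw [integral_finsetSum _ (hei a b)]
          exact E.sum_integral_excess_le hF hβ.le a b T
      _ ≤ _ := by
          rw [Finset.sum_const, Finset.card_univ, nsmul_eq_mul]
          have : (Fintype.card (Opp a) : ℝ) ≤ 2 := by
            exact_mod_cast (crossedMarket δ hδ).card_opp_le a
          gcongr
  have hExb' : ∫ ω, Ex ω ∂E.P ≤ 8 * E.σ * (1 + x) := by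
    rw [hEx, integral_add (hei1 (.inl 0)) (hei1 (.inr 0))]
    linarith [hExb (.inl 0), hExb (.inr 0)]
  have hClb : ∫ ω, Cl ω ∂E.P ≤ 1 + 4 * (2 : ℕ) * (2 : ℕ) * z := by
    rw [hCl, integral_finsetSum _ hci]
    refine (E.sum_integral_not_clean_le hF T).trans ?_
    have := sum_rpow_le_inv hα T
    gcongr
  have hA : Integrable (fun _ : Ω => (1 - γ) / 4 * T - C * Real.log T) E.P := integrable_const _
  have hB : Integrable (fun ω => (1 - γ) / 4 * T - C * Real.log T - (1 - γ) / 2 * Cl ω) E.P :=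
    hA.sub (hCli.const_mul _)
  have hlow := integral_mono (hB.sub (hExi.const_mul 9)) (integrable_finsetSum _ hDi) hpt
  have hval : ∫ ω, ((1 - γ) / 4 * T - C * Real.log T - (1 - γ) / 2 * Cl ω - 9 * Ex ω) ∂E.P =
      (1 - γ) / 4 * T - C * Real.log T - (1 - γ) / 2 * ∫ ω, Cl ω ∂E.P - 9 * ∫ ω, Ex ω ∂E.P := by
    rw [integral_sub hB (hExi.const_mul 9), integral_sub hA (hCli.const_mul _),
      integral_const_mul, integral_const_mul, integral_const, probReal_univ, one_smul]
  have hlow' := hval.symm.le.trans (hlow.trans hreg)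
  have h5 := mul_le_mul_of_nonneg_left hClb (by positivity : 0 ≤ (1 - γ) / 2)
  have h6 : 72 * E.σ * x ≤ (1 - γ) / 16 * T := by
    have h7 : 72 * E.σ * x ≤ 72 * (E.σ + 1) * x := by gcongr; linarith
    refine h7.trans ((mul_le_mul_of_nonneg_left hT' (by positivity)).trans (le_of_eq ?_))
    field_simp
  rw [hK] at hT
  linarith

end crossedMarket

theorem proposition2 (γ : ℝ) (hγ₀ : 0 ≤ γ) (hγ₁ : γ ≤ 1) :
    -- the Gale-Shapley algorithm gives incentive compatibility
    (∀ (N L : ℕ) (m : Market N L) (Ω : Type u) [MeasurableSpace Ω] (E : Env m Ω)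
        (mech : Info N L → Matching N L), (proportional γ mech).IsGaleShapley →
      ∀ T : ℕ, E.IncentiveCompatible (proportional γ mech) T) ∧
    (γ < 1 →
      -- logarithmic pessimal regret
      (∀ (N L : ℕ) (m : Market N L) (Ω : Type u) [MeasurableSpace Ω] (E : Env m Ω)
          (mech : Info N L → Matching N L), Measurable mech →
          (proportional γ mech).IsGaleShapley →
        ∀ T : ℕ, 0 < T → (γ = 0 ∨ 2 ≤ T) → ∀ a : Agent N L,
          E.pessimalRegret (proportional γ mech) a T ≤
            2 * (N : ℝ) ^ 2 * L * (1 - γ) * m.gapMax a *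
              (8 * (E.σ : ℝ) ^ 2 * E.α * Real.log T / ((1 - γ) ^ 2 * m.gapMin ^ 2)
                + E.α / (E.α - 2))) ∧
      -- fairness is not guaranteed
      (∃ (N L : ℕ) (m : Market N L), ∀ (Ω : Type u) [MeasurableSpace Ω] (E : Env m Ω)
          (mech : Info N L → Matching N L), Measurable mech →
          (proportional γ mech).IsGaleShapley →
        E.Unfair (proportional γ mech)) ∧
      -- high social welfare is not guaranteed, whatever the incentive-compatible mechanism
      (∃ (N L : ℕ) (m : Market N L), ∀ (Ω : Type u) [MeasurableSpace Ω] (E : Env m Ω)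
          (mech : Info N L → Matching N L), Measurable mech →
          (∀ T : ℕ, E.IncentiveCompatible (proportional γ mech) T) →
        ∀ᶠ T : ℕ in atTop, ¬ ∀ᵐ ω ∂E.P, ∀ t ∈ Finset.Icc 1 T,
          E.HighWelfare (proportional γ mech) t ω) ∧
      -- linear optimal regret of some agent
      (∃ (N L : ℕ) (m : Market N L), ∀ (Ω : Type u) [MeasurableSpace Ω] (E : Env m Ω)
          (mech : Info N L → Matching N L), Measurable mech →
          (proportional γ mech).IsGaleShapley →
        ∃ a : Agent N L, ∃ c : ℝ, 0 < c ∧ ∀ᶠ T : ℕ in atTop,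
          c * (T : ℝ) ≤ E.optimalRegret (proportional γ mech) a T)) := by
  refine ⟨fun N L m Ω _ E mech hGS T t _ ω => E.matched_mem_stableSet hGS t ω, fun hγ => ?_⟩
  have hδ : 0 < (1 - γ) / 16 := by linarith
  refine ⟨fun N L m Ω _ E mech hmech hGS T hT hγT a =>
      E.pessimalRegret_le hγ₀ hγ hmech hGS hT hγT a,
    ⟨2, 2, crossedMarket _ hδ, fun Ω _ E mech hmech hGS => ?_⟩,
    ⟨2, 1, welfareMarket, fun Ω _ E mech hmech hIC =>
      welfareMarket.eventually_not_highWelfare hγ E hmech hIC⟩,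
    ⟨2, 2, crossedMarket _ hδ, fun Ω _ E mech hmech hGS => ⟨.inl 0, (1 - γ) / 8, by linarith,
      crossedMarket.eventually_le_optimalRegret_user hγ₀ hγ rfl hmech hGS E⟩⟩⟩
  refine ⟨{.inr 0}, by simp, by simp, .inr 0, by simp, .inl 0, by simp,
    crossedMarket.exists_optimalRegret_provider_le hγ₀ hγ hmech hGS E, fun C => ?_⟩
  filter_upwards [crossedMarket.eventually_le_optimalRegret_user hγ₀ hγ rfl hmech hGS E,
    eventually_log_add_le C 0 (c := (1 - γ) / 8) (by linarith)] with T h1 h2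
  linarith
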